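/- Let $p,q\in\mathbb C$ with $0<|p|,|q|<1$. Put $(q;q)_\infty=\prod_{n\ge1}(1-q^n)$, $\kappa=\frac{(q;q)_\infty(p;p)_\infty}{4\pi i}$ and $$\Gamma(z)=\prod_{j,k=0}^\infty\frac{1-z^{-1}p^{j+1}q^{k+1}}{1-zp^jq^k},\qquad \Gamma(x_1,\dots,x_m)=\prod_i\Gamma(x_i),\qquad \Gamma(xz^{\pm})=\Gamma(xz)\Gamma(xz^{-1}).$$ For $t=(t_1,\dots,t_8)\in\mathbb C^8$ with $\prod_{j=1}^8t_j=p^2q^2$ put $$V(t)=\kappa\int_C\frac{\prod_{j=1}^8\Gamma(t_jz^{\pm})}{\Gamma(z^{2})\Gamma(z^{-2})}\frac{dz}{z},$$ where $C$ is any closed contour which has winding number $1$ around $0$ and around all points $t_jp^aq^b$ and winding number $0$ around all points $t_j^{-1}p^{-a}q^{-b}$ ($1\le j\le 8$, $a,b\in\mathbb Z_{\ge0}$), and passes through none of these points; call $t$ admissible if such a contour exists (for instance, $C$ may be the unit circle if all $|t_j|<1$). In each statement below, both sides may be computed with arbitrary contours of this kind for their respective parameters. 1. If $\varepsilon^2=t_1t_2t_3t_4/(pq)$,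 $s_j=\varepsilon^{-1}t_j$ for $j\le4$ and $s_j=\varepsilon t_j$ for $j\ge5$, and $t,s$ are admissible, then $$\text{(i)}\qquad V(t)=\prod_{1\le j<k\le4}\Gamma(t_jt_k,\,t_{j+4}t_{k+4})\;V(s).$$ 2. If $\tau^2=t_1t_2t_3t_4$, $\upsilon^2=t_5t_6t_7t_8$, $\tau\upsilon=pq$, $u=(\tau/t_1,\dots,\tau/t_4,\upsilon/t_5,\dots,\upsilon/t_8)$, and $t,u$ are admissible, then $$\text{(ii)}\qquad V(t)=\prod_{j,k=1}^4\Gamma(t_jt_{k+4})\;V(u).$$ 3. If $\prod_j s_j=p^2q^2$, $\sigma^2=pq$, $\sigma/s=(\sigma/s_1,\dots,\sigma/s_8)$, and $s,\sigma/s$ are admissible, then $$\text{(iii)}\qquad V(s)=\prod_{1\le j<k\le8}\Gamma(s_js_k)\;V(\sigma/s).$$ 4. ($E_7$ symmetry.) Let $Y=\{x\in\mathbb R^8:\sum_jx_j=0\}$, let $v=\frac12(-1,-1,-1,-1,1,1,1,1)\in Y$, and let $W$ be the group of linear transformations of $Y$ generated by the coordinate permutations and by the reflection $x\mapsto x-\frac{2\langle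 v,x\rangle}{\langle v,v\rangle}v$. Then $W$ is the Weyl group of a root system of type $E_7$ in $Y$. Let $W$ act complex linearly on $Y_{\mathbb C}=Y+iY$, fix $c$ with $c^4=pq$, and put $t(x)_j=c\,e^{2\pi ix_j}$ for $x\in Y_{\mathbb C}$. The vectors $t(x)$ are exactly the $t$ with $\prod_jt_j=p^2q^2$; a coordinate permutation of $x$ permutes the components of $t(x)$; and the reflection in $v$ acts as the map $t\mapsto s$ of part 1, for some $\varepsilon$ with $\varepsilon^2=t_1t_2t_3t_4/(pq)$. Moreover, there are functions $r:\mathbb C\to\mathbb C$ with $r(u)^2=\Gamma(u)$ at every $u\ne0$ that is not a pole of $\Gamma$, and with $r(u)\,r(pq/u)=1$ whenever $u\neq0$ is neither a zero nor a pole of $\Gamma$. For each such choice $r(u)=\sqrt{\Gamma(u)}$, the function $$\frac{V(t(x))}{\prod_{1\le k<l\le8}\sqrt{\Gamma(t(x)_kt(x)_l)}}$$ takes the same value at $x$ and at $wx$, for every $w\in W$ and every $x\in Y_{\mathbb C}$ such that $t(x)$ and $t(wx)$ are admissible and $\Gamma(t(x)_kt(x)_l)\ne0$ for all $k<l$. 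-/

import Mathlib

noncomputable section

namespace EllipticHyp

/-- The infinite `q`-Pochhammer symbol `(q;q)_∞`. -/
def qPoch (q : ℂ) : ℂ := ∏' n : ℕ, (1 - q ^ (n + 1))

/-- The standard elliptic gamma function `Γ(z;p,q)`, for `|p|, |q| < 1` and `z ≠ 0`.
With Lean's division its value at a pole is `0`. -/
def Gam (p q z : ℂ) : ℂ :=
  (∏' n : ℕ × ℕ, (1 - z⁻¹ * p ^ (n.1 + 1) * q ^ (n.2 + 1))) /
    (∏' n : ℕ × ℕ, (1 - z * p ^ n.1 * q ^ n.2))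

/-- A closed contour in the complex plane, parametrised by `[0,1]`: a closed continuous curve,
differentiable outside a finite set of parameters, with integrable derivative.
Closed piecewise `C¹` curves are of this kind. -/
structure Contour where
  toFun : ℝ → ℂ
  continuousOn : ContinuousOn toFun (Set.Icc 0 1)
  closed : toFun 0 = toFun 1
  differentiable : ∃ S : Set ℝ, S.Finite ∧ ∀ x ∈ Set.Ioo (0 : ℝ) 1 \ S, DifferentiableAt ℝ toFun x
  integrable : IntervalIntegrable (deriv toFun) MeasureTheory.volume 0 1

/-- The contour integral `∫_C f(z) dz`. -/
def Contour.integral (C : Contour) (f : ℂ → ℂ) : ℂ :=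
  ∫ x in (0 : ℝ)..1, f (C.toFun x) * deriv C.toFun x

/-- `C` does not pass through `w`. -/
def Contour.Avoids (C : Contour) (w : ℂ) : Prop := ∀ x ∈ Set.Icc (0 : ℝ) 1, C.toFun x ≠ w

/-- The winding number of `C` around a point `w` that `C` avoids. -/
def Contour.winding (C : Contour) (w : ℂ) : ℂ :=
  (2 * Real.pi * Complex.I)⁻¹ * C.integral (fun z => (z - w)⁻¹)

/-- `C` has the point `w` in its interior (and encircles it once counterclockwise). -/
def Contour.Encloses (C : Contour) (w : ℂ) : Prop := C.Avoids w ∧ C.winding w = 1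

/-- `C` has the point `w` in its exterior. -/
def Contour.Excludes (C : Contour) (w : ℂ) : Prop := C.Avoids w ∧ C.winding w = 0

/-- `C` separates the sequences of poles `t_j p^a q^b`, which converge to zero, from the
diverging sequences of poles `t_j⁻¹ p^(-a) q^(-b)`: zero and the former are inside `C`,
the latter are outside. -/
structure Contour.Separates (C : Contour) (p q : ℂ) (t : Fin 8 → ℂ) : Prop where
  zero : C.Encloses 0
  inner : ∀ (j : Fin 8) (a b : ℕ), C.Encloses (t j * p ^ a * q ^ b)
  outer : ∀ (j : Fin 8) (a b : ℕ), C.Excludes (t j * p ^ a * q ^ b)⁻¹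

/-- The integrand `∏_{j=1}^8 Γ(t_j z) Γ(t_j z⁻¹) / (Γ(z²) Γ(z⁻²))`. -/
def integrand (p q : ℂ) (t : Fin 8 → ℂ) (z : ℂ) : ℂ :=
  (∏ j, Gam p q (t j * z) * Gam p q (t j * z⁻¹)) / (Gam p q (z ^ 2) * Gam p q ((z ^ 2)⁻¹))

/-- The elliptic hypergeometric function `V(t;p,q)`, computed with the contour `C`. -/
def V (p q : ℂ) (C : Contour) (t : Fin 8 → ℂ) : ℂ :=
  qPoch q * qPoch p / (4 * Real.pi * Complex.I) * C.integral (fun z => integrand p q t z / z)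

/-- `(t₁, …, t₈) ↦ (ε⁻¹ t₁, …, ε⁻¹ t₄, ε t₅, …, ε t₈)`. -/
def shift (ε : ℂ) (t : Fin 8 → ℂ) (j : Fin 8) : ℂ := if j.val < 4 then ε⁻¹ * t j else ε * t j

/-- `(t₁, …, t₈) ↦ (τ / t₁, …, τ / t₄, υ / t₅, …, υ / t₈)`. -/
def invert (τ υ : ℂ) (t : Fin 8 → ℂ) (j : Fin 8) : ℂ := if j.val < 4 then τ / t j else υ / t j

/-- The hyperplane `x₁ + ⋯ + x₈ = 0` in the Euclidean space `ℝ⁸`. -/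
def Y : Submodule ℝ (EuclideanSpace ℝ (Fin 8)) where
  carrier := {x | ∑ j, x j = 0}
  add_mem' := by
    intro x y hx hy
    simp only [Set.mem_ofPred_eq] at hx hy ⊢
    simp [Finset.sum_add_distrib, hx, hy]
  zero_mem' := by simp
  smul_mem' := by
    intro c x hx
    simp only [Set.mem_ofPred_eq] at hx ⊢
    simp [← Finset.mul_sum, hx]

/-- The vector `v = (e₅ + ⋯ + e₈ - e₁ - ⋯ - e₄) / 2` of `Y`. -/
def vVec : Y :=
  ⟨WithLp.toLp 2 fun j : Fin 8 => if j.val < 4 then -(1 / 2) else 1 / 2, by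
    change ∑ j : Fin 8, (if j.val < 4 then -(1 / 2 : ℝ) else 1 / 2) = 0
    simp [Fin.sum_univ_eight]⟩

/-- The reflection `x ↦ x - 2 ⟨v, x⟩ / ⟨v, v⟩ v` of `Y`. -/
def refl : Y ≃ₗ[ℝ] Y := ((ℝ ∙ vVec)ᗮ).reflection.toLinearEquiv

/-- The permutation of coordinates `x ↦ (j ↦ x_{σ(j)})` of `Y`. -/
def perm (σ : Equiv.Perm (Fin 8)) : Y ≃ₗ[ℝ] Y where
  toFun x := ⟨WithLp.toLp 2 fun j => x.1 (σ j), by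
    change ∑ j, x.1 (σ j) = 0
    rw [Equiv.sum_comp σ fun j => x.1 j]; exact x.2⟩
  invFun x := ⟨WithLp.toLp 2 fun j => x.1 (σ.symm j), by
    change ∑ j, x.1 (σ.symm j) = 0
    rw [Equiv.sum_comp σ.symm fun j => x.1 j]; exact x.2⟩
  map_add' x y := by ext j; simp
  map_smul' c x := by ext j; simp
  left_inv x := by ext j; simp
  right_inv x := by ext j; simp

/-- The group of linear transformations of `Y` generated by the reflection in `v` and the
permutations of coordinates. -/
def symmetryGroup : Subgroup (Y ≃ₗ[ℝ] Y) := Subgroup.closure ({refl} ∪ Set.range perm)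

/-- `G` is the Weyl group of a root system in `E` that has the Cartan matrix `A` with respect
to some base. -/
def IsWeylGroupOfType {E : Type} [AddCommGroup E] [Module ℝ E] {n : ℕ}
    (A : Matrix (Fin n) (Fin n) ℤ) (G : Subgroup (E ≃ₗ[ℝ] E)) : Prop :=
  ∃ (ι : Type) (_ : Finite ι) (P : RootPairing ι ℝ E (Module.Dual ℝ E))
    (_ : P.IsRootSystem) (_ : P.IsCrystallographic) (_ : P.IsReduced)
    (b : P.Base) (e : b.support ≃ Fin n),
    b.cartanMatrix.reindex e e = A ∧
      P.weylGroup.map (RootPairing.Equiv.weightHom P) = G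

/-- The parameters `t_j = c e^{2π i x_j}`, where `x = a + i b` is a complex vector with real and
imaginary parts `a, b ∈ Y`, and `c` is a fourth root of `pq`. -/
def param (c : ℂ) (a b : Y) (j : Fin 8) : ℂ :=
  c * Complex.exp (2 * Real.pi * Complex.I * ((a.1 j : ℂ) + Complex.I * (b.1 j : ℂ)))

/-- `r` is a choice of square roots `√Γ(u;p,q)` that respects the reflection equation
`Γ(u;p,q) Γ(pq/u;p,q) = 1`. The condition `Gam p q u ≠ 0` says that `u` is neither a zero nor
a pole of `Γ`. -/
def IsSqrtGamma (p q : ℂ) (r : ℂ → ℂ) : Prop :=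
  (∀ u, r u ^ 2 = Gam p q u) ∧ ∀ u, u ≠ 0 → Gam p q u ≠ 0 → r u * r (p * q / u) = 1

/-- The normalised function `V(t) / ∏_{k<l} √Γ(t_k t_l)`. -/
def normV (p q : ℂ) (r : ℂ → ℂ) (C : Contour) (t : Fin 8 → ℂ) : ℂ :=
  V p q C t / ∏ k, ∏ l ∈ Finset.Ioi k, r (t k * t l)

end EllipticHyp

end

/-! ### Infinite products, theta functions and the elliptic gamma function -/

noncomputable section

namespace EllipticHyp

open Filter Topology Set

/-! ### Infinite products -/

section LinearProduct

variable {ι : Type*} {a : ι → ℂ}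

/-! The integral is treated as a function of its parameters alone. By the residue theorem in an
annulus it depends on the contour only through winding numbers, so contours may be replaced by
chains of circles. A separating chain exists exactly when no t_j vanishes and no t_j t_k p^a q^b
equals 1 (`admissible_iff`), and the resulting function `hypI` is holomorphic along holomorphic
curves of admissible parameters (`hypI_differentiableAt`).

The first transformation rests on the elliptic beta integral: for six small parameters with product
pq, two of which have a product smaller than q in modulus, the integral equals A ∏ Γ(t_j t_k) with a
constant A (`exists_hypI_eq_mul_pairG`). A theta function identity and a shift of the contour show
that the quotient of both sides is unchanged under (t_j, t_k) ↦ (q t_j, t_k / q) (`theta_identity`,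
`hypI_difference`). As a function of t_j with fixed product t_j t_k it is therefore q-periodic, and
constant by the maximum principle as soon as |t_j t_k| < |q|; changing one pair after another
connects all parameter vectors in question. The value of A is irrelevant, only A ≠ 0 matters. This
is seen from the parameters ±ir, ±a, ±b/r, for which the contour is pinched at ±i as r → 1 and (1 -
r⁴) times the integral has a non-zero limit.

Now consider the double integral of a kernel in z and w that is symmetric under exchanging z with w
and one block of four parameters with the other (`kernelF_symm`). Each of the two orders of
integration allows one integration by the elliptic beta integral; comparing the results gives the
first transformation for small parameters (`hypI_vec8`). Both sides are continued analytically along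
a segment in logarithmic coordinates: only countably many points of the complex line are
inadmissible, so the remaining set is connected (`hypI_shift`).

In the coordinates x the first transformation is the covariance of the integral under the reflection
in v, and the reflection equation of Γ turns the factor into a quotient of products of √Γ.
Covariance under generators passes to products of generators; if an intermediate parameter vector is
inadmissible, x is perturbed in a generic direction and continuity is used (`IsMultiplier.mul`). The
map -1 belongs to the group, being the product of the reflections in seven mutually orthogonal
roots, and this yields the third transformation. The second is the first followed by the third.

For the type of the group, the roots are the vectors of squared length 2 in the lattice spanned by
seven explicit simple roots. Adjacent transpositions and the reflection in v are reflections in such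
roots, and they include all simple reflections. -/

theorem summable_norm_mul_left (ha : Summable fun i => ‖a i‖) (x : ℂ) :
    Summable fun i => ‖-(x * a i)‖ := by
  simpa [norm_mul] using ha.mul_left ‖x‖

theorem multipliable_one_sub (ha : Summable fun i => ‖a i‖) (x : ℂ) :
    Multipliable fun i => 1 - x * a i := by
  simpa [sub_eq_add_neg] using multipliable_one_add_of_summable (summable_norm_mul_left ha x)

theorem tprod_one_sub_eq_zero_iff (ha : Summable fun i => ‖a i‖) (x : ℂ) :
    ∏' i, (1 - x * a i) = 0 ↔ ∃ i, x * a i = 1 := by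
  constructor
  · intro h
    by_contra! hne
    refine tprod_one_add_ne_zero_of_summable (f := fun i => -(x * a i)) (fun i => ?_)
      (summable_norm_mul_left ha x) (by simpa [sub_eq_add_neg] using h)
    simpa [sub_eq_add_neg] using sub_ne_zero.2 (hne i).symm
  · rintro ⟨i, hi⟩
    exact tprod_of_exists_eq_zero ⟨i, by simp [hi]⟩

theorem differentiable_tprod_one_sub (ha : Summable fun i => ‖a i‖) :
    Differentiable ℂ fun x : ℂ => ∏' i, (1 - x * a i) := by
  intro x
  have hU : IsOpen (Metric.ball (0 : ℂ) (‖x‖ + 1)) := Metric.isOpen_ball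
  have h := Summable.hasProdLocallyUniformlyOn_one_add (f := fun i (x : ℂ) => -(x * a i))
    hU (ha.mul_left (‖x‖ + 1))
    (Eventually.of_forall fun i y hy => by
      rw [norm_neg, norm_mul]
      exact mul_le_mul_of_nonneg_right (by simpa using (mem_ball_zero_iff.1 hy).le)
        (norm_nonneg _)) (fun i => by fun_prop)
  rw [hasProdLocallyUniformlyOn_iff_tendstoLocallyUniformlyOn] at h
  have hF : ∀ᶠ s : Finset ι in atTop, DifferentiableOn ℂ
      (fun y : ℂ => ∏ i ∈ s, (1 + -(y * a i))) (Metric.ball (0 : ℂ) (‖x‖ + 1)) :=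
    Eventually.of_forall fun s => DifferentiableOn.fun_finsetProd fun i _ => by fun_prop
  have hd := h.differentiableOn hF hU
  have hx : x ∈ Metric.ball (0 : ℂ) (‖x‖ + 1) := by simp
  simp_rw [sub_eq_add_neg]
  exact hd.differentiableAt (hU.mem_nhds hx)

end LinearProduct

/-- The double product `∏ (1 - x p^a q^b)`. -/
def E (p q x : ℂ) : ℂ := ∏' n : ℕ × ℕ, (1 - x * p ^ n.1 * q ^ n.2)

/-- The infinite Pochhammer symbol `(x;q)_∞`. -/
def poch (q x : ℂ) : ℂ := ∏' n : ℕ, (1 - x * q ^ n)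

/-- The theta function `θ(x;q) = (x;q)_∞ (q/x;q)_∞`. -/
def theta (q x : ℂ) : ℂ := poch q x * poch q (q / x)

variable {p q : ℂ}

theorem summable_norm_pow (hq : ‖q‖ < 1) : Summable fun n : ℕ => ‖q ^ n‖ := by
  simpa using summable_geometric_of_lt_one (norm_nonneg q) hq

theorem summable_norm_pow_mul_pow (hp : ‖p‖ < 1) (hq : ‖q‖ < 1) :
    Summable fun n : ℕ × ℕ => ‖p ^ n.1 * q ^ n.2‖ := by
  simpa using (summable_norm_pow hp).mul_norm (summable_norm_pow hq)

theorem E_eq (p q x : ℂ) : E p q x = ∏' n : ℕ × ℕ, (1 - x * (p ^ n.1 * q ^ n.2)) := by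
  simp only [E, mul_assoc]

theorem E_differentiable (hp : ‖p‖ < 1) (hq : ‖q‖ < 1) : Differentiable ℂ (E p q) := by
  have := differentiable_tprod_one_sub (summable_norm_pow_mul_pow hp hq)
  rwa [show E p q = fun x => ∏' n : ℕ × ℕ, (1 - x * (p ^ n.1 * q ^ n.2)) from
    funext fun x => E_eq p q x]

theorem E_eq_zero_iff (hp : ‖p‖ < 1) (hq : ‖q‖ < 1) (x : ℂ) :
    E p q x = 0 ↔ ∃ a b : ℕ, x * p ^ a * q ^ b = 1 := by
  rw [E_eq, tprod_one_sub_eq_zero_iff (summable_norm_pow_mul_pow hp hq)]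
  simp [mul_assoc]

theorem E_symm (p q x : ℂ) : E p q x = E q p x := by
  rw [E, E, ← (Equiv.prodComm ℕ ℕ).tprod_eq]
  exact tprod_congr fun n => by simp [mul_right_comm]

theorem poch_differentiable (hq : ‖q‖ < 1) : Differentiable ℂ (poch q) :=
  differentiable_tprod_one_sub (summable_norm_pow hq)

theorem poch_eq_zero_iff (hq : ‖q‖ < 1) (x : ℂ) : poch q x = 0 ↔ ∃ n : ℕ, x * q ^ n = 1 :=
  tprod_one_sub_eq_zero_iff (summable_norm_pow hq) x

theorem poch_ne_zero (hq : ‖q‖ < 1) {x : ℂ} (hx : ‖x‖ < 1) : poch q x ≠ 0 := by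
  rw [Ne, poch_eq_zero_iff hq]
  rintro ⟨n, hn⟩
  have h := congrArg norm hn
  rw [norm_mul, norm_pow, norm_one] at h
  have h1 : ‖q‖ ^ n ≤ 1 := pow_le_one₀ (norm_nonneg _) hq.le
  nlinarith [norm_nonneg x, norm_nonneg q]

theorem E_ne_zero (hp : ‖p‖ < 1) (hq : ‖q‖ < 1) {x : ℂ} (hx : ‖x‖ < 1) : E p q x ≠ 0 := by
  rw [Ne, E_eq_zero_iff hp hq]
  rintro ⟨a, b, h⟩
  have h := congrArg norm h
  rw [norm_mul, norm_mul, norm_pow, norm_pow, norm_one] at h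
  have h1 : ‖p‖ ^ a ≤ 1 := pow_le_one₀ (norm_nonneg _) hp.le
  have h2 : ‖q‖ ^ b ≤ 1 := pow_le_one₀ (norm_nonneg _) hq.le
  have h3 : ‖p‖ ^ a * ‖q‖ ^ b ≤ 1 := mul_le_one₀ h1 (by positivity) h2
  have h4 : ‖x‖ * (‖p‖ ^ a * ‖q‖ ^ b) ≤ ‖x‖ * 1 := by gcongr
  rw [← mul_assoc, h] at h4
  linarith

theorem poch_shift (hq : ‖q‖ < 1) (x : ℂ) : poch q x = (1 - x) * poch q (q * x) := by
  have h : HasProd (fun n : ℕ => 1 - x * q ^ (n + 1)) (poch q (q * x)) := by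
    refine (multipliable_one_sub (summable_norm_pow hq) (q * x)).hasProd.congr_fun fun n => ?_
    ring
  have h2 := (multipliable_one_sub (summable_norm_pow hq) x).hasProd.unique
    (HasProd.zero_mul (f := fun n : ℕ => 1 - x * q ^ n) h)
  rwa [pow_zero, mul_one] at h2

/-- Grouping the double product by the exponent of p gives ∏_a (x p^a; q)_∞, from which the factor
with a = 0 is split off. -/
theorem E_shift_left (hp : ‖p‖ < 1) (hq : ‖q‖ < 1) (x : ℂ) :
    E p q x = poch q x * E p q (p * x) := by
  have h (x : ℂ) : HasProd (fun a : ℕ => poch q (x * p ^ a)) (E p q x) := by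
    have h1 := (multipliable_one_sub (summable_norm_pow_mul_pow hp hq) x).hasProd
    rw [← E_eq] at h1
    refine h1.prod_fiberwise fun a => ?_
    refine (multipliable_one_sub (summable_norm_pow hq) (x * p ^ a)).hasProd.congr_fun fun n => ?_
    ring
  have h2 : HasProd (fun a : ℕ => poch q (x * p ^ (a + 1))) (E p q (p * x)) := by
    refine (h (p * x)).congr_fun fun n => ?_
    ring_nf
  simpa using (h x).unique (HasProd.zero_mul (f := fun a : ℕ => poch q (x * p ^ a)) h2)

theorem E_shift_right (hp : ‖p‖ < 1) (hq : ‖q‖ < 1) (x : ℂ) :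
    E p q x = poch p x * E p q (q * x) := by
  rw [E_symm, E_shift_left hq hp, E_symm]

/-! ### Theta functions -/

theorem theta_div (hq0 : q ≠ 0) (x : ℂ) : theta q (q / x) = theta q x := by
  rw [theta, theta, div_div_cancel₀ hq0, mul_comm]

theorem theta_mul (hq0 : q ≠ 0) (hq : ‖q‖ < 1) {x : ℂ} (hx : x ≠ 0) :
    theta q (q * x) = -x⁻¹ * theta q x := by
  have h1 : q / (q * x) = x⁻¹ := by field_simp
  rw [theta, theta, h1, poch_shift hq x, poch_shift hq x⁻¹, ← div_eq_mul_inv q]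
  field_simp
  ring

theorem theta_inv (hq0 : q ≠ 0) (hq : ‖q‖ < 1) {x : ℂ} (hx : x ≠ 0) :
    theta q x⁻¹ = -x⁻¹ * theta q x := by
  rw [← theta_mul hq0 hq hx, ← theta_div hq0 x⁻¹]
  simp

theorem theta_zpow_mul_eq_zero (hq0 : q ≠ 0) (hq : ‖q‖ < 1) {x : ℂ} (hx : x ≠ 0) (k : ℤ) :
    theta q (q ^ k * x) = 0 ↔ theta q x = 0 := by
  induction k with
  | zero => simp
  | succ k ih =>
    rw [← ih, zpow_add_one₀ hq0, mul_comm _ q, mul_assoc, theta_mul hq0 hq (by positivity)]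
    simp [hq0, hx]
  | pred k ih =>
    rw [← ih, show q ^ (-(k : ℤ)) * x = q * (q ^ (-(k : ℤ) - 1) * x) by
      rw [zpow_sub_one₀ hq0]; field_simp, theta_mul hq0 hq (by positivity)]
    simp [hq0, hx, zpow_ne_zero]

theorem theta_one (hq : ‖q‖ < 1) : theta q 1 = 0 := by
  rw [theta, (poch_eq_zero_iff hq 1).2 ⟨0, by simp⟩, zero_mul]

theorem theta_eq_zero_iff (hq0 : q ≠ 0) (hq : ‖q‖ < 1) {x : ℂ} (hx : x ≠ 0) :
    theta q x = 0 ↔ ∃ k : ℤ, x = q ^ k := by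
  constructor
  · intro h
    rcases mul_eq_zero.1 h with h | h
    · obtain ⟨n, hn⟩ := (poch_eq_zero_iff hq _).1 h
      exact ⟨-n, by rw [zpow_neg, zpow_natCast]; exact eq_inv_of_mul_eq_one_left hn⟩
    · obtain ⟨n, hn⟩ := (poch_eq_zero_iff hq _).1 h
      refine ⟨n + 1, ?_⟩
      rw [zpow_add_one₀ hq0, zpow_natCast]
      field_simp at hn
      rw [← hn, mul_comm]
  · rintro ⟨k, rfl⟩
    have := theta_zpow_mul_eq_zero hq0 hq one_ne_zero k
    rw [mul_one] at this
    exact this.2 (theta_one hq)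

theorem theta_differentiableAt (hq : ‖q‖ < 1) {x : ℂ} (hx : x ≠ 0) :
    DifferentiableAt ℂ (theta q) x := by
  have h := poch_differentiable hq
  exact (h x).mul ((h (q / x)).comp x (by fun_prop (disch := assumption)))

theorem deriv_theta_one (hq : ‖q‖ < 1) : deriv (theta q) 1 ≠ 0 := by
  have h := poch_differentiable hq
  have h1 : theta q = fun x => (1 - x) * (poch q (q * x) * poch q (q / x)) := by
    funext x
    rw [theta, poch_shift hq x, mul_assoc]
  have h2 : HasDerivAt (fun x => (1 - x) * (poch q (q * x) * poch q (q / x)))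
      (-1 * (poch q (q * 1) * poch q (q / 1)) +
        (1 - 1) * deriv (fun x => poch q (q * x) * poch q (q / x)) 1) 1 := by
    refine HasDerivAt.mul ((hasDerivAt_id (1 : ℂ)).const_sub 1) (DifferentiableAt.hasDerivAt ?_)
    refine DifferentiableAt.mul ((h _).comp 1 (by fun_prop)) ((h _).comp 1 ?_)
    exact (differentiableAt_const q).div differentiableAt_id one_ne_zero
  rw [h1, h2.deriv]
  simpa using poch_ne_zero hq hq

/-- Differentiating θ(qx) = -x⁻¹ θ(x) at a zero leaves only the term with θ'. Hence the simplicity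
of the zero at 1 propagates along the powers of q. -/
theorem deriv_theta_mul_ne_zero (hq0 : q ≠ 0) (hq : ‖q‖ < 1) {x : ℂ} (hx : x ≠ 0)
    (h0 : theta q x = 0) : deriv (theta q) (q * x) ≠ 0 ↔ deriv (theta q) x ≠ 0 := by
  have h1 : HasDerivAt (fun y => theta q (q * y)) (deriv (theta q) (q * x) * q) x := by
    have := (theta_differentiableAt hq (mul_ne_zero hq0 hx)).hasDerivAt
    exact this.comp x (by simpa using (hasDerivAt_id x).const_mul q)
  have h2 : HasDerivAt (fun y => -y⁻¹ * theta q y)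
      (-(-(x ^ 2)⁻¹) * theta q x + -x⁻¹ * deriv (theta q) x) x :=
    (hasDerivAt_inv hx).neg.mul (theta_differentiableAt hq hx).hasDerivAt
  have h3 : (fun y => theta q (q * y)) =ᶠ[𝓝 x] fun y => -y⁻¹ * theta q y := by
    filter_upwards [isOpen_ne.mem_nhds hx] with y hy using theta_mul hq0 hq hy
  have h4 := h1.unique (h2.congr_of_eventuallyEq h3)
  rw [h0, mul_zero, zero_add] at h4
  rw [not_iff_not]
  constructor
  · intro h
    rw [h, zero_mul] at h4
    simpa [hx] using h4.symm
  · intro h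
    rw [h, mul_zero] at h4
    simpa [hq0] using h4

theorem deriv_theta_ne_zero (hq0 : q ≠ 0) (hq : ‖q‖ < 1) {x : ℂ} (hx : x ≠ 0)
    (h0 : theta q x = 0) : deriv (theta q) x ≠ 0 := by
  obtain ⟨k, rfl⟩ := (theta_eq_zero_iff hq0 hq hx).1 h0
  clear h0 hx
  have hz (k : ℤ) : theta q (q ^ k) = 0 :=
    (theta_eq_zero_iff hq0 hq (zpow_ne_zero k hq0)).2 ⟨k, rfl⟩
  induction k with
  | zero => simpa using deriv_theta_one hq
  | succ k ih =>
    rw [zpow_add_one₀ hq0, mul_comm]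
    exact (deriv_theta_mul_ne_zero hq0 hq (zpow_ne_zero _ hq0) (hz _)).2 ih
  | pred k ih =>
    rw [show q ^ (-(k : ℤ)) = q * q ^ (-(k : ℤ) - 1) by rw [zpow_sub_one₀ hq0]; field_simp] at ih
    exact (deriv_theta_mul_ne_zero hq0 hq (zpow_ne_zero _ hq0) (hz _)).1 ih

/-! ### The elliptic gamma function -/

theorem Gam_eq (p q z : ℂ) : Gam p q z = E p q (p * q / z) / E p q z := by
  rw [Gam, E, E]
  congr 1
  exact tprod_congr fun n => by ring

theorem Gam_reflect (hp0 : p ≠ 0) (hq0 : q ≠ 0) (z : ℂ) :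
    Gam p q (p * q / z) = (Gam p q z)⁻¹ := by
  rw [Gam_eq, Gam_eq, div_div_cancel₀ (mul_ne_zero hp0 hq0), inv_div]

theorem Gam_differentiableAt (hp : ‖p‖ < 1) (hq : ‖q‖ < 1) {z : ℂ} (hz : z ≠ 0)
    (hE : E p q z ≠ 0) : DifferentiableAt ℂ (Gam p q) z := by
  have h := E_differentiable hp hq
  rw [show Gam p q = fun z => E p q (p * q / z) / E p q z from funext fun z => Gam_eq p q z]
  exact DifferentiableAt.div ((h _).comp z (by fun_prop (disch := assumption))) (h z) hE

theorem Gam_shift (hp : ‖p‖ < 1) (hq : ‖q‖ < 1) (hq0 : q ≠ 0) {z : ℂ}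
    (hE : E p q z ≠ 0) : Gam p q (q * z) = theta p z * Gam p q z := by
  rw [E_shift_right hp hq] at hE
  obtain ⟨h1, h2⟩ := mul_ne_zero_iff.1 hE
  have h3 : p * q / (q * z) = p / z := by
    rw [mul_comm p q, mul_div_mul_left _ _ hq0]
  rw [Gam_eq, Gam_eq, theta, E_shift_right hp hq z, h3, E_shift_right hp hq (p / z),
    show q * (p / z) = p * q / z by ring]
  field_simp

/-- The hypotheses exclude points where one gamma factor is 0 and the other has a pole. There the
left side has the default value 0 although the singularity is removable and the right side need not
vanish. -/
theorem inv_Gam_mul_Gam_inv (hp : ‖p‖ < 1) (hq : ‖q‖ < 1) {x : ℂ}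
    (h1 : E p q (p * q / x) ≠ 0) (h2 : E p q (p * q * x) ≠ 0) :
    (Gam p q x * Gam p q x⁻¹)⁻¹ = theta p x * theta q x⁻¹ := by
  have e1 : E p q x⁻¹ = poch q x⁻¹ * (poch p (p / x) * E p q (p * q / x)) := by
    rw [E_shift_left hp hq, E_shift_right hp hq (p * x⁻¹)]
    ring_nf
  have e2 : E p q x = poch p x * (poch q (q * x) * E p q (p * q * x)) := by
    rw [E_shift_right hp hq, E_shift_left hp hq (q * x)]
    ring_nf
  rw [Gam_eq, Gam_eq, e1, e2, theta, theta, div_inv_eq_mul, div_inv_eq_mul]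
  field_simp

end EllipticHyp

end

/-! ### Contour integrals and the residue theorem in an annulus -/

noncomputable section

namespace EllipticHyp

open Filter Topology Set

/-! ### Contour integrals -/

namespace Contour

variable (C : Contour)

theorem intervalIntegrable {f : ℂ → ℂ} (hf : ContinuousOn (fun x => f (C.toFun x)) (Icc 0 1)) :
    IntervalIntegrable (fun x => f (C.toFun x) * deriv C.toFun x) MeasureTheory.volume 0 1 :=
  C.integrable.continuousOn_mul (by rwa [uIcc_of_le zero_le_one])

theorem continuousOn_comp {f : ℂ → ℂ} (hf : ∀ x ∈ Icc (0 : ℝ) 1, ContinuousAt f (C.toFun x)) :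
    ContinuousOn (fun x => f (C.toFun x)) (Icc 0 1) := fun x hx =>
  (hf x hx).comp_continuousWithinAt (C.continuousOn x hx)

/-- The fundamental theorem of calculus along a closed contour. -/
theorem integral_eq_zero_of_primitive {f H : ℂ → ℂ}
    (hf : ContinuousOn (fun x => f (C.toFun x)) (Icc 0 1))
    (hH : ∀ x ∈ Icc (0 : ℝ) 1, HasDerivAt H (f (C.toFun x)) (C.toFun x)) :
    C.integral f = 0 := by
  obtain ⟨S, hS, hd⟩ := C.differentiable
  rw [integral, MeasureTheory.integral_eq_of_hasDerivAt_off_countable_of_le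
    (fun x => H (C.toFun x)) _ zero_le_one hS.countable _ _ (C.intervalIntegrable hf), C.closed,
    sub_self]
  · exact C.continuousOn_comp fun x hx => (hH x hx).continuousAt
  · intro x hx
    exact (hH x (Ioo_subset_Icc_self hx.1)).comp_of_eq x (hd x hx).hasDerivAt rfl

theorem integral_add {f g : ℂ → ℂ} (hf : ContinuousOn (fun x => f (C.toFun x)) (Icc 0 1))
    (hg : ContinuousOn (fun x => g (C.toFun x)) (Icc 0 1)) :
    C.integral (fun z => f z + g z) = C.integral f + C.integral g := by
  simp only [integral, add_mul]
  exact intervalIntegral.integral_add (C.intervalIntegrable hf) (C.intervalIntegrable hg)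

theorem integral_sub {f g : ℂ → ℂ} (hf : ContinuousOn (fun x => f (C.toFun x)) (Icc 0 1))
    (hg : ContinuousOn (fun x => g (C.toFun x)) (Icc 0 1)) :
    C.integral (fun z => f z - g z) = C.integral f - C.integral g := by
  simp only [integral, sub_mul]
  exact intervalIntegral.integral_sub (C.intervalIntegrable hf) (C.intervalIntegrable hg)

theorem integral_const_mul (a : ℂ) (f : ℂ → ℂ) :
    C.integral (fun z => a * f z) = a * C.integral f := by
  simp only [integral, mul_assoc]
  exact intervalIntegral.integral_const_mul a _

theorem integral_sum {ι : Type*} (s : Finset ι) {f : ι → ℂ → ℂ}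
    (hf : ∀ i ∈ s, ContinuousOn (fun x => f i (C.toFun x)) (Icc 0 1)) :
    C.integral (fun z => ∑ i ∈ s, f i z) = ∑ i ∈ s, C.integral (f i) := by
  simp only [integral, Finset.sum_mul]
  exact intervalIntegral.integral_finsetSum fun i hi => C.intervalIntegrable (hf i hi)

variable {C}

theorem Avoids.continuousOn_inv {w : ℂ} (hw : C.Avoids w) :
    ContinuousOn (fun x => (C.toFun x - w)⁻¹) (Icc 0 1) :=
  (C.continuousOn.sub continuousOn_const).inv₀ fun x hx => sub_ne_zero.2 (hw x hx)

theorem Avoids.integral_inv {w : ℂ} : C.integral (fun z => (z - w)⁻¹) =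
    2 * Real.pi * Complex.I * C.winding w := by
  rw [winding, mul_inv_cancel_left₀]
  simp [Complex.I_ne_zero, Real.pi_ne_zero]

theorem integral_eq_of_primitive_sub {f g H : ℂ → ℂ}
    (hf : ContinuousOn (fun x => f (C.toFun x)) (Icc 0 1))
    (hg : ContinuousOn (fun x => g (C.toFun x)) (Icc 0 1))
    (hH : ∀ x ∈ Icc (0 : ℝ) 1, HasDerivAt H (f (C.toFun x) - g (C.toFun x)) (C.toFun x)) :
    C.integral f = C.integral g := by
  rw [← sub_eq_zero, ← C.integral_sub hf hg]
  exact C.integral_eq_zero_of_primitive (f := fun z => f z - g z) (hf.sub hg) hH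

/-- The winding number does not change under displacements that are small compared with the
distance to the curve. -/
theorem winding_eq_of_dist_lt {w w' : ℂ}
    (h : ∀ x ∈ Icc (0 : ℝ) 1, ‖w - w'‖ < ‖C.toFun x - w'‖) :
    C.Avoids w ∧ C.Avoids w' ∧ C.winding w = C.winding w' := by
  have h1 : C.Avoids w := fun x hx e => by
    have := h x hx
    rw [e] at this
    exact this.false
  have h2 : C.Avoids w' := fun x hx e => by
    have := h x hx
    rw [e, sub_self, norm_zero] at this
    exact absurd this (norm_nonneg _).not_gt
  refine ⟨h1, h2, ?_⟩
  rw [winding, winding, integral_eq_of_primitive_sub (f := fun z => (z - w)⁻¹)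
    (g := fun z => (z - w')⁻¹) (H := fun z => Complex.log ((z - w) / (z - w')))
    h1.continuousOn_inv h2.continuousOn_inv]
  intro x hx
  have n1 := sub_ne_zero.2 (h1 x hx)
  have n2 := sub_ne_zero.2 (h2 x hx)
  -- The quotient stays in the disk of radius 1 about 1, so the principal logarithm gives a
  -- primitive along the whole curve.
  have h3 : (C.toFun x - w) / (C.toFun x - w') ∈ Complex.slitPlane := by
    rw [show (C.toFun x - w) / (C.toFun x - w') = 1 + (w' - w) / (C.toFun x - w') by
      field_simp; ring]
    refine Complex.mem_slitPlane_of_norm_lt_one ?_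
    rw [norm_div, div_lt_one (norm_pos_iff.2 n2), norm_sub_rev w' w]
    exact h x hx
  have h4 := (((hasDerivAt_id (C.toFun x)).sub_const w).div
    ((hasDerivAt_id (C.toFun x)).sub_const w') n2).clog h3
  refine h4.congr_deriv ?_
  simp only [id, Pi.div_apply]
  field_simp

/-- The winding number vanishes outside a disk that contains the curve. -/
theorem winding_eq_zero_of_lt {c w : ℂ} (h : ∀ x ∈ Icc (0 : ℝ) 1, ‖C.toFun x - c‖ < ‖w - c‖) :
    C.Avoids w ∧ C.winding w = 0 := by
  have h1 : C.Avoids w := fun x hx e => by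
    have := h x hx
    rw [e] at this
    exact this.false
  refine ⟨h1, ?_⟩
  rw [winding, integral_eq_zero_of_primitive C (f := fun z => (z - w)⁻¹)
    (H := fun z => Complex.log ((z - w) / (c - w))) h1.continuousOn_inv, mul_zero]
  intro x hx
  have n1 := sub_ne_zero.2 (h1 x hx)
  have n2 : c - w ≠ 0 := by
    rw [← norm_pos_iff, norm_sub_rev]
    exact (norm_nonneg _).trans_lt (h x hx)
  have h3 : (C.toFun x - w) / (c - w) ∈ Complex.slitPlane := by
    rw [show (C.toFun x - w) / (c - w) = 1 + (C.toFun x - c) / (c - w) by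
      field_simp; ring]
    refine Complex.mem_slitPlane_of_norm_lt_one ?_
    rw [norm_div, div_lt_one (norm_pos_iff.2 n2), norm_sub_rev c w]
    exact h x hx
  have h4 := (((hasDerivAt_id (C.toFun x)).sub_const w).div_const (c - w)).clog h3
  refine h4.congr_deriv ?_
  simp only [id]
  field_simp

end Contour

/-- The circle as a contour. -/
def circle (c : ℂ) (r : ℝ) : Contour where
  toFun x := circleMap c r (2 * Real.pi * x)
  continuousOn := ((continuous_circleMap c r).comp (by fun_prop)).continuousOn
  closed := by
    have := periodic_circleMap c r 0
    simp only [mul_zero, mul_one]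
    rw [← this, zero_add]
  differentiable := ⟨∅, finite_empty, fun x _ => by
    exact (differentiable_circleMap c r).comp (by fun_prop : Differentiable ℝ fun x : ℝ =>
      2 * Real.pi * x) x⟩
  integrable := by
    have h : ContDiff ℝ 1 fun x : ℝ => circleMap c r (2 * Real.pi * x) :=
      (contDiff_circleMap c r).comp (by fun_prop)
    exact (h.continuous_deriv le_rfl).intervalIntegrable 0 1

theorem circle_integral (c : ℂ) (r : ℝ) (f : ℂ → ℂ) :
    (circle c r).integral f = ∮ z in C(c, r), f z := by
  have h (x : ℝ) : deriv (circle c r).toFun x =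
      (2 * Real.pi : ℝ) • deriv (circleMap c r) (2 * Real.pi * x) :=
    deriv_comp_mul_left (2 * Real.pi) (circleMap c r) x
  have h2 := intervalIntegral.smul_integral_comp_mul_left (a := 0) (b := 1)
    (fun θ => deriv (circleMap c r) θ • f (circleMap c r θ)) (2 * Real.pi)
  rw [mul_zero, mul_one] at h2
  rw [circleIntegral, ← h2, Contour.integral, ← intervalIntegral.integral_smul]
  refine intervalIntegral.integral_congr fun x _ => ?_
  simp only [h, smul_eq_mul, Complex.real_smul]
  simp only [circle]
  push_cast
  ring

theorem circle_mem_sphere (c : ℂ) {r : ℝ} (hr : 0 ≤ r) (x : ℝ) :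
    ‖(circle c r).toFun x - c‖ = r := by
  simp [circle, abs_of_nonneg hr]

theorem circle_encloses {c w : ℂ} {r : ℝ} (h : ‖w - c‖ < r) : (circle c r).Encloses w := by
  have hr : 0 ≤ r := (norm_nonneg _).trans h.le
  constructor
  · intro x _ e
    have := circle_mem_sphere c hr x
    rw [e] at this
    exact h.ne this
  · rw [Contour.winding, circle_integral,
      circleIntegral.integral_sub_inv_of_mem_ball (mem_ball_iff_norm.2 h), inv_mul_cancel₀]
    simp [Complex.I_ne_zero, Real.pi_ne_zero]

theorem circle_excludes {c w : ℂ} {r : ℝ} (hr : 0 ≤ r) (h : r < ‖w - c‖) :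
    (circle c r).Excludes w :=
  Contour.winding_eq_zero_of_lt fun x _ => by rwa [circle_mem_sphere c hr]

/-! ### Primitives in an annulus -/

/-- The open annulus `r < |z| < R`. -/
def annulus (r R : ℝ) : Set ℂ := {z | r < ‖z‖ ∧ ‖z‖ < R}

theorem isOpen_annulus (r R : ℝ) : IsOpen (annulus r R) :=
  (isOpen_lt continuous_const continuous_norm).inter (isOpen_lt continuous_norm continuous_const)

theorem ne_zero_of_mem_annulus {r R : ℝ} (hr : 0 < r) {z : ℂ} (hz : z ∈ annulus r R) : z ≠ 0 :=
  norm_pos_iff.1 (hr.trans hz.1)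

/-- The exponential function covers the annulus by a convex strip, on which the pulled back form has
a primitive P. Translation by 2πi changes P by a constant d; subtracting c w with c = d / (2πi)
makes it periodic, so that it descends. The multiple of 1/z is thus the only obstruction. -/
theorem exists_primitive_annulus {r R : ℝ} (hr : 0 < r) {g : ℂ → ℂ}
    (hg : DifferentiableOn ℂ g (annulus r R)) :
    ∃ (c : ℂ) (H : ℂ → ℂ), ∀ z ∈ annulus r R, HasDerivAt H (g z - c * z⁻¹) z := by
  set s : Set ℂ := {w | Real.log r < w.re ∧ Real.exp w.re < R} with hs
  have hso : IsOpen s := (isOpen_lt continuous_const Complex.continuous_re).inter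
    (isOpen_lt (Real.continuous_exp.comp Complex.continuous_re) continuous_const)
  have hmem (w : ℂ) : Complex.exp w ∈ annulus r R ↔ w ∈ s := by
    rw [annulus, hs, mem_ofPred_eq, mem_ofPred_eq, Complex.norm_exp, Real.log_lt_iff_lt_exp hr]
  have hconv : Convex ℝ s := by
    rcases le_or_gt R 0 with hR | hR
    · have : s = ∅ := by
        ext w
        simp only [hs, mem_ofPred_eq, mem_empty_iff_false, iff_false, not_and, not_lt]
        exact fun _ => hR.trans (Real.exp_pos _).le
      rw [this]
      exact convex_empty
    · have : s = Complex.re ⁻¹' Ioo (Real.log r) (Real.log R) := by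
        ext w
        simp only [hs, mem_ofPred_eq, mem_preimage, mem_Ioo, Real.lt_log_iff_exp_lt hR]
      rw [this]
      exact (convex_Ioo _ _).is_linear_preimage Complex.reLm.isLinear
  obtain ⟨P, hP⟩ := hconv.exists_forall_hasDerivWithinAt (𝕜 := ℂ)
    (f := fun w => g (Complex.exp w) * Complex.exp w)
    ((hg.comp Complex.differentiable_exp.differentiableOn fun w hw => (hmem w).2 hw).mul
      Complex.differentiable_exp.differentiableOn)
  have hP' (w : ℂ) (hw : w ∈ s) : HasDerivAt P (g (Complex.exp w) * Complex.exp w) w :=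
    (hP w hw).hasDerivAt (hso.mem_nhds hw)
  have hper (w : ℂ) : w + 2 * Real.pi * Complex.I ∈ s ↔ w ∈ s := by
    rw [← hmem, ← hmem, Complex.exp_add, Complex.exp_two_pi_mul_I, mul_one]
  obtain ⟨d, hd⟩ : ∃ d, ∀ w ∈ s, P (w + 2 * Real.pi * Complex.I) - P w = d := by
    have hder (w : ℂ) (hw : w ∈ s) :
        HasDerivAt (fun w => P (w + 2 * Real.pi * Complex.I) - P w) 0 w := by
      have h1 := (hP' _ ((hper w).2 hw)).comp_add_const w (2 * Real.pi * Complex.I)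
      refine (h1.sub (hP' w hw)).congr_deriv ?_
      rw [Complex.exp_add, Complex.exp_two_pi_mul_I, mul_one, sub_self]
    rcases s.eq_empty_or_nonempty with he | ⟨w0, hw0⟩
    · exact ⟨0, fun w hw => by simp [he] at hw⟩
    · refine ⟨P (w0 + 2 * Real.pi * Complex.I) - P w0, fun w hw => ?_⟩
      exact hconv.is_const_of_fderivWithin_eq_zero (𝕜 := ℂ)
        (f := fun w => P (w + 2 * Real.pi * Complex.I) - P w)
        (fun w hw => (hder w hw).differentiableAt.differentiableWithinAt)
        (fun w hw => by
          rw [fderivWithin_of_isOpen hso hw]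
          ext
          simpa using (hder w hw).deriv) hw hw0
  set c : ℂ := d / (2 * Real.pi * Complex.I) with hc
  have hpi : (2 * Real.pi * Complex.I : ℂ) ≠ 0 := by
    simp [Complex.I_ne_zero, Real.pi_ne_zero]
  set Q : ℂ → ℂ := fun w => P w - c * w with hQ
  have hQper (w : ℂ) (hw : w ∈ s) : Q (w + 2 * Real.pi * Complex.I) = Q w := by
    simp only [hQ]
    have := hd w hw
    have h2 : c * (2 * Real.pi * Complex.I) = d := by rw [hc, div_mul_cancel₀ _ hpi]
    linear_combination this - h2
  have hperint (w : ℂ) (hw : w ∈ s) (n : ℤ) : w + n * (2 * Real.pi * Complex.I) ∈ s := by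
    rw [← hmem, Complex.exp_add, Complex.exp_int_mul_two_pi_mul_I, mul_one, hmem]
    exact hw
  have hQint (w : ℂ) (hw : w ∈ s) (n : ℤ) : Q (w + n * (2 * Real.pi * Complex.I)) = Q w := by
    induction n with
    | zero => simp
    | succ k ih =>
      rw [← ih, ← hQper _ (hperint w hw k)]
      push_cast
      ring_nf
    | pred k ih =>
      rw [← ih, ← hQper _ (hperint w hw (-k - 1))]
      push_cast
      ring_nf
  refine ⟨c, fun z => Q (Complex.log z), fun z hz => ?_⟩
  have hz0 := ne_zero_of_mem_annulus hr hz
  -- A logarithm that is holomorphic near z even if z lies on the branch cut. It differs from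
  -- `Complex.log` by multiples of 2πi, which the periodic function Q does not see.
  set L : ℂ → ℂ := fun y => Complex.log (y / z) + Complex.log z with hL
  have hLz : L z = Complex.log z := by simp [hL, hz0]
  have hLd : HasDerivAt L z⁻¹ z := by
    have h1 : z / z ∈ Complex.slitPlane := by simp [hz0]
    have := (((hasDerivAt_id z).div_const z).clog h1).add_const (Complex.log z)
    refine this.congr_deriv ?_
    simp [hz0]
  have hexpL (y : ℂ) (hy : y ≠ 0) : Complex.exp (L y) = y := by
    rw [hL, Complex.exp_add, Complex.exp_log (div_ne_zero hy hz0), Complex.exp_log hz0,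
      div_mul_cancel₀ _ hz0]
  have hlog : Complex.log z ∈ s := by rw [← hmem, Complex.exp_log hz0]; exact hz
  have hQd : HasDerivAt Q (g z * z - c) (L z) := by
    rw [hLz]
    have := (hP' _ hlog).sub ((hasDerivAt_id (Complex.log z)).const_mul c)
    refine this.congr_deriv ?_
    rw [Complex.exp_log hz0, mul_one]
  have hcomp := hQd.comp z hLd
  refine (hcomp.congr_of_eventuallyEq ?_).congr_deriv ?_
  · filter_upwards [(isOpen_annulus r R).mem_nhds hz] with y hy
    have hy0 := ne_zero_of_mem_annulus hr hy
    obtain ⟨n, hn⟩ := Complex.exp_eq_exp_iff_exists_int.1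
      ((hexpL y hy0).trans (Complex.exp_log hy0).symm)
    have hlogy : Complex.log y ∈ s := by rw [← hmem, Complex.exp_log hy0]; exact hy
    simp only [Function.comp_apply, hn]
    exact (hQint _ hlogy n).symm
  · field_simp

/-! ### The residue theorem -/

/-- P is the principal part, ρ the residue, and K a primitive of the terms of higher order.
Induction on the pole order removes the leading term; `dslope` is the analytic continuation of (h(z)
- h(s)) / (z - s). -/
theorem exists_principal_part {f : ℂ → ℂ} {s : ℂ} (hf : MeromorphicAt f s) :
    ∃ (P K : ℂ → ℂ) (ρ : ℂ), (∀ z, z ≠ s → DifferentiableAt ℂ P z) ∧ MeromorphicAt P s ∧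
      (∀ z, z ≠ s → HasDerivAt K (P z - ρ * (z - s)⁻¹) z) ∧
      ∃ g : ℂ → ℂ, AnalyticAt ℂ g s ∧ ∀ᶠ z in 𝓝[≠] s, f z - P z = g z := by
  obtain ⟨n, hn⟩ := hf
  have key : ∀ (n : ℕ) (f h : ℂ → ℂ), AnalyticAt ℂ h s →
      (∀ᶠ z in 𝓝[≠] s, (z - s) ^ n * f z = h z) →
      ∃ (P K : ℂ → ℂ) (ρ : ℂ), (∀ z, z ≠ s → DifferentiableAt ℂ P z) ∧ MeromorphicAt P s ∧
      (∀ z, z ≠ s → HasDerivAt K (P z - ρ * (z - s)⁻¹) z) ∧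
      ∃ g : ℂ → ℂ, AnalyticAt ℂ g s ∧ ∀ᶠ z in 𝓝[≠] s, f z - P z = g z := by
    intro n
    induction n with
    | zero =>
      intro f h hh hfh
      refine ⟨0, 0, 0, fun z _ => differentiableAt_const 0, analyticAt_const.meromorphicAt,
        fun z _ => ?_, h, hh, ?_⟩
      · simp [hasDerivAt_zero]
      · simpa using hfh
    | succ n ih =>
      intro f h hh hfh
      obtain ⟨P, K, ρ, hP, hPm, hK, g, hg, hfg⟩ := ih (fun z => f z - h s * ((z - s) ^ (n + 1))⁻¹)
        (dslope h s) (by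
          obtain ⟨p, hp⟩ := hh
          exact ⟨_, hp.has_fpower_series_dslope_fslope⟩) (by
          filter_upwards [hfh, self_mem_nhdsWithin] with z hz hzs
          have hzs' : z - s ≠ 0 := sub_ne_zero.2 hzs
          rw [dslope_of_ne _ hzs, slope_def_field, ← hz]
          field_simp
          ring)
      have hd (z : ℂ) (hz : z ≠ s) :
          DifferentiableAt ℂ (fun z => h s * ((z - s) ^ (n + 1))⁻¹) z := by
        have : (z - s) ^ (n + 1) ≠ 0 := pow_ne_zero _ (sub_ne_zero.2 hz)
        fun_prop (disch := assumption)
      have hm : MeromorphicAt (fun z => h s * ((z - s) ^ (n + 1))⁻¹) s := by fun_prop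
      have hfg' : ∀ᶠ z in 𝓝[≠] s, f z - (h s * ((z - s) ^ (n + 1))⁻¹ + P z) = g z := by
        filter_upwards [hfg] with z hz
        rw [← hz]
        ring
      -- A term of order one adds to the residue; a term of higher order has a primitive.
      rcases n with _ | n
      · refine ⟨fun z => h s * ((z - s) ^ (0 + 1))⁻¹ + P z, K, h s + ρ,
          fun z hz => (hd z hz).add (hP z hz), hm.add hPm, fun z hz => ?_, g, hg, hfg'⟩
        refine (hK z hz).congr_deriv ?_
        simp only [zero_add, pow_one]
        ring
      · refine ⟨fun z => h s * ((z - s) ^ (n + 1 + 1))⁻¹ + P z,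
          fun z => h s * (-(n + 1 : ℂ)⁻¹ * ((z - s) ^ (n + 1))⁻¹) + K z, ρ,
          fun z hz => (hd z hz).add (hP z hz), hm.add hPm, fun z hz => ?_, g, hg, hfg'⟩
        have hz' : z - s ≠ 0 := sub_ne_zero.2 hz
        have h1 : HasDerivAt (fun z => ((z - s) ^ (n + 1))⁻¹)
            (-((n + 1 : ℕ) * (z - s) ^ n * 1) / ((z - s) ^ (n + 1)) ^ 2) z := by
          have := (((hasDerivAt_id z).sub_const s).pow (n + 1)).inv (pow_ne_zero _ hz')
          simp only [id, Nat.add_sub_cancel] at this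
          exact this
        refine (((h1.const_mul (-(n + 1 : ℂ)⁻¹)).const_mul (h s)).add (hK z hz)).congr_deriv ?_
        have hn1 : (n + 1 : ℂ) ≠ 0 := Nat.cast_add_one_ne_zero n
        push_cast
        field_simp
        ring
  refine key n f _ hn ?_
  exact Eventually.of_forall fun z => by simp

/-- Subtracting the principal part at one point of S and filling the removable singularity reduces
the number of poles. The case without poles is `exists_primitive_annulus`. -/
theorem exists_primitive_sub_residues {r R : ℝ} (hr : 0 < r) (S : Finset ℂ) {f : ℂ → ℂ}
    (hd : ∀ z ∈ annulus r R, z ∉ S → DifferentiableAt ℂ f z)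
    (hm : ∀ s ∈ S, MeromorphicAt f s) :
    ∃ (c : ℂ) (ρ : ℂ → ℂ) (H : ℂ → ℂ), ∀ z ∈ annulus r R, z ∉ S →
      HasDerivAt H (f z - (c * z⁻¹ + ∑ s ∈ S, ρ s * (z - s)⁻¹)) z := by
  classical
  induction S using Finset.induction_on generalizing f with
  | empty =>
    obtain ⟨c, H, hH⟩ := exists_primitive_annulus hr (g := f) (R := R) fun z hz =>
      (hd z hz (by simp)).differentiableWithinAt
    exact ⟨c, 0, H, fun z hz _ => by simpa using hH z hz⟩
  | insert s S hs ih =>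
    obtain ⟨P, K, ρ0, hP, hPm, hK, g, hg, hfg⟩ :=
      exists_principal_part (hm s (Finset.mem_insert_self s S))
    set f1 : ℂ → ℂ := Function.update (fun z => f z - P z) s (g s) with hf1
    have hne (z : ℂ) (hz : z ≠ s) : f1 =ᶠ[𝓝 z] fun z => f z - P z := by
      filter_upwards [isOpen_ne.mem_nhds hz] with y hy
      rw [hf1, Function.update_of_ne hy]
    have hse : f1 =ᶠ[𝓝 s] g := by
      rw [eventually_nhdsWithin_iff] at hfg
      filter_upwards [hfg] with y hy
      rcases eq_or_ne y s with rfl | hys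
      · simp [hf1]
      · rw [hf1, Function.update_of_ne hys, hy hys]
    obtain ⟨c, ρ, H, hH⟩ := ih (f := f1) (fun z hz hzS => by
      rcases eq_or_ne z s with rfl | hzs
      · exact hg.differentiableAt.congr_of_eventuallyEq hse
      · refine ((hd z hz ?_).sub (hP z hzs)).congr_of_eventuallyEq (hne z hzs)
        simp [hzs, hzS]) (fun z hzS => by
      have hzs : z ≠ s := fun e => hs (e ▸ hzS)
      have h1 : MeromorphicAt P z := by
        refine AnalyticAt.meromorphicAt ?_
        exact DifferentiableOn.analyticAt (s := {s}ᶜ)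
          (fun y hy => (hP y hy).differentiableWithinAt) (isOpen_ne.mem_nhds hzs)
      exact ((hm z (Finset.mem_insert_of_mem hzS)).sub h1).congr
        ((hne z hzs).symm.filter_mono nhdsWithin_le_nhds))
    refine ⟨c, Function.update ρ s ρ0, fun z => H z + K z, fun z hz hzS => ?_⟩
    rw [Finset.mem_insert, not_or] at hzS
    refine ((hH z hz hzS.2).add (hK z hzS.1)).congr_deriv ?_
    have hsum : ∑ y ∈ S, Function.update ρ s ρ0 y * (z - y)⁻¹ = ∑ y ∈ S, ρ y * (z - y)⁻¹ :=
      Finset.sum_congr rfl fun y hy => by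
        rw [Function.update_of_ne (ne_of_mem_of_not_mem hy hs)]
    rw [(hne z hzS.1).eq_of_nhds, Finset.sum_insert hs, Function.update_self, hsum]
    ring

/-- The residue theorem in an annulus: the integral depends on winding numbers only. -/
theorem exists_integral_eq_winding {r R : ℝ} (hr : 0 < r) (S : Finset ℂ) {f : ℂ → ℂ}
    (hd : ∀ z ∈ annulus r R, z ∉ S → DifferentiableAt ℂ f z)
    (hm : ∀ s ∈ S, MeromorphicAt f s) :
    ∃ (c : ℂ) (ρ : ℂ → ℂ), ∀ C : Contour, (∀ x ∈ Icc (0 : ℝ) 1, C.toFun x ∈ annulus r R) →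
      (∀ s ∈ S, C.Avoids s) → C.integral f = c * C.winding 0 + ∑ s ∈ S, ρ s * C.winding s := by
  obtain ⟨c, ρ, H, hH⟩ := exists_primitive_sub_residues hr S hd hm
  refine ⟨c * (2 * Real.pi * Complex.I), fun s => ρ s * (2 * Real.pi * Complex.I),
    fun C hC hCS => ?_⟩
  have hnot (x : ℝ) (hx : x ∈ Icc (0 : ℝ) 1) : C.toFun x ∉ S := fun h => hCS _ h x hx rfl
  have h0 : C.Avoids 0 := fun x hx => ne_zero_of_mem_annulus hr (hC x hx)
  have hc0 := h0.continuousOn_inv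
  simp only [sub_zero] at hc0
  have hcs (s : ℂ) (hs : s ∈ S) :
      ContinuousOn (fun x => ρ s * (C.toFun x - s)⁻¹) (Icc 0 1) :=
    continuousOn_const.mul (hCS s hs).continuousOn_inv
  have hsum : ContinuousOn (fun x => ∑ s ∈ S, ρ s * (C.toFun x - s)⁻¹) (Icc 0 1) :=
    continuousOn_finsetSum S hcs
  rw [Contour.integral_eq_of_primitive_sub (C := C) (f := f)
    (g := fun z => c * z⁻¹ + ∑ s ∈ S, ρ s * (z - s)⁻¹) (H := H)
    (C.continuousOn_comp fun x hx => (hd _ (hC x hx) (hnot x hx)).continuousAt)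
    ((continuousOn_const.mul hc0).add hsum)
    (fun x hx => hH _ (hC x hx) (hnot x hx)),
    C.integral_add (f := fun z => c * z⁻¹) (continuousOn_const.mul hc0) hsum,
    C.integral_const_mul, C.integral_sum S (f := fun s z => ρ s * (z - s)⁻¹) hcs]
  have e0 := Contour.Avoids.integral_inv (C := C) (w := 0)
  simp only [sub_zero] at e0
  rw [e0]
  congr 1
  · ring
  · refine Finset.sum_congr rfl fun s _ => ?_
    rw [C.integral_const_mul, Contour.Avoids.integral_inv]
    ring

end EllipticHyp

end

/-! ### The integral over separating chains and its dependence on the parameters -/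

noncomputable section

namespace EllipticHyp

open Filter Topology Set

variable {p q : ℂ} {J : Type}

/-! ### The integrand -/

/-- The meromorphic function `∏ Γ(t_j z) Γ(t_j / z) / (Γ(z²) Γ(z⁻²))`, without removable
singularities. -/
def hypF [Fintype J] (p q : ℂ) (t : J → ℂ) (z : ℂ) : ℂ :=
  (∏ j, Gam p q (t j * z) * Gam p q (t j * z⁻¹)) * (theta p (z ^ 2) * theta q ((z ^ 2)⁻¹))

/-- The integrand is holomorphic at `z`. -/
structure Regular (p q : ℂ) (t : J → ℂ) (z : ℂ) : Prop where
  ne_zero : z ≠ 0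
  param_ne_zero : ∀ j, t j ≠ 0
  left : ∀ j, E p q (t j * z) ≠ 0
  right : ∀ j, E p q (t j * z⁻¹) ≠ 0

theorem differentiableAt_prod {X K : Type*} [NormedAddCommGroup X] [NormedSpace ℂ X] (s : Finset K)
    {f : K → X → ℂ} {x : X} (hf : ∀ j ∈ s, DifferentiableAt ℂ (f j) x) :
    DifferentiableAt ℂ (fun y => ∏ j ∈ s, f j y) x := by
  classical
  induction s using Finset.induction_on with
  | empty => simp
  | insert a s ha ih =>
    simp only [Finset.prod_insert ha]
    exact (hf a (Finset.mem_insert_self a s)).mul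
      (ih fun j hj => hf j (Finset.mem_insert_of_mem hj))

theorem hypF_differentiableAt [Fintype J] (hp : ‖p‖ < 1) (hq : ‖q‖ < 1) {X : Type*} [NormedAddCommGroup X]
    [NormedSpace ℂ X] {f : X → J → ℂ} {g : X → ℂ} {x : X} (hf : DifferentiableAt ℂ f x)
    (hg : DifferentiableAt ℂ g x) (h : Regular p q (f x) (g x)) :
    DifferentiableAt ℂ (fun y => hypF p q (f y) (g y)) x := by
  have h0 := h.ne_zero
  have hfj (j : J) : DifferentiableAt ℂ (fun y => f y j) x := differentiableAt_pi.1 hf j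
  have hgi : DifferentiableAt ℂ (fun y => (g y)⁻¹) x := hg.inv h0
  have hg2 : DifferentiableAt ℂ (fun y => ((g y) ^ 2)⁻¹) x := (hg.pow 2).inv (pow_ne_zero 2 h0)
  refine DifferentiableAt.mul (differentiableAt_prod _ fun j _ => ?_)
    (DifferentiableAt.mul ?_ ?_)
  · exact ((Gam_differentiableAt hp hq (mul_ne_zero (h.param_ne_zero j) h0) (h.left j)).comp x
      ((hfj j).mul hg)).mul
      ((Gam_differentiableAt hp hq (mul_ne_zero (h.param_ne_zero j) (inv_ne_zero h0))
        (h.right j)).comp (f := fun y => f y j * (g y)⁻¹) x ((hfj j).mul hgi))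
  · exact (theta_differentiableAt hp (pow_ne_zero 2 h0)).comp x (hg.pow 2)
  · exact (theta_differentiableAt hq (inv_ne_zero (pow_ne_zero 2 h0))).comp x hg2

theorem hypF_meromorphicAt [Fintype J] (hp : ‖p‖ < 1) (hq : ‖q‖ < 1) (t : J → ℂ) {z : ℂ} (hz : z ≠ 0) :
    MeromorphicAt (hypF p q t) z := by
  have hE {g : ℂ → ℂ} (hg : AnalyticAt ℂ g z) : MeromorphicAt (fun y => E p q (g y)) z :=
    ((E_differentiable hp hq).analyticAt _ |>.comp hg).meromorphicAt
  have hG {g : ℂ → ℂ} (hg : AnalyticAt ℂ g z) (hg' : AnalyticAt ℂ (fun y => p * q / g y) z) :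
      MeromorphicAt (fun y => Gam p q (g y)) z := by
    simp only [Gam_eq]
    exact (hE hg').div (hE hg)
  have hth {q : ℂ} (hq : ‖q‖ < 1) {w : ℂ} (hw : w ≠ 0) : AnalyticAt ℂ (theta q) w :=
    DifferentiableOn.analyticAt (s := {0}ᶜ)
      (fun y hy => (theta_differentiableAt hq hy).differentiableWithinAt) (isOpen_ne.mem_nhds hw)
  have hi : AnalyticAt ℂ (fun y : ℂ => y⁻¹) z := analyticAt_inv hz
  refine MeromorphicAt.mul (MeromorphicAt.fun_prod fun j _ => ?_) (AnalyticAt.meromorphicAt ?_)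
  · rcases eq_or_ne (t j) 0 with h0 | h0
    · simp only [h0, zero_mul]
      exact analyticAt_const.meromorphicAt
    · refine MeromorphicAt.mul (hG (by fun_prop) ?_) (hG (by fun_prop) ?_)
      · exact AnalyticAt.div analyticAt_const (by fun_prop) (mul_ne_zero h0 hz)
      · exact AnalyticAt.div analyticAt_const (by fun_prop) (mul_ne_zero h0 (inv_ne_zero hz))
  · refine AnalyticAt.mul ?_ ?_
    · exact (hth hp (pow_ne_zero 2 hz)).comp (f := fun y : ℂ => y ^ 2) (by fun_prop)
    · exact (hth hq (inv_ne_zero (pow_ne_zero 2 hz))).comp (f := fun y : ℂ => (y ^ 2)⁻¹)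
        ((analyticAt_id.pow 2).inv (pow_ne_zero 2 hz))

theorem integrand_eq_hypF (hp : ‖p‖ < 1) (hq : ‖q‖ < 1) (t : Fin 8 → ℂ) {z : ℂ}
    (h1 : E p q (p * q / z ^ 2) ≠ 0) (h2 : E p q (p * q * z ^ 2) ≠ 0) :
    integrand p q t z = hypF p q t z := by
  rw [integrand, hypF, div_eq_mul_inv, inv_Gam_mul_Gam_inv hp hq h1 h2]

/-- The curve may rest at a point of D for a set of times of positive measure, but there the
derivative, hence both integrands, vanish. Times at which it meets a given point with non-zero
derivative are isolated in the fibre, so there are only countably many of them. -/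
theorem Contour.integral_congr_off_countable (C : Contour) {f g : ℂ → ℂ} {D : Set ℂ}
    (hD : D.Countable) (h : ∀ x ∈ Icc (0 : ℝ) 1, C.toFun x ∉ D → f (C.toFun x) = g (C.toFun x)) :
    C.integral f = C.integral g := by
  have hcount : {x : ℝ | C.toFun x ∈ D ∧ deriv C.toFun x ≠ 0}.Countable := by
    have : {x : ℝ | C.toFun x ∈ D ∧ deriv C.toFun x ≠ 0} =
        ⋃ w ∈ D, {x : ℝ | C.toFun x = w ∧ deriv C.toFun x ≠ 0} := by
      ext x
      simp
    rw [this]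
    refine hD.biUnion fun w _ => ?_
    refine Set.Countable.mono (fun x hx => ?_) (s₂ := {x ∈ {x : ℝ | C.toFun x = w} |
      𝓝[{x : ℝ | C.toFun x = w} ∩ Ioi x] x = ⊥}) ?_
    · refine ⟨hx.1, ?_⟩
      have h1 := (differentiableAt_of_deriv_ne_zero hx.2).hasDerivAt.eventually_ne (c := w) hx.2
      rw [eventually_nhdsWithin_iff] at h1
      rw [← Filter.empty_mem_iff_bot, mem_nhdsWithin_iff_eventually]
      filter_upwards [h1] with y hy hy2
      exact hy (ne_of_gt hy2.2) hy2.1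
    · exact countable_setOfPred_isolated_right_within
  refine intervalIntegral.integral_congr_ae ?_
  filter_upwards [hcount.ae_notMem MeasureTheory.volume] with x hx hx1
  rw [uIoc_of_le zero_le_one] at hx1
  by_cases hd : deriv C.toFun x = 0
  · simp [hd]
  · rw [h x (Ioc_subset_Icc_self hx1) fun hD => hx ⟨hD, hd⟩]

/-! ### Poles -/

/-- The poles of the integrand that tend to zero. -/
def innerPoles (p q : ℂ) (t : J → ℂ) : Set ℂ := {w | ∃ (j : J) (a b : ℕ), w = t j * p ^ a * q ^ b}

/-- The poles of the integrand that tend to infinity. -/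
def outerPoles (p q : ℂ) (t : J → ℂ) : Set ℂ :=
  {w | ∃ (j : J) (a b : ℕ), w = (t j * p ^ a * q ^ b)⁻¹}

theorem regular_of_notMem (hp : ‖p‖ < 1) (hq : ‖q‖ < 1) {t : J → ℂ} {z : ℂ} (hz : z ≠ 0)
    (ht : ∀ j, t j ≠ 0) (h1 : z ∉ innerPoles p q t) (h2 : z ∉ outerPoles p q t) :
    Regular p q t z := by
  refine ⟨hz, ht, fun j h => h2 ?_, fun j h => h1 ?_⟩
  · obtain ⟨a, b, h⟩ := (E_eq_zero_iff hp hq _).1 h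
    exact ⟨j, a, b, eq_inv_of_mul_eq_one_right (by rw [← h]; ring)⟩
  · obtain ⟨a, b, h⟩ := (E_eq_zero_iff hp hq _).1 h
    refine ⟨j, a, b, ?_⟩
    field_simp at h
    exact h.symm

theorem finite_pow_mul_pow (hp : ‖p‖ < 1) (hq : ‖q‖ < 1) {r : ℝ} (hr : 0 < r) :
    {n : ℕ × ℕ | r ≤ ‖p ^ n.1 * q ^ n.2‖}.Finite := by
  have h := (summable_norm_pow_mul_pow hp hq).tendsto_cofinite_zero.eventually_lt_const hr
  simpa only [Filter.eventually_cofinite, not_lt] using h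

theorem finite_innerPoles [Fintype J] (hp : ‖p‖ < 1) (hq : ‖q‖ < 1) (t : J → ℂ) {r : ℝ} (hr : 0 < r) :
    {w ∈ innerPoles p q t | r ≤ ‖w‖}.Finite := by
  have h (j : J) : {n : ℕ × ℕ | r / (‖t j‖ + 1) ≤ ‖p ^ n.1 * q ^ n.2‖}.Finite :=
    finite_pow_mul_pow hp hq (by positivity)
  refine (Set.finite_iUnion fun j => (h j).image fun n => t j * p ^ n.1 * q ^ n.2).subset ?_
  rintro w ⟨⟨j, a, b, rfl⟩, hw⟩
  refine mem_iUnion.2 ⟨j, ⟨(a, b), ?_, rfl⟩⟩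
  rw [mul_assoc, norm_mul] at hw
  rw [mem_ofPred_eq, div_le_iff₀ (by positivity)]
  nlinarith [norm_nonneg (p ^ a * q ^ b)]

theorem finite_outerPoles [Fintype J] (hp : ‖p‖ < 1) (hq : ‖q‖ < 1) (t : J → ℂ) {R : ℝ} :
    {w ∈ outerPoles p q t | w ≠ 0 ∧ ‖w‖ ≤ R}.Finite := by
  refine ((finite_innerPoles hp hq t (r := (|R| + 1)⁻¹) (by positivity)).image
    fun w => w⁻¹).subset ?_
  rintro w ⟨⟨j, a, b, rfl⟩, h0, hw⟩
  refine ⟨_, ⟨⟨j, a, b, rfl⟩, ?_⟩, rfl⟩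
  rw [norm_inv] at hw
  have h1 : 0 < ‖t j * p ^ a * q ^ b‖ := norm_pos_iff.2 (fun h => h0 (by rw [h, inv_zero]))
  rw [inv_le_comm₀ (by positivity) h1]
  linarith [le_abs_self R]

/-! ### Chains -/

/-- A formal linear combination of contours. -/
structure Chain where
  ι : Type
  fintype : Fintype ι
  coef : ι → ℂ
  curve : ι → Contour

attribute [instance] Chain.fintype

namespace Chain

/-- The integral over a chain. -/
def integral (K : Chain) (f : ℂ → ℂ) : ℂ := ∑ i, K.coef i * (K.curve i).integral f

/-- The winding number of a chain. -/
def winding (K : Chain) (w : ℂ) : ℂ := ∑ i, K.coef i * (K.curve i).winding w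

/-- No curve of the chain passes through `w`. -/
def Avoids (K : Chain) (w : ℂ) : Prop := ∀ i, (K.curve i).Avoids w

/-- The chain separates the two families of poles of the integrand. -/
structure Separates (K : Chain) (p q : ℂ) (t : J → ℂ) : Prop where
  zero : K.Avoids 0 ∧ K.winding 0 = 1
  inner : ∀ w ∈ innerPoles p q t, K.Avoids w ∧ K.winding w = 1
  outer : ∀ w ∈ outerPoles p q t, K.Avoids w ∧ K.winding w = 0

/-- A contour as a chain. -/
def single (C : Contour) : Chain := ⟨Unit, inferInstance, fun _ => 1, fun _ => C⟩

theorem single_integral (C : Contour) (f : ℂ → ℂ) : (single C).integral f = C.integral f := by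
  show ∑ _i : Unit, 1 * C.integral f = _
  simp

theorem single_winding (C : Contour) (w : ℂ) : (single C).winding w = C.winding w := by
  show ∑ _i : Unit, 1 * C.winding w = _
  simp

theorem single_separates_iff (C : Contour) (t : Fin 8 → ℂ) :
    (single C).Separates p q t ↔ C.Separates p q t := by
  have hA (w : ℂ) : (single C).Avoids w ↔ C.Avoids w := ⟨fun h => h (), fun h _ => h⟩
  have h1 (w c : ℂ) : ((single C).Avoids w ∧ (single C).winding w = c) ↔
      (C.Avoids w ∧ C.winding w = c) := by rw [hA, single_winding]
  constructor
  · intro h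
    exact ⟨(h1 _ _).1 h.zero, fun j a b => (h1 _ _).1 (h.inner _ ⟨j, a, b, rfl⟩),
      fun j a b => (h1 _ _).1 (h.outer _ ⟨j, a, b, rfl⟩)⟩
  · intro h
    refine ⟨(h1 _ _).2 h.zero, ?_, ?_⟩
    · rintro w ⟨j, a, b, rfl⟩
      exact (h1 _ _).2 (h.inner j a b)
    · rintro w ⟨j, a, b, rfl⟩
      exact (h1 _ _).2 (h.outer j a b)

/-- For `t j = 0` the inverse has the default value 0, and the winding number around 0 would be both
0 and 1. -/
theorem Separates.param_ne_zero {K : Chain} {t : J → ℂ} (h : K.Separates p q t) (j : J) :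
    t j ≠ 0 := by
  intro h0
  have h1 := (h.outer _ ⟨j, 0, 0, rfl⟩).2
  rw [h0, zero_mul, zero_mul, inv_zero, h.zero.2] at h1
  exact one_ne_zero h1

theorem Separates.mul_ne_one {K : Chain} {t : J → ℂ} (h : K.Separates p q t) (j k : J) (a b : ℕ) :
    t j * t k * p ^ a * q ^ b ≠ 1 := by
  intro h0
  have h1 := (h.outer _ ⟨k, 0, 0, rfl⟩).2
  have h2 := (h.inner _ ⟨j, a, b, rfl⟩).2
  have h3 : (t k * p ^ 0 * q ^ 0)⁻¹ = t j * p ^ a * q ^ b := by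
    rw [pow_zero, pow_zero, mul_one, mul_one]
    exact inv_eq_of_mul_eq_one_right (by rw [← h0]; ring)
  rw [h3, h2] at h1
  exact one_ne_zero h1

theorem exists_bounds {C : Contour} (h : C.Avoids 0) :
    ∃ r R : ℝ, 0 < r ∧ ∀ x ∈ Icc (0 : ℝ) 1, r < ‖C.toFun x‖ ∧ ‖C.toFun x‖ < R := by
  obtain ⟨x, hx, hx'⟩ := isCompact_Icc.exists_isMinOn (nonempty_Icc.2 (zero_le_one (α := ℝ)))
    C.continuousOn.norm
  obtain ⟨y, hy, hy'⟩ := isCompact_Icc.exists_isMaxOn (nonempty_Icc.2 (zero_le_one (α := ℝ)))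
    C.continuousOn.norm
  have h0 : 0 < ‖C.toFun x‖ := norm_pos_iff.2 (h x hx)
  exact ⟨‖C.toFun x‖ / 2, ‖C.toFun y‖ + 1, by positivity, fun z hz =>
    ⟨(half_lt_self h0).trans_le (hx' hz), (hy' hz).trans_lt (lt_add_one _)⟩⟩

theorem exists_chain_bounds {K : Chain} (h : K.Avoids 0) :
    ∃ r R : ℝ, 0 < r ∧ ∀ i, ∀ x ∈ Icc (0 : ℝ) 1,
      r < ‖(K.curve i).toFun x‖ ∧ ‖(K.curve i).toFun x‖ < R := by
  choose r R hr hR using fun i => exists_bounds (h i)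
  rcases isEmpty_or_nonempty K.ι with he | hne
  · exact ⟨1, 1, one_pos, fun i => he.elim i⟩
  · obtain ⟨i, hi⟩ := Finite.exists_min r
    obtain ⟨k, hk⟩ := Finite.exists_max R
    exact ⟨r i, R k, hr i, fun j x hx => ⟨(hi j).trans_lt (hR j x hx).1,
      (hR j x hx).2.trans_le (hk j)⟩⟩

/-- An annulus that contains both chains contains only finitely many poles. The residue theorem
expresses both integrals by the same constants and by winding numbers, and the latter are prescribed
by separation. -/
theorem integral_eq_of_separates [Fintype J] (hp : ‖p‖ < 1) (hq : ‖q‖ < 1) {K K' : Chain} {t : J → ℂ}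
    (h : K.Separates p q t) (h' : K'.Separates p q t) :
    K.integral (fun z => hypF p q t z / z) = K'.integral (fun z => hypF p q t z / z) := by
  obtain ⟨r, R, hr, hR⟩ := exists_chain_bounds h.zero.1
  obtain ⟨r', R', hr', hR'⟩ := exists_chain_bounds h'.zero.1
  have hfin : ({w ∈ innerPoles p q t | min r r' ≤ ‖w‖} ∪
      {w ∈ outerPoles p q t | w ≠ 0 ∧ ‖w‖ ≤ max R R'}).Finite :=
    (finite_innerPoles hp hq t (lt_min hr hr')).union (finite_outerPoles hp hq t)
  set S := hfin.toFinset with hS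
  have hSmem {w : ℂ} (hw : w ∈ S) : w ∈ innerPoles p q t ∨ w ∈ outerPoles p q t := by
    rw [hS, Finite.mem_toFinset] at hw
    exact hw.imp And.left And.left
  have hz0 {z : ℂ} (hz : z ∈ annulus (min r r') (max R R')) : z ≠ 0 :=
    ne_zero_of_mem_annulus (lt_min hr hr') hz
  obtain ⟨c, ρ, hρ⟩ := exists_integral_eq_winding (R := max R R') (lt_min hr hr') S
    (f := fun z => hypF p q t z / z) (fun z hz hzS => by
      rw [hS, Finite.mem_toFinset, mem_union, not_or] at hzS
      refine DifferentiableAt.div ?_ differentiableAt_id (hz0 hz)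
      refine hypF_differentiableAt hp hq (differentiableAt_const t) differentiableAt_id ?_
      exact regular_of_notMem hp hq (hz0 hz) h.param_ne_zero
        (fun hi => hzS.1 ⟨hi, hz.1.le⟩) (fun ho => hzS.2 ⟨ho, hz0 hz, hz.2.le⟩))
    (fun s hs => by
      have hs0 : s ≠ 0 := by
        rw [hS, Finite.mem_toFinset] at hs
        rcases hs with hs | hs
        · exact norm_pos_iff.1 ((lt_min hr hr').trans_le hs.2)
        · exact hs.2.1
      exact (hypF_meromorphicAt hp hq t hs0).div (MeromorphicAt.id s))
  have key {L : Chain} (hL : L.Separates p q t) (hLA : ∀ i, ∀ x ∈ Icc (0 : ℝ) 1,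
      (L.curve i).toFun x ∈ annulus (min r r') (max R R')) :
      L.integral (fun z => hypF p q t z / z) = c * L.winding 0 + ∑ s ∈ S, ρ s * L.winding s := by
    have h1 (i : L.ι) := hρ (L.curve i) (hLA i) fun s hs =>
      (hSmem hs).elim (fun hw => (hL.inner s hw).1 i) fun hw => (hL.outer s hw).1 i
    simp only [integral, h1, winding, Finset.mul_sum, mul_add, Finset.sum_add_distrib]
    congr 1
    · exact Finset.sum_congr rfl fun i _ => by ring
    · rw [Finset.sum_comm]
      exact Finset.sum_congr rfl fun s _ => Finset.sum_congr rfl fun i _ => by ring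
  rw [key h fun i x hx => ⟨(min_le_left _ _).trans_lt (hR i x hx).1,
      (hR i x hx).2.trans_le (le_max_left _ _)⟩,
    key h' fun i x hx => ⟨(min_le_right _ _).trans_lt (hR' i x hx).1,
      (hR' i x hx).2.trans_le (le_max_right _ _)⟩, h.zero.2, h'.zero.2]
  congr 1
  refine Finset.sum_congr rfl fun s hs => ?_
  rcases hSmem hs with hw | hw
  · rw [(h.inner s hw).2, (h'.inner s hw).2]
  · rw [(h.outer s hw).2, (h'.outer s hw).2]

/-! ### Existence and stability of separating chains -/

/-- Take a circle about 0 whose radius is not the modulus of any pole. Only finitely many poles are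
on its wrong side, and each of them is corrected by a small circle around it, with coefficient 1 for
an inner and -1 for an outer pole. Chains make it unnecessary to join these circles to a single
curve. -/
theorem exists_separates [Fintype J] (hp : ‖p‖ < 1) (hq : ‖q‖ < 1) (hp0 : p ≠ 0) (hq0 : q ≠ 0)
    {t : J → ℂ} (h0 : ∀ j, t j ≠ 0) (h : ∀ j k (a b : ℕ), t j * t k * p ^ a * q ^ b ≠ 1) :
    ∃ K : Chain, K.Separates p q t := by
  classical
  have hdisj (w : ℂ) (h1 : w ∈ innerPoles p q t) (h2 : w ∈ outerPoles p q t) : False := by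
    obtain ⟨j, a, b, rfl⟩ := h1
    obtain ⟨k, c, d, hk⟩ := h2
    refine h j k (a + c) (b + d) ?_
    have := mul_eq_one_iff_eq_inv₀ (mul_ne_zero (mul_ne_zero (h0 k) (pow_ne_zero c hp0))
      (pow_ne_zero d hq0)) |>.2 hk
    rw [← this]
    ring
  have hin0 : (0 : ℂ) ∉ innerPoles p q t := by
    rintro ⟨j, a, b, hj⟩
    exact mul_ne_zero (mul_ne_zero (h0 j) (pow_ne_zero a hp0)) (pow_ne_zero b hq0) hj.symm
  have hout0 : (0 : ℂ) ∉ outerPoles p q t := by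
    rintro ⟨j, a, b, hj⟩
    exact inv_ne_zero (mul_ne_zero (mul_ne_zero (h0 j) (pow_ne_zero a hp0))
      (pow_ne_zero b hq0)) hj.symm
  have hcount : (innerPoles p q t ∪ outerPoles p q t).Countable := by
    refine Set.Countable.union ?_ ?_
    · refine (countable_range fun n : J × ℕ × ℕ => t n.1 * p ^ n.2.1 * q ^ n.2.2).mono ?_
      rintro w ⟨j, a, b, rfl⟩
      exact ⟨(j, a, b), rfl⟩
    · refine (countable_range fun n : J × ℕ × ℕ => (t n.1 * p ^ n.2.1 * q ^ n.2.2)⁻¹).mono ?_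
      rintro w ⟨j, a, b, rfl⟩
      exact ⟨(j, a, b), rfl⟩
  obtain ⟨ρ, hρ0, hρ⟩ : ∃ ρ : ℝ, 0 < ρ ∧ ∀ w ∈ innerPoles p q t ∪ outerPoles p q t, ‖w‖ ≠ ρ := by
    obtain ⟨ρ, hρ0, hρ⟩ := ((hcount.image norm).dense_compl ℝ).exists_mem_open isOpen_Ioi
      (nonempty_Ioi (a := (0 : ℝ)))
    exact ⟨ρ, hρ, fun w hw e => hρ0 ⟨w, hw, e⟩⟩
  have hT : ({w ∈ innerPoles p q t | ρ ≤ ‖w‖} ∪ {w ∈ outerPoles p q t | w ≠ 0 ∧ ‖w‖ ≤ ρ}).Finite :=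
    (finite_innerPoles hp hq t hρ0).union (finite_outerPoles hp hq t)
  set T := hT.toFinset with hTdef
  have hTmem {w : ℂ} : w ∈ T ↔ (w ∈ innerPoles p q t ∧ ρ < ‖w‖) ∨
      (w ∈ outerPoles p q t ∧ ‖w‖ < ρ) := by
    rw [hTdef, Finite.mem_toFinset]
    constructor
    · rintro (⟨hw, hw'⟩ | ⟨hw, hw0, hw'⟩)
      · exact Or.inl ⟨hw, hw'.lt_of_ne' (hρ w (Or.inl hw))⟩
      · exact Or.inr ⟨hw, hw'.lt_of_ne (hρ w (Or.inr hw))⟩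
    · rintro (⟨hw, hw'⟩ | ⟨hw, hw'⟩)
      · exact Or.inl ⟨hw, hw'.le⟩
      · exact Or.inr ⟨hw, ne_of_mem_of_not_mem hw hout0, hw'.le⟩
  -- The closed disk of radius δ about s contains neither 0 nor a pole other than s. Only finitely
  -- many poles have modulus between |s|/2 and 2|s|, or need to be considered at all; the others are
  -- farther than |s|/2 from s.
  have hδ (s : ℂ) (hs : s ≠ 0) : ∃ δ : ℝ, 0 < δ ∧ δ < ‖s‖ ∧
      ∀ w ∈ innerPoles p q t ∪ outerPoles p q t, w ≠ s → δ < ‖w - s‖ := by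
    have hs' : 0 < ‖s‖ := norm_pos_iff.2 hs
    have hB : ({w ∈ innerPoles p q t | ‖s‖ / 2 ≤ ‖w‖} ∪
        {w ∈ outerPoles p q t | w ≠ 0 ∧ ‖w‖ ≤ 2 * ‖s‖}).Finite :=
      (finite_innerPoles hp hq t (by positivity)).union (finite_outerPoles hp hq t)
    have hev : ∀ᶠ δ in 𝓝[>] (0 : ℝ), ∀ w ∈ ({w ∈ innerPoles p q t | ‖s‖ / 2 ≤ ‖w‖} ∪
        {w ∈ outerPoles p q t | w ≠ 0 ∧ ‖w‖ ≤ 2 * ‖s‖}), w ≠ s → δ < ‖w - s‖ := by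
      rw [Filter.eventually_all_finite hB]
      intro w _
      rcases eq_or_ne w s with rfl | hws
      · exact Eventually.of_forall fun _ hne => absurd rfl hne
      · filter_upwards [Ioo_mem_nhdsGT (norm_pos_iff.2 (sub_ne_zero.2 hws))] with δ hδ _
        exact hδ.2
    obtain ⟨δ, ⟨hδ1, hδ2⟩, hδ3⟩ := ((Filter.Eventually.and (Ioo_mem_nhdsGT
      (show (0 : ℝ) < ‖s‖ / 2 by positivity)) hev)).exists
    refine ⟨δ, hδ1, by linarith, fun w hw hws => ?_⟩
    have hfar (hfar : ‖w‖ < ‖s‖ / 2 ∨ 2 * ‖s‖ < ‖w‖) : δ < ‖w - s‖ := by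
      rcases hfar with hf | hf
      · have := norm_sub_norm_le s w
        rw [norm_sub_rev] at this
        linarith
      · have := norm_sub_norm_le w s
        linarith
    rcases hw with hw | hw
    · by_cases hle : ‖s‖ / 2 ≤ ‖w‖
      · exact hδ3 w (Or.inl ⟨hw, hle⟩) hws
      · exact hfar (Or.inl (not_le.1 hle))
    · by_cases hle : ‖w‖ ≤ 2 * ‖s‖
      · exact hδ3 w (Or.inr ⟨hw, ne_of_mem_of_not_mem hw hout0, hle⟩) hws
      · exact hfar (Or.inr (not_le.1 hle))
  have hTne (s : T) : (s : ℂ) ≠ 0 := by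
    rcases hTmem.1 s.2 with hs | hs
    · exact ne_of_mem_of_not_mem hs.1 hin0
    · exact ne_of_mem_of_not_mem hs.1 hout0
  choose δ hδ0 hδs hδ using fun s : T => hδ s (hTne s)
  let K : Chain :=
    ⟨Option T, inferInstance,
      fun i => i.elim 1 fun s => if (s : ℂ) ∈ innerPoles p q t then 1 else -1,
      fun i => i.elim (circle 0 ρ) fun s => circle s (δ s)⟩
  have hK (w : ℂ) : K.winding w = (circle 0 ρ).winding w + ∑ s : T,
      (if (s : ℂ) ∈ innerPoles p q t then 1 else -1) * (circle s (δ s)).winding w := by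
    rw [winding]
    change ∑ i : Option T, _ = _
    rw [Fintype.sum_option]
    simp [K]
  have hbig (w : ℂ) (hw : ‖w‖ ≠ ρ) : (circle 0 ρ).Avoids w ∧
      (circle 0 ρ).winding w = if ‖w‖ < ρ then 1 else 0 := by
    split_ifs with hlt
    · exact circle_encloses (by simpa using hlt)
    · exact circle_excludes hρ0.le (by simpa using lt_of_le_of_ne (not_lt.1 hlt) hw.symm)
  have hsmall (w : ℂ) (hw : w = 0 ∨ w ∈ innerPoles p q t ∪ outerPoles p q t) (s : T) :
      (circle s (δ s)).Avoids w ∧ (circle s (δ s)).winding w = if w = s then 1 else 0 := by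
    split_ifs with hws
    · exact circle_encloses (by simpa [hws] using hδ0 s)
    · refine circle_excludes (hδ0 s).le ?_
      rcases hw with rfl | hw
      · simpa using hδs s
      · exact hδ s w hw hws
  have hA (w : ℂ) (hw : w = 0 ∨ w ∈ innerPoles p q t ∪ outerPoles p q t) : K.Avoids w := by
    intro i
    have hwρ : ‖w‖ ≠ ρ := by
      rcases hw with rfl | hw
      · simpa using hρ0.ne
      · exact hρ w hw
    rcases i with _ | s
    · exact (hbig w hwρ).1
    · exact (hsmall w hw s).1
  have hsum (w : ℂ) (hw : w = 0 ∨ w ∈ innerPoles p q t ∪ outerPoles p q t) :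
      ∑ s : T, (if (s : ℂ) ∈ innerPoles p q t then (1 : ℂ) else -1) *
        (circle s (δ s)).winding w =
      if w ∈ T then (if w ∈ innerPoles p q t then 1 else -1) else 0 := by
    simp only [fun s => (hsmall w hw s).2, mul_ite, mul_one, mul_zero]
    rw [Finset.sum_coe_sort T (fun s => if w = s then
      (if s ∈ innerPoles p q t then (1 : ℂ) else -1) else 0), Finset.sum_ite_eq]
  refine ⟨K, ⟨hA 0 (Or.inl rfl), ?_⟩, fun w hw => ⟨hA w (Or.inr (Or.inl hw)), ?_⟩,
    fun w hw => ⟨hA w (Or.inr (Or.inr hw)), ?_⟩⟩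
  · have : (0 : ℂ) ∉ T := fun h0 => hTne ⟨0, h0⟩ rfl
    rw [hK, hsum 0 (Or.inl rfl), (hbig 0 (by simpa using hρ0.ne)).2, if_neg this]
    simp [hρ0]
  · have hwρ := hρ w (Or.inl hw)
    rw [hK, hsum w (Or.inr (Or.inl hw)), (hbig w hwρ).2]
    by_cases hlt : ‖w‖ < ρ
    · have : w ∉ T := fun hwT => (hTmem.1 hwT).elim (fun h1 => h1.2.not_gt hlt)
        fun h1 => hdisj w hw h1.1
      simp [hlt, this]
    · have : w ∈ T := hTmem.2 (Or.inl ⟨hw, lt_of_le_of_ne (not_lt.1 hlt) hwρ.symm⟩)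
      simp [hlt, this, hw]
  · have hwρ := hρ w (Or.inr hw)
    have hwi : w ∉ innerPoles p q t := fun hi => hdisj w hi hw
    rw [hK, hsum w (Or.inr (Or.inr hw)), (hbig w hwρ).2]
    by_cases hlt : ‖w‖ < ρ
    · have : w ∈ T := hTmem.2 (Or.inr ⟨hw, hlt⟩)
      simp [hlt, this, hwi]
    · have : w ∉ T := fun hwT => (hTmem.1 hwT).elim (fun h1 => hwi h1.1)
        fun h1 => hlt h1.2
      simp [hlt, this]

theorem winding_eq_of_forall (K : Chain) {w w' : ℂ} (h : ∀ i, ∀ x ∈ Icc (0 : ℝ) 1,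
    ‖w - w'‖ < ‖(K.curve i).toFun x - w'‖) : K.Avoids w ∧ K.winding w = K.winding w' :=
  ⟨fun i => (Contour.winding_eq_of_dist_lt (h i)).1,
    Finset.sum_congr rfl fun i _ => by rw [(Contour.winding_eq_of_dist_lt (h i)).2.2]⟩

theorem Avoids.eventually {K : Chain} {w' : ℂ} (h : K.Avoids w') :
    ∀ᶠ w in 𝓝 w', K.Avoids w ∧ K.winding w = K.winding w' := by
  have h1 : ∀ i, ∀ᶠ w in 𝓝 w', ∀ x ∈ Icc (0 : ℝ) 1, ‖w - w'‖ < ‖(K.curve i).toFun x - w'‖ := by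
    intro i
    obtain ⟨x, hx, hx'⟩ := isCompact_Icc.exists_isMinOn (nonempty_Icc.2 (zero_le_one (α := ℝ)))
      ((K.curve i).continuousOn.sub continuousOn_const).norm (f := fun x =>
        ‖(K.curve i).toFun x - w'‖)
    have h0 : 0 < ‖(K.curve i).toFun x - w'‖ := norm_pos_iff.2 (sub_ne_zero.2 (h i x hx))
    filter_upwards [Metric.ball_mem_nhds w' h0] with w hw y hy
    exact (mem_ball_iff_norm.1 hw).trans_le (hx' hy)
  filter_upwards [eventually_all.2 h1] with w hw
  exact K.winding_eq_of_forall hw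

/-- Infinitely many conditions have to persist. Near t₀ all but finitely many inner poles are closer
to 0 than the chain is, uniformly in t, and have the winding number of 0, while their inverses lie
outside a disk that contains the chain. The remaining poles move continuously. -/
theorem Separates.eventually [Fintype J] (hp : ‖p‖ < 1) (hq : ‖q‖ < 1) (hp0 : p ≠ 0)
    (hq0 : q ≠ 0) {K : Chain} {t₀ : J → ℂ} (h : K.Separates p q t₀) :
    ∀ᶠ t in 𝓝 t₀, K.Separates p q t := by
  obtain ⟨r, R, hr, hR⟩ := exists_chain_bounds h.zero.1
  have hpq (a b : ℕ) : p ^ a * q ^ b ≠ 0 := mul_ne_zero (pow_ne_zero a hp0) (pow_ne_zero b hq0)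
  have key (j : J) : ∀ᶠ t in 𝓝 t₀, ∀ a b : ℕ,
      (K.Avoids (t j * p ^ a * q ^ b) ∧ K.winding (t j * p ^ a * q ^ b) = 1) ∧
      (K.Avoids (t j * p ^ a * q ^ b)⁻¹ ∧ K.winding (t j * p ^ a * q ^ b)⁻¹ = 0) := by
    have hB : 0 < ‖t₀ j‖ + 1 := by positivity
    -- A pole of modulus less than r' lies closer to 0 than the chain, and its inverse has modulus
    -- larger than R.
    set r' := min r (|R| + 1)⁻¹ with hr'
    have hr'0 : 0 < r' := lt_min hr (by positivity)
    have hfin := finite_pow_mul_pow hp hq (r := r' / (‖t₀ j‖ + 1)) (by positivity)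
    have e0 : ∀ᶠ t in 𝓝 t₀, t j ≠ 0 :=
      (continuous_apply j).continuousAt.eventually_ne (h.param_ne_zero j)
    have e1 : ∀ᶠ t in 𝓝 t₀, ‖t j‖ < ‖t₀ j‖ + 1 :=
      (continuous_apply j).norm.continuousAt.eventually_lt_const (lt_add_one _)
    have e2 : ∀ᶠ t in 𝓝 t₀, ∀ n ∈ {n : ℕ × ℕ | r' / (‖t₀ j‖ + 1) ≤ ‖p ^ n.1 * q ^ n.2‖},
        (K.Avoids (t j * p ^ n.1 * q ^ n.2) ∧ K.winding (t j * p ^ n.1 * q ^ n.2) = 1) ∧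
        (K.Avoids (t j * p ^ n.1 * q ^ n.2)⁻¹ ∧ K.winding (t j * p ^ n.1 * q ^ n.2)⁻¹ = 0) := by
      rw [Filter.eventually_all_finite hfin]
      rintro ⟨a, b⟩ _
      have c1 : ContinuousAt (fun t : J → ℂ => t j * p ^ a * q ^ b) t₀ :=
        (((continuous_apply j).mul continuous_const).mul continuous_const).continuousAt
      have c2 : ContinuousAt (fun t : J → ℂ => (t j * p ^ a * q ^ b)⁻¹) t₀ :=
        c1.inv₀ (mul_ne_zero (mul_ne_zero (h.param_ne_zero j) (pow_ne_zero a hp0))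
          (pow_ne_zero b hq0))
      have i1 := h.inner _ ⟨j, a, b, rfl⟩
      have i2 := h.outer _ ⟨j, a, b, rfl⟩
      filter_upwards [c1.eventually i1.1.eventually, c2.eventually i2.1.eventually] with t h1 h2
      exact ⟨⟨h1.1, h1.2.trans i1.2⟩, h2.1, h2.2.trans i2.2⟩
    filter_upwards [e0, e1, e2] with t ht0 ht1 ht2 a b
    by_cases hn : r' / (‖t₀ j‖ + 1) ≤ ‖p ^ a * q ^ b‖
    · exact ht2 (a, b) hn
    · rw [not_le, lt_div_iff₀ hB] at hn
      have hpos : 0 < ‖p ^ a * q ^ b‖ := norm_pos_iff.2 (hpq a b)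
      have hlt : ‖t j * p ^ a * q ^ b‖ < r' := by
        rw [mul_assoc, norm_mul]
        nlinarith
      have hne : t j * p ^ a * q ^ b ≠ 0 := by
        rw [mul_assoc]
        exact mul_ne_zero ht0 (hpq a b)
      constructor
      · have := K.winding_eq_of_forall (w := t j * p ^ a * q ^ b) (w' := 0) fun i x hx => by
          rw [sub_zero, sub_zero]
          exact (hlt.trans_le (min_le_left _ _)).trans (hR i x hx).1
        exact ⟨this.1, this.2.trans h.zero.2⟩
      · have hlt' : R < ‖(t j * p ^ a * q ^ b)⁻¹‖ := by
          rw [norm_inv]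
          have h1 : |R| + 1 < ‖t j * p ^ a * q ^ b‖⁻¹ := by
            rw [lt_inv_comm₀ (by positivity) (norm_pos_iff.2 hne)]
            exact hlt.trans_le (min_le_right _ _)
          linarith [le_abs_self R]
        have h2 (i : K.ι) := Contour.winding_eq_zero_of_lt (C := K.curve i) (c := 0)
          (w := (t j * p ^ a * q ^ b)⁻¹) fun x hx => by
            rw [sub_zero, sub_zero]
            exact (hR i x hx).2.trans hlt'
        refine ⟨fun i => (h2 i).1, ?_⟩
        rw [winding, Finset.sum_eq_zero fun i _ => by rw [(h2 i).2, mul_zero]]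
  filter_upwards [eventually_all.2 key] with t ht
  refine ⟨h.zero, ?_, ?_⟩
  · rintro w ⟨j, a, b, rfl⟩
    exact (ht j a b).1
  · rintro w ⟨j, a, b, rfl⟩
    exact (ht j a b).2

end Chain

/-! ### Holomorphic dependence on parameters -/

/-- A contour integral of a jointly continuous function, holomorphic in a parameter, is
holomorphic in the parameter. -/
theorem Contour.differentiableOn_integral (C : Contour) {U : Set ℂ} (hU : IsOpen U)
    {G : ℂ → ℂ → ℂ}
    (hc : ContinuousOn (fun y : ℂ × ℂ => G y.1 y.2) (U ×ˢ (C.toFun '' Icc 0 1)))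
    (hd : ∀ x ∈ Icc (0 : ℝ) 1, DifferentiableOn ℂ (fun u => G u (C.toFun x)) U) :
    DifferentiableOn ℂ (fun u => C.integral (G u)) U := by
  intro u₀ hu₀
  obtain ⟨ε, hε, hεU⟩ := Metric.isOpen_iff.1 hU u₀ hu₀
  set δ := ε / 4 with hδ
  have hδ0 : 0 < δ := by positivity
  have hsub : Metric.closedBall u₀ (2 * δ) ⊆ U :=
    (Metric.closedBall_subset_ball (by linarith)).trans hεU
  have himg : IsCompact (C.toFun '' Icc 0 1) := isCompact_Icc.image_of_continuousOn C.continuousOn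
  obtain ⟨M, hM⟩ := ((isCompact_closedBall u₀ (2 * δ)).prod himg).exists_bound_of_continuousOn
    (hc.mono (prod_mono hsub subset_rfl))
  have hcx (u : ℂ) (hu : u ∈ U) : ContinuousOn (fun x => G u (C.toFun x)) (Icc 0 1) :=
    hc.comp (f := fun x => (u, C.toFun x)) (continuousOn_const.prodMk C.continuousOn)
      fun x hx => ⟨hu, mem_image_of_mem _ hx⟩
  have hint (u : ℂ) (hu : u ∈ U) := C.intervalIntegrable (hcx u hu)
  have hder (x : ℝ) (hx : x ∈ Icc (0 : ℝ) 1) (u : ℂ) (hu : u ∈ U) :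
      HasDerivAt (fun u => G u (C.toFun x)) (deriv (fun u => G u (C.toFun x)) u) u :=
    ((hd x hx).differentiableAt (hU.mem_nhds hu)).hasDerivAt
  have hIoc : uIoc (0 : ℝ) 1 ⊆ Icc 0 1 := by
    rw [uIoc_of_le zero_le_one]
    exact Ioc_subset_Icc_self
  have key := intervalIntegral.hasDerivAt_integral_of_dominated_loc_of_deriv_le
    (μ := MeasureTheory.volume) (a := 0) (b := 1)
    (F := fun u x => G u (C.toFun x) * deriv C.toFun x)
    (F' := fun u x => deriv (fun u => G u (C.toFun x)) u * deriv C.toFun x)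
    (x₀ := u₀) (s := Metric.ball u₀ δ) (bound := fun x => M / δ * ‖deriv C.toFun x‖)
    (Metric.ball_mem_nhds u₀ hδ0) ?_ (hint u₀ hu₀) ?_ ?_
    (C.integrable.norm.const_mul _) ?_
  · exact key.2.differentiableAt.differentiableWithinAt
  · filter_upwards [hU.mem_nhds hu₀] with u hu
    exact (hint u hu).aestronglyMeasurable_restrict_uIoc
  -- The derivative with respect to the parameter is measurable along the curve as a limit of
  -- difference quotients for a sequence of increments.
  · set s : ℕ → ℂ := fun n => (δ : ℂ) / (n + 1) with hs
    have hs0 : Tendsto s atTop (𝓝[≠] 0) := by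
      refine tendsto_nhdsWithin_iff.2 ⟨?_, Eventually.of_forall fun n => ?_⟩
      · have := (tendsto_one_div_add_atTop_nhds_zero_nat (𝕜 := ℂ)).const_mul (δ : ℂ)
        rw [mul_zero] at this
        refine this.congr fun n => ?_
        simp only [hs]
        ring
      · exact div_ne_zero (by exact_mod_cast hδ0.ne') (Nat.cast_add_one_ne_zero n)
    have hsU (n : ℕ) : u₀ + s n ∈ U := by
      refine hsub ?_
      rw [mem_closedBall_iff_norm, add_sub_cancel_left, hs]
      simp only [norm_div, Complex.norm_real, Real.norm_of_nonneg hδ0.le]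
      have : ‖((n : ℂ) + 1)‖ = n + 1 := by exact_mod_cast Complex.norm_natCast (n + 1)
      rw [this, div_le_iff₀ (by positivity)]
      nlinarith [(Nat.cast_nonneg n : (0 : ℝ) ≤ n)]
    refine aestronglyMeasurable_of_tendsto_ae (u := atTop)
      (f := fun n x => (s n)⁻¹ * (G (u₀ + s n) (C.toFun x) * deriv C.toFun x -
        G u₀ (C.toFun x) * deriv C.toFun x)) (fun n => ?_) ?_
    · exact ((hint _ (hsU n)).aestronglyMeasurable_restrict_uIoc.sub
        (hint _ hu₀).aestronglyMeasurable_restrict_uIoc).const_mul _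
    · refine (MeasureTheory.ae_restrict_iff' measurableSet_uIoc).2
        (Eventually.of_forall fun x hx => ?_)
      have h1 := ((hder x (hIoc hx) u₀ hu₀).tendsto_slope_zero.comp hs0).mul_const
        (deriv C.toFun x)
      refine h1.congr fun n => ?_
      simp only [Function.comp_apply, smul_eq_mul]
      ring
  · refine Eventually.of_forall fun x hx u hu => ?_
    rw [norm_mul]
    refine mul_le_mul_of_nonneg_right ?_ (norm_nonneg _)
    -- Cauchy's estimate on the circle of radius δ about u bounds the derivative by M / δ.
    have hb : Metric.closedBall u δ ⊆ Metric.closedBall u₀ (2 * δ) :=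
      Metric.closedBall_subset_closedBall' (by linarith [(Metric.mem_ball.1 hu).le])
    refine Complex.norm_deriv_le_of_forall_mem_sphere_norm_le hδ0 ?_ fun y hy =>
      hM (y, C.toFun x) ⟨hb (Metric.sphere_subset_closedBall hy), mem_image_of_mem _ (hIoc hx)⟩
    exact ((hd x (hIoc hx)).mono (hb.trans hsub)).diffContOnCl_ball subset_rfl
  · refine Eventually.of_forall fun x hx u hu => ?_
    refine (hder x (hIoc hx) u ?_).mul_const _
    exact hsub (Metric.ball_subset_closedBall
      (Metric.ball_subset_ball (by linarith) hu))

/-! ### The elliptic hypergeometric integral -/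

/-- The parameters for which a separating chain exists. -/
def Admissible (p q : ℂ) (t : J → ℂ) : Prop := ∃ K : Chain, K.Separates p q t

open Classical in
/-- The elliptic hypergeometric integral with parameters `t`, over any separating chain. -/
def hypI [Fintype J] (p q : ℂ) (t : J → ℂ) : ℂ :=
  if h : Admissible p q t then h.choose.integral (fun z => hypF p q t z / z) else 0

theorem Chain.Separates.hypI_eq [Fintype J] (hp : ‖p‖ < 1) (hq : ‖q‖ < 1) {K : Chain} {t : J → ℂ}
    (h : K.Separates p q t) : hypI p q t = K.integral (fun z => hypF p q t z / z) := by
  have hA : Admissible p q t := ⟨K, h⟩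
  rw [hypI, dif_pos hA]
  exact Chain.integral_eq_of_separates hp hq hA.choose_spec h

theorem Admissible.eventually [Fintype J] (hp : ‖p‖ < 1) (hq : ‖q‖ < 1) (hp0 : p ≠ 0)
    (hq0 : q ≠ 0) {t₀ : J → ℂ} (h : Admissible p q t₀) : ∀ᶠ t in 𝓝 t₀, Admissible p q t := by
  obtain ⟨K, hK⟩ := h
  filter_upwards [hK.eventually hp hq hp0 hq0] with t ht using ⟨K, ht⟩

/-- For non-zero parameters, a coincidence of an inner with an outer pole is the only obstruction.
The case j = k is included, so there are conditions on the squares t_j² that do not come from the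
factors Γ(t_j t_k) with j < k. -/
theorem admissible_iff [Fintype J] (hp : ‖p‖ < 1) (hq : ‖q‖ < 1) (hp0 : p ≠ 0) (hq0 : q ≠ 0)
    {t : J → ℂ} : Admissible p q t ↔ (∀ j, t j ≠ 0) ∧ ∀ j k, E p q (t j * t k) ≠ 0 := by
  constructor
  · rintro ⟨K, hK⟩
    refine ⟨hK.param_ne_zero, fun j k h => ?_⟩
    obtain ⟨a, b, hab⟩ := (E_eq_zero_iff hp hq _).1 h
    exact hK.mul_ne_one j k a b hab
  · rintro ⟨h0, h⟩
    exact Chain.exists_separates hp hq hp0 hq0 h0 fun j k a b hab =>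
      h j k ((E_eq_zero_iff hp hq _).2 ⟨a, b, hab⟩)

theorem Chain.Separates.regular (hp : ‖p‖ < 1) (hq : ‖q‖ < 1) {K : Chain} {t : J → ℂ}
    (h : K.Separates p q t) (i : K.ι) {x : ℝ} (hx : x ∈ Icc (0 : ℝ) 1) :
    Regular p q t ((K.curve i).toFun x) :=
  regular_of_notMem hp hq (h.zero.1 i x hx) h.param_ne_zero
    (fun hw => (h.inner _ hw).1 i x hx rfl) fun hw => (h.outer _ hw).1 i x hx rfl

/-- One chain separates the poles for all parameters near u₀, so that differentiation under the
integral applies with a fixed chain. -/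
theorem hypI_differentiableAt [Fintype J] (hp : ‖p‖ < 1) (hq : ‖q‖ < 1) (hp0 : p ≠ 0)
    (hq0 : q ≠ 0) {t : ℂ → J → ℂ} {u₀ : ℂ} (ht : ∀ᶠ u in 𝓝 u₀, DifferentiableAt ℂ t u)
    (h : Admissible p q (t u₀)) : DifferentiableAt ℂ (fun u => hypI p q (t u)) u₀ := by
  obtain ⟨K, hK⟩ := h
  have hev : ∀ᶠ u in 𝓝 u₀, DifferentiableAt ℂ t u ∧ K.Separates p q (t u) :=
    ht.and (ht.self_of_nhds.continuousAt.eventually (hK.eventually hp hq hp0 hq0))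
  obtain ⟨U, hU, hUo, hu₀⟩ := eventually_nhds_iff.1 hev
  have hreg {u : ℂ} (hu : u ∈ U) {z : ℂ} (i : K.ι) (hz : z ∈ (K.curve i).toFun '' Icc 0 1) :
      Regular p q (t u) z := by
    obtain ⟨x, hx, rfl⟩ := hz
    exact (hU u hu).2.regular hp hq i hx
  have hdiff : DifferentiableOn ℂ (fun u => K.integral fun z => hypF p q (t u) z / z) U := by
    refine DifferentiableOn.fun_sum fun i _ => DifferentiableOn.const_mul ?_ _
    refine Contour.differentiableOn_integral _ hUo (G := fun u z => hypF p q (t u) z / z) ?_ ?_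
    · rintro ⟨u, z⟩ ⟨hu, hz⟩
      have hr := hreg hu i hz
      refine DifferentiableAt.continuousAt (𝕜 := ℂ) ?_ |>.continuousWithinAt
      simp only [div_eq_mul_inv]
      refine DifferentiableAt.mul ?_ (DifferentiableAt.inv differentiableAt_snd hr.ne_zero)
      exact hypF_differentiableAt hp hq (f := fun y : ℂ × ℂ => t y.1)
        ((hU u hu).1.comp (f := Prod.fst) (u, z) differentiableAt_fst) differentiableAt_snd hr
    · intro x hx u hu
      have hr := hreg hu i (mem_image_of_mem _ hx)
      refine (DifferentiableAt.div_const ?_ _).differentiableWithinAt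
      exact hypF_differentiableAt hp hq (hU u hu).1 (differentiableAt_const _) hr
  refine (hdiff.differentiableAt (hUo.mem_nhds hu₀)).congr_of_eventuallyEq ?_
  filter_upwards [hUo.mem_nhds hu₀] with u hu
  exact (hU u hu).2.hypI_eq hp hq

/-- The integrand can differ from `hypF` only where z² or z⁻² has the form p^(a+1) q^(b+1), by
default values at removable singularities. This set is countable. -/
theorem V_eq_hypI (hp : ‖p‖ < 1) (hq : ‖q‖ < 1) {C : Contour}
    {t : Fin 8 → ℂ} (h : C.Separates p q t) :
    V p q C t = qPoch q * qPoch p / (4 * Real.pi * Complex.I) * hypI p q t := by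
  have hs := (Chain.single_separates_iff C t).2 h
  have hsq (w : ℂ) : {z : ℂ | z ^ 2 = w}.Countable := by
    rcases {z : ℂ | z ^ 2 = w}.eq_empty_or_nonempty with he | ⟨z₀, hz₀⟩
    · rw [he]
      exact countable_empty
    · refine (Set.Finite.countable (s := {z₀, -z₀}) (by simp)).mono fun z hz => ?_
      exact sq_eq_sq_iff_eq_or_eq_neg.1 (Eq.trans hz (Eq.symm hz₀))
  have hD : (⋃ n : ℕ × ℕ, ({z : ℂ | z ^ 2 = p * q * p ^ n.1 * q ^ n.2} ∪
      {z : ℂ | z ^ 2 = (p * q * p ^ n.1 * q ^ n.2)⁻¹})).Countable :=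
    countable_iUnion fun n => (hsq _).union (hsq _)
  rw [V, hs.hypI_eq hp hq, Chain.single_integral]
  congr 1
  refine C.integral_congr_off_countable hD fun x hx hxD => ?_
  have h0 : C.toFun x ≠ 0 := h.zero.1 x hx
  rw [integrand_eq_hypF hp hq]
  · intro he
    obtain ⟨a, b, hab⟩ := (E_eq_zero_iff hp hq _).1 he
    refine hxD (mem_iUnion.2 ⟨(a, b), Or.inl ?_⟩)
    field_simp at hab
    rw [mem_ofPred_eq, ← hab]
  · intro he
    obtain ⟨a, b, hab⟩ := (E_eq_zero_iff hp hq _).1 he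
    refine hxD (mem_iUnion.2 ⟨(a, b), Or.inr ?_⟩)
    exact eq_inv_of_mul_eq_one_right (by rw [← hab]; ring)

end EllipticHyp

end

/-! ### Zeros of quasi-periodic functions and a theta function identity -/

noncomputable section

namespace EllipticHyp

open Filter Topology Set

/-! ### Quasi-periodic functions on the punctured plane -/

variable {q : ℂ}

/-- For |z| ≤ r the factor K z^k has modulus at most 1, so that a bound on the compact annulus |q| r
≤ |z| ≤ 1 propagates towards 0. -/
theorem bounded_of_quasiperiodic (hq0 : q ≠ 0) (hq : ‖q‖ < 1) {f : ℂ → ℂ} {K : ℂ} {k : ℕ}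
    (hk : k ≠ 0) (hf : ContinuousOn f {0}ᶜ) (h : ∀ z, z ≠ 0 → f (q * z) = K * z ^ k * f z) :
    ∃ M, ∀ z, z ≠ 0 → ‖z‖ ≤ 1 → ‖f z‖ ≤ M := by
  have hq0' : 0 < ‖q‖ := norm_pos_iff.2 hq0
  set r : ℝ := (‖K‖ + 1)⁻¹ with hr
  have hr0 : 0 < r := by positivity
  have hr1 : r ≤ 1 := inv_le_one_of_one_le₀ (by linarith [norm_nonneg K])
  have hKr : ‖K‖ * r ≤ 1 := by
    rw [hr, ← div_eq_mul_inv, div_le_one (by positivity)]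
    linarith
  have hcomp : IsCompact (Metric.closedBall (0 : ℂ) 1 ∩ {z | ‖q‖ * r ≤ ‖z‖}) :=
    (isCompact_closedBall _ _).inter_right (isClosed_le continuous_const continuous_norm)
  obtain ⟨M, hM⟩ := hcomp.exists_bound_of_continuousOn (hf.mono fun z hz => by
    have : 0 < ‖z‖ := (by positivity : 0 < ‖q‖ * r).trans_le hz.2
    exact norm_pos_iff.1 this)
  have key (n : ℕ) : ∀ z : ℂ, ‖q‖ ^ (n + 1) * r ≤ ‖z‖ → ‖z‖ ≤ 1 → ‖f z‖ ≤ M := by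
    induction n with
    | zero => exact fun z h1 h2 => hM z ⟨by simpa using h2, by simpa using h1⟩
    | succ n ih =>
      intro z h1 h2
      by_cases h3 : ‖q‖ * r ≤ ‖z‖
      · exact hM z ⟨by simpa using h2, h3⟩
      · have hz : z = q * (z / q) := by field_simp
        have hzq : ‖z / q‖ < r := by
          rw [norm_div, div_lt_iff₀ hq0', mul_comm]
          exact not_le.1 h3
        have hz0 : z / q ≠ 0 := by
          refine div_ne_zero (norm_pos_iff.1 (lt_of_lt_of_le ?_ h1)) hq0
          positivity
        rw [hz, h _ hz0, norm_mul, norm_mul, norm_pow]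
        have h4 : ‖f (z / q)‖ ≤ M := ih _ (by
          rw [norm_div, le_div_iff₀ hq0']
          calc ‖q‖ ^ (n + 1) * r * ‖q‖ = ‖q‖ ^ (n + 1 + 1) * r := by ring
            _ ≤ ‖z‖ := h1) (hzq.le.trans hr1)
        have h5 : ‖z / q‖ ^ k ≤ r :=
          (pow_le_of_le_one (norm_nonneg _) (hzq.le.trans hr1) hk).trans hzq.le
        calc ‖K‖ * ‖z / q‖ ^ k * ‖f (z / q)‖ ≤ ‖K‖ * r * ‖f (z / q)‖ := by gcongr
          _ ≤ 1 * ‖f (z / q)‖ := by gcongr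
          _ ≤ M := by linarith
  refine ⟨M, fun z hz hz1 => ?_⟩
  obtain ⟨n, hn⟩ := exists_pow_lt_of_lt_one (norm_pos_iff.2 hz) hq
  refine key n z ?_ hz1
  calc ‖q‖ ^ (n + 1) * r ≤ ‖q‖ ^ (n + 1) * 1 := by gcongr
    _ ≤ ‖q‖ ^ n := by
      rw [mul_one]
      exact pow_le_pow_of_le_one (norm_nonneg q) hq.le (Nat.le_succ n)
    _ ≤ ‖z‖ := hn.le

/-- Liouville's theorem for f ∘ exp. -/
theorem const_of_bounded {f : ℂ → ℂ} (hf : DifferentiableOn ℂ f {0}ᶜ) {M : ℝ}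
    (hM : ∀ z, z ≠ 0 → ‖f z‖ ≤ M) {z w : ℂ} (hz : z ≠ 0) (hw : w ≠ 0) : f z = f w := by
  have hd : Differentiable ℂ fun u => f (Complex.exp u) := fun u =>
    (hf.differentiableAt (isOpen_ne.mem_nhds (Complex.exp_ne_zero u))).comp u
      Complex.differentiableAt_exp
  have hb : Bornology.IsBounded (range fun u => f (Complex.exp u)) := by
    refine (Metric.isBounded_closedBall (x := (0 : ℂ)) (r := M)).subset ?_
    rintro _ ⟨u, rfl⟩
    simpa using hM _ (Complex.exp_ne_zero u)
  have := hd.apply_eq_apply_of_bounded hb (Complex.log z) (Complex.log w)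
  rwa [Complex.exp_log hz, Complex.exp_log hw] at this

/-- For K ≠ 0 the function f(1/z) satisfies an equation of the same kind with K⁻¹ q^k in place of K.
Hence f is bounded near 0 and near infinity, so it is constant; a non-zero constant would require K
z^k = 1 for all z, which the points 1 and 2 refute. -/
theorem eq_zero_of_quasiperiodic_pos (hq0 : q ≠ 0) (hq : ‖q‖ < 1) {f : ℂ → ℂ} {K : ℂ} {k : ℕ}
    (hk : k ≠ 0) (hf : DifferentiableOn ℂ f {0}ᶜ)
    (h : ∀ z, z ≠ 0 → f (q * z) = K * z ^ k * f z) {z : ℂ} (hz : z ≠ 0) : f z = 0 := by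
  rcases eq_or_ne K 0 with rfl | hK
  · have := h (z / q) (div_ne_zero hz hq0)
    rwa [mul_div_cancel₀ _ hq0, zero_mul, zero_mul] at this
  obtain ⟨M₁, hM₁⟩ := bounded_of_quasiperiodic hq0 hq hk hf.continuousOn h
  have hinv : ContinuousOn (fun z => f z⁻¹) {0}ᶜ :=
    hf.continuousOn.comp (continuousOn_inv₀) fun y hy => inv_ne_zero hy
  obtain ⟨M₂, hM₂⟩ := bounded_of_quasiperiodic hq0 hq (f := fun z => f z⁻¹) (K := K⁻¹ * q ^ k)
    hk hinv fun y hy => by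
      have h1 := h (q * y)⁻¹ (inv_ne_zero (mul_ne_zero hq0 hy))
      rw [show q * (q * y)⁻¹ = y⁻¹ by field_simp] at h1
      rw [h1, inv_pow, mul_pow]
      generalize f (q * y)⁻¹ = F
      field_simp
  have hconst := fun y (hy : y ≠ 0) => const_of_bounded hf (M := max M₁ M₂) (fun y hy => by
    rcases le_total ‖y‖ 1 with h1 | h1
    · exact (hM₁ y hy h1).trans (le_max_left _ _)
    · have := hM₂ y⁻¹ (inv_ne_zero hy) (by rw [norm_inv]; exact inv_le_one_of_one_le₀ h1)
      rw [inv_inv] at this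
      exact this.trans (le_max_right _ _)) hy hz
  by_contra hne
  have h1 := h 1 one_ne_zero
  have h2 := h 2 two_ne_zero
  rw [hconst _ (mul_ne_zero hq0 one_ne_zero), hconst 1 one_ne_zero, one_pow, mul_one] at h1
  rw [hconst _ (mul_ne_zero hq0 two_ne_zero), hconst 2 two_ne_zero] at h2
  have hK1 : K = 1 := by
    have : (K - 1) * f z = 0 := by linear_combination -h1
    exact sub_eq_zero.1 ((mul_eq_zero.1 this).resolve_right hne)
  have h3 : (2 : ℂ) ^ k = 1 := by
    have : ((2 : ℂ) ^ k - 1) * f z = 0 := by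
      rw [hK1] at h2
      linear_combination -h2
    exact sub_eq_zero.1 ((mul_eq_zero.1 this).resolve_right hne)
  have h4 : (2 : ℕ) ^ k = 1 := by exact_mod_cast h3
  exact hk (by simpa using h4)

/-- Division of holomorphic functions by one with simple zeros. -/
theorem exists_quotient {U : Set ℂ} (hU : IsOpen U) {f g : ℂ → ℂ} (hf : DifferentiableOn ℂ f U)
    (hg : DifferentiableOn ℂ g U) (h : ∀ z ∈ U, g z = 0 → f z = 0 ∧ deriv g z ≠ 0) :
    ∃ k : ℂ → ℂ, DifferentiableOn ℂ k U ∧ ∀ z ∈ U, f z = g z * k z := by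
  classical
  refine ⟨fun z => if g z = 0 then deriv f z / deriv g z else f z / g z, fun z hz => ?_,
    fun z hz => ?_⟩
  · by_cases hgz : g z = 0
    · obtain ⟨hfz, hdg⟩ := h z hz hgz
      have d1 : DifferentiableAt ℂ (dslope f z) z :=
        ((Complex.differentiableOn_dslope (hU.mem_nhds hz)).2 hf).differentiableAt
          (hU.mem_nhds hz)
      have d2 : DifferentiableAt ℂ (dslope g z) z :=
        ((Complex.differentiableOn_dslope (hU.mem_nhds hz)).2 hg).differentiableAt
          (hU.mem_nhds hz)
      have hne : dslope g z z ≠ 0 := by rwa [dslope_same]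
      refine ((d1.div d2 hne).congr_of_eventuallyEq ?_).differentiableWithinAt
      filter_upwards [d2.continuousAt.eventually_ne hne] with y hy
      rcases eq_or_ne y z with rfl | hyz
      · simp [hgz, dslope_same]
      · rw [dslope_of_ne _ hyz, slope_def_field, hgz, sub_zero] at hy
        have hgy : g y ≠ 0 := fun h0 => hy (by rw [h0, zero_div])
        have hyz' : y - z ≠ 0 := sub_ne_zero.2 hyz
        rw [if_neg hgy, Pi.div_apply, dslope_of_ne _ hyz, dslope_of_ne _ hyz, slope_def_field,
          slope_def_field, hfz, hgz, sub_zero, sub_zero]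
        field_simp
    · have d1 := hf.differentiableAt (hU.mem_nhds hz)
      have d2 := hg.differentiableAt (hU.mem_nhds hz)
      refine ((d1.div d2 hgz).congr_of_eventuallyEq ?_).differentiableWithinAt
      filter_upwards [d2.continuousAt.eventually_ne hgz] with y hy
      rw [if_neg hy, Pi.div_apply]
  · dsimp only
    split_ifs with hgz
    · rw [(h z hz hgz).1, hgz, zero_mul]
    · field_simp

/-- A theta function with more zeros than its degree vanishes. -/
theorem eq_zero_of_quasiperiodic (hq0 : q ≠ 0) (hq : ‖q‖ < 1) (L : List ℂ) {f : ℂ → ℂ} {K : ℂ}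
    {m : ℤ} (hf : DifferentiableOn ℂ f {0}ᶜ)
    (h : ∀ z, z ≠ 0 → f (q * z) = K * z ^ m * f z) (hL0 : ∀ a ∈ L, a ≠ 0) (hL : ∀ a ∈ L, f a = 0)
    (hpw : L.Pairwise fun a b => ∀ k : ℤ, b ≠ q ^ k * a) (hm : 0 < m + L.length) {z : ℂ}
    (hz : z ≠ 0) : f z = 0 := by
  -- Division by θ(z/a) removes the orbit of a under q^ℤ from the zeros and raises the exponent m by
  -- one. When the list is exhausted, the exponent is positive.
  induction L generalizing f K m with
  | nil =>
    obtain ⟨k, rfl⟩ := Int.eq_ofNat_of_zero_le (a := m) (by simpa using hm.le)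
    refine eq_zero_of_quasiperiodic_pos hq0 hq (K := K) (k := k) ?_ hf (fun z hz => ?_) hz
    · rintro rfl
      simp at hm
    · simpa using h z hz
  | cons a L ih =>
    have ha : a ≠ 0 := hL0 a (by simp)
    have hfa : f a = 0 := hL a (by simp)
    rw [List.pairwise_cons] at hpw
    have hfk (k : ℤ) : f (q ^ k * a) = 0 := by
      induction k with
      | zero => simpa using hfa
      | succ k ih =>
        rw [zpow_add_one₀ hq0, mul_comm _ q, mul_assoc, h _ (by positivity), ih, mul_zero]
      | pred k ih =>
        have hne : q ^ (-(k : ℤ) - 1) * a ≠ 0 := by positivity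
        rw [show q ^ (-(k : ℤ)) * a = q * (q ^ (-(k : ℤ) - 1) * a) by
          rw [zpow_sub_one₀ hq0]; field_simp, h _ hne] at ih
        rcases mul_eq_zero.1 ih with h0 | h0
        · rcases mul_eq_zero.1 h0 with h0 | h0
          · have := h (q ^ (-(k : ℤ) - 1) * a / q) (div_ne_zero hne hq0)
            rwa [h0, zero_mul, zero_mul, mul_div_cancel₀ _ hq0] at this
          · exact absurd h0 (zpow_ne_zero _ hne)
        · exact h0
    have hθ (y : ℂ) (hy : y ≠ 0) : HasDerivAt (fun y => theta q (y / a))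
        (deriv (theta q) (y / a) * a⁻¹) y := by
      have := (theta_differentiableAt hq (div_ne_zero hy ha)).hasDerivAt
      exact this.comp y (by simpa using (hasDerivAt_id y).div_const a)
    obtain ⟨g, hg, hfg⟩ := exists_quotient (U := {0}ᶜ) isOpen_ne hf
      (g := fun y => theta q (y / a)) (fun y hy => (hθ y hy).differentiableAt.differentiableWithinAt)
      (fun y hy hy0 => by
        have hya : y / a ≠ 0 := div_ne_zero hy ha
        obtain ⟨k, hk⟩ := (theta_eq_zero_iff hq0 hq hya).1 hy0
        constructor
        · rw [← hfk k, ← hk, div_mul_cancel₀ _ ha]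
        · rw [(hθ y hy).deriv]
          exact mul_ne_zero (deriv_theta_ne_zero hq0 hq hya hy0) (inv_ne_zero ha))
    have hqper : ∀ y, y ≠ 0 → g (q * y) = -(K / a) * y ^ (m + 1) * g y := by
      have h1 (y : ℂ) (hy : y ≠ 0) (hy0 : theta q (y / a) ≠ 0) :
          g (q * y) = -(K / a) * y ^ (m + 1) * g y := by
        have h2 := h y hy
        rw [hfg _ (mul_ne_zero hq0 hy), hfg y hy, mul_div_assoc,
          theta_mul hq0 hq (div_ne_zero hy ha)] at h2
        rw [zpow_add_one₀ hy]
        refine mul_left_cancel₀ hy0 (mul_left_cancel₀ (neg_ne_zero.2 (inv_ne_zero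
          (div_ne_zero hy ha))) ?_)
        rw [← mul_assoc, h2]
        field_simp
      intro y hy
      -- At the zeros of the divisor the functional equation of the quotient follows by continuity,
      -- since these zeros are isolated.
      by_cases hy0 : theta q (y / a) = 0
      · have hya : y / a ≠ 0 := div_ne_zero hy ha
        have hne := (hθ y hy).eventually_ne (c := 0)
          (mul_ne_zero (deriv_theta_ne_zero hq0 hq hya hy0) (inv_ne_zero ha))
        have hev : ∀ᶠ x in 𝓝[≠] y, g (q * x) = -(K / a) * x ^ (m + 1) * g x := by
          filter_upwards [hne, nhdsWithin_le_nhds (isOpen_ne.mem_nhds hy)] with x hx hx0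
          exact h1 x hx0 hx
        have c0 : ContinuousAt (fun x => g (q * x)) y :=
          ContinuousAt.comp (g := g) (f := fun x => q * x)
            (hg.continuousOn.continuousAt (isOpen_ne.mem_nhds (mul_ne_zero hq0 hy))) (by fun_prop)
        have c1 : ContinuousAt (fun x => -(K / a) * x ^ (m + 1) * g x) y :=
          (continuousAt_const.mul (continuousAt_zpow₀ y _ (Or.inl hy))).mul
            (hg.continuousOn.continuousAt (isOpen_ne.mem_nhds hy))
        exact tendsto_nhds_unique_of_eventuallyEq (c0.mono_left nhdsWithin_le_nhds)
          (c1.mono_left nhdsWithin_le_nhds) hev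
      · exact h1 y hy hy0
    rw [hfg z hz, ih hg hqper (fun b hb => hL0 b (by simp [hb])) (fun b hb => ?_) hpw.2
      (by simp only [List.length_cons] at hm; push_cast at hm; linarith), mul_zero]
    have hb0 : b ≠ 0 := hL0 b (by simp [hb])
    have h1 := hL b (by simp [hb])
    rw [hfg b hb0] at h1
    refine (mul_eq_zero.1 h1).resolve_left fun h2 => ?_
    obtain ⟨k, hk⟩ := (theta_eq_zero_iff hq0 hq (div_ne_zero hb0 ha)).1 h2
    exact hpw.1 b hb k (by rw [← hk, div_mul_cancel₀ _ ha])

theorem theta_mul_div (hq0 : q ≠ 0) (hq : ‖q‖ < 1) {x z : ℂ} (hx : x ≠ 0) (hz : z ≠ 0) :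
    theta q (x / (q * z)) = -(x / (q * z)) * theta q (x / z) := by
  have h := theta_mul hq0 hq (x := x / (q * z)) (div_ne_zero hx (mul_ne_zero hq0 hz))
  rw [show q * (x / (q * z)) = x / z by field_simp] at h
  rw [h]
  field_simp

theorem theta_mul_mul (hq0 : q ≠ 0) (hq : ‖q‖ < 1) {x z : ℂ} (hx : x ≠ 0) (hz : z ≠ 0) :
    theta q (x * (q * z)) = -(x * z)⁻¹ * theta q (x * z) := by
  rw [← theta_mul hq0 hq (mul_ne_zero hx hz)]
  ring_nf

/-- The theta function identity behind the difference equation of the elliptic beta integral. -/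
theorem theta_identity (hq0 : q ≠ 0) (hq : ‖q‖ < 1) {a b : ℂ} {c : Fin 4 → ℂ}
    (hprod : a * b * ∏ j, c j = q) (ha2 : ∀ k : ℤ, a ^ 2 ≠ q ^ k) (hb2 : ∀ k : ℤ, b ^ 2 ≠ q ^ k)
    (hab : ∀ k : ℤ, a * b ≠ q ^ k) (hba : ∀ k : ℤ, b ≠ q ^ k * a) {z : ℂ} (hz : z ≠ 0) :
    a * theta q (b / a) * (z⁻¹ * (theta q (a * z) * theta q (b * z) * ∏ j, theta q (c j * z)) -
      z ^ 3 * (theta q (a / z) * theta q (b / z) * ∏ j, theta q (c j / z))) =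
    theta q (z ^ 2) * (theta q (b * z) * theta q (b / z) * ∏ j, theta q (c j * a) -
      theta q (a * z) * theta q (a / z) * ∏ j, theta q (c j * b)) := by
  have habc : a * b * ∏ j, c j ≠ 0 := hprod ▸ hq0
  have ha : a ≠ 0 := left_ne_zero_of_mul (left_ne_zero_of_mul habc)
  have hb : b ≠ 0 := right_ne_zero_of_mul (left_ne_zero_of_mul habc)
  have hc (j : Fin 4) : c j ≠ 0 := Finset.prod_ne_zero_iff.1 (right_ne_zero_of_mul habc) j
    (Finset.mem_univ j)
  obtain ⟨s, hs⟩ : ∃ s : ℂ, s ^ 2 = q := IsAlgClosed.exists_pow_nat_eq q two_pos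
  have hs0 : s ≠ 0 := by
    rintro rfl
    exact hq0 (by rw [← hs]; ring)
  have hmul {x : ℂ} (hx : x ≠ 0) : theta q (x * s) = -(s / x) * theta q (x / s) := by
    have h := theta_mul hq0 hq (x := x / s) (div_ne_zero hx hs0)
    rw [show q * (x / s) = x * s by rw [← hs]; field_simp] at h
    rw [h, inv_div]
  have h1 : theta q 1 = 0 := theta_one hq
  have hθq : theta q q = 0 := by
    have := theta_mul hq0 hq one_ne_zero
    rwa [mul_one, h1, mul_zero] at this
  have hinv {x : ℂ} (hx : x ≠ 0) : theta q x⁻¹ = -x⁻¹ * theta q x := theta_inv hq0 hq hx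
  rw [← sub_eq_zero]
  have hnorm (k : ℤ) (x : ℂ) (hx : ‖x‖ = 1) (h : x = q ^ k) : x = 1 := by
    have h2 : ‖q‖ ^ k = 1 := by rw [← norm_zpow, ← h, hx]
    have h3 : k = 0 := by
      by_contra hk
      exact absurd ((zpow_eq_one_iff_right₀ (norm_nonneg q) hq.ne).1 h2) hk
    rw [h, h3, zpow_zero]
  have hspow (k : ℤ) (x : ℂ) (hx : ‖x‖ = 1) : s ≠ q ^ k * x := by
    intro h
    have h2 : ‖s‖ = ‖s‖ ^ (2 * k) := by
      conv_lhs => rw [h]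
      rw [norm_mul, hx, mul_one, norm_zpow, ← hs, norm_pow, zpow_mul]
      norm_cast
    have hs1 : ‖s‖ ≠ 1 := by
      intro h3
      rw [← hs, norm_pow, h3, one_pow] at hq
      exact hq.false
    have h3 : ‖s‖ ^ (2 * k - 1) = 1 := by
      rw [zpow_sub_one₀ (norm_ne_zero_iff.2 hs0), ← h2,
        mul_inv_cancel₀ (norm_ne_zero_iff.2 hs0)]
    have := (zpow_eq_one_iff_right₀ (norm_nonneg s) hs1).1 h3
    omega
  -- Replacing z by qz multiplies both sides by q⁻² z⁻⁶, so seven zeros in different orbits force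
  -- equality. Here s is a square root of q; the assumptions on a², b², ab and b/a keep the seven
  -- orbits apart.
  refine eq_zero_of_quasiperiodic hq0 hq [1, -1, s, a, a⁻¹, b, b⁻¹] (K := (q ^ 2)⁻¹) (m := -6)
    (f := fun z => a * theta q (b / a) *
      (z⁻¹ * (theta q (a * z) * theta q (b * z) * ∏ j, theta q (c j * z)) -
      z ^ 3 * (theta q (a / z) * theta q (b / z) * ∏ j, theta q (c j / z))) -
      theta q (z ^ 2) * (theta q (b * z) * theta q (b / z) * ∏ j, theta q (c j * a) -
      theta q (a * z) * theta q (a / z) * ∏ j, theta q (c j * b))) ?_ ?_ ?_ ?_ ?_ ?_ hz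
  · intro y hy
    have hy : y ≠ 0 := hy
    have d1 {x : ℂ} (hx : x ≠ 0) : DifferentiableAt ℂ (fun z => theta q (x * z)) y :=
      (theta_differentiableAt hq (mul_ne_zero hx hy)).comp y (by fun_prop)
    have d2 {x : ℂ} (hx : x ≠ 0) : DifferentiableAt ℂ (fun z => theta q (x / z)) y :=
      (theta_differentiableAt hq (div_ne_zero hx hy)).comp (f := fun z => x / z) y
        (by fun_prop (disch := assumption))
    have d3 : DifferentiableAt ℂ (fun z => theta q (z ^ 2)) y :=
      (theta_differentiableAt hq (pow_ne_zero 2 hy)).comp (f := fun z => z ^ 2) y (by fun_prop)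
    have d4 : DifferentiableAt ℂ (fun z => ∏ j, theta q (c j * z)) y :=
      differentiableAt_prod _ fun j _ => d1 (hc j)
    have d5 : DifferentiableAt ℂ (fun z => ∏ j, theta q (c j / z)) y :=
      differentiableAt_prod _ fun j _ => d2 (hc j)
    have d6 : DifferentiableAt ℂ (fun z : ℂ => z⁻¹) y := differentiableAt_inv hy
    exact ((((d6.mul (((d1 ha).mul (d1 hb)).mul d4)).sub
      ((differentiableAt_id.pow 3).mul (((d2 ha).mul (d2 hb)).mul d5))).const_mul _).sub
      (d3.mul ((((d1 hb).mul (d2 hb)).mul_const _).sub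
        (((d1 ha).mul (d2 ha)).mul_const _)))).differentiableWithinAt
  · intro y hy
    have e2 : theta q ((q * y) ^ 2) = (q * y ^ 4)⁻¹ * theta q (y ^ 2) := by
      rw [show (q * y) ^ 2 = q * (q * y ^ 2) by ring, theta_mul hq0 hq (by positivity),
        theta_mul hq0 hq (by positivity)]
      field_simp
    simp only [theta_mul_mul hq0 hq ha hy, theta_mul_mul hq0 hq hb hy, theta_mul_div hq0 hq ha hy,
      theta_mul_div hq0 hq hb hy, fun j => theta_mul_mul hq0 hq (hc j) hy,
      fun j => theta_mul_div hq0 hq (hc j) hy, Finset.prod_mul_distrib, e2]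
    have p1 : ∏ j, -(c j * y)⁻¹ = a * b / (q * y ^ 4) := by
      rw [← hprod]
      simp only [Fin.prod_univ_four] at habc ⊢
      have := hc 0; have := hc 1; have := hc 2; have := hc 3
      field_simp
    have p2 : ∏ j, -(c j / (q * y)) = q / (a * b * q ^ 4 * y ^ 4) := by
      conv_rhs => rw [← hprod]
      simp only [Fin.prod_univ_four] at habc ⊢
      have := hc 0; have := hc 1; have := hc 2; have := hc 3
      rw [← hprod]
      simp only [Fin.prod_univ_four]
      field_simp
    rw [p1, p2]
    generalize (∏ j, theta q (c j * y)) = P1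
    generalize (∏ j, theta q (c j / y)) = P2
    generalize (∏ j, theta q (c j * a)) = P3
    generalize (∏ j, theta q (c j * b)) = P4
    rw [zpow_neg]
    norm_cast
    field_simp
  · simp [ha, hb, hs0]
  -- At ±1 and s the factor θ(z²) vanishes and the two products on the left cancel. At a, a⁻¹, b and
  -- b⁻¹ one product on each side vanishes, and the other two agree.
  · have z0 {x : ℂ} (hx : x ≠ 0) : theta q (x / x) = 0 := by rw [div_self hx, h1]
    have hab' : theta q (a / b) = -(a / b) * theta q (b / a) := by
      rw [← inv_div b a, hinv (div_ne_zero hb ha)]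
    simp only [List.mem_cons, List.not_mem_nil, or_false]
    rintro x (rfl | rfl | rfl | rfl | rfl | rfl | rfl)
    · simp [h1]
    · simp [h1, div_neg]
      right
      ring
    · rw [hs, hθq]
      simp only [hmul ha, hmul hb, fun j => hmul (hc j), Finset.prod_mul_distrib]
      have p1 : ∏ j, -(x / c j) = x ^ 4 * (a * b) / q := by
        rw [← hprod]
        simp only [Fin.prod_univ_four] at habc ⊢
        have := hc 0; have := hc 1; have := hc 2; have := hc 3
        field_simp
      rw [p1, ← hs]
      field_simp
      ring
    · rw [z0 ha, sq]
      field_simp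
      ring_nf
    · simp only [z0 ha, div_inv_eq_mul, inv_pow, hinv (pow_ne_zero 2 ha), ← div_eq_mul_inv,
        mul_comm b a]
      rw [sq]
      field_simp
      ring_nf
    · rw [z0 hb, hab', sq, mul_comm a x]
      field_simp
      ring_nf
    · simp only [z0 hb, div_inv_eq_mul, inv_pow, hinv (pow_ne_zero 2 hb), ← div_eq_mul_inv, hab']
      rw [sq]
      field_simp
      ring_nf
  · have key {x w : ℂ} (hx : ∀ k : ℤ, x ^ 2 ≠ q ^ k) (j : ℤ) (hw : w ^ 2 = q ^ j) (k : ℤ) :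
        x ≠ q ^ k * w := fun h => hx (2 * k + j) (by
      rw [h, mul_pow, hw, zpow_add₀ hq0, mul_comm 2 k, zpow_mul]
      norm_cast)
    have kinv {x : ℂ} (hx : ∀ k : ℤ, x ^ 2 ≠ q ^ k) (k : ℤ) : x⁻¹ ^ 2 ≠ q ^ k := fun h =>
      hx (-k) (by rw [zpow_neg, ← h, inv_pow, inv_inv])
    have kself {x : ℂ} (hx0 : x ≠ 0) (hx : ∀ k : ℤ, x ^ 2 ≠ q ^ k) (k : ℤ) : x⁻¹ ≠ q ^ k * x :=
      fun h => hx (-k) (by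
        rw [zpow_neg]
        refine eq_inv_of_mul_eq_one_right ?_
        rw [sq, ← mul_assoc, ← h, inv_mul_cancel₀ hx0])
    have w1 : (1 : ℂ) ^ 2 = q ^ (0 : ℤ) := by simp
    have w2 : (-1 : ℂ) ^ 2 = q ^ (0 : ℤ) := by simp
    have w3 : s ^ 2 = q ^ (1 : ℤ) := by simp [hs]
    have a2 := kinv ha2
    have b2 := kinv hb2
    have n1 (k : ℤ) : (-1 : ℂ) ≠ q ^ k * 1 := fun h => by
      have := hnorm k (-1) (by simp) (by rw [h, mul_one])
      norm_num at this
    have n2 (k : ℤ) : b⁻¹ ≠ q ^ k * a := fun h => hab (-k) (by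
      rw [zpow_neg]
      refine eq_inv_of_mul_eq_one_right ?_
      rw [← mul_assoc, ← h, inv_mul_cancel₀ hb])
    have n3 (k : ℤ) : b ≠ q ^ k * a⁻¹ := fun h => hab k (by rw [h]; field_simp)
    have n4 (k : ℤ) : b⁻¹ ≠ q ^ k * a⁻¹ := fun h => hba (-k) (by
      rw [zpow_neg, ← inv_inv b, h, mul_inv, inv_inv])
    simp only [List.pairwise_cons, List.mem_cons, List.not_mem_nil, or_false,
      forall_eq_or_imp, forall_eq, IsEmpty.forall_iff, implies_true, List.Pairwise.nil, and_true]
    exact ⟨⟨n1, fun k => hspow k 1 (by simp), key ha2 0 w1, key a2 0 w1, key hb2 0 w1,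
        key b2 0 w1⟩,
      ⟨fun k => hspow k (-1) (by simp), key ha2 0 w2, key a2 0 w2, key hb2 0 w2, key b2 0 w2⟩,
      ⟨key ha2 1 w3, key a2 1 w3, key hb2 1 w3, key b2 1 w3⟩,
      ⟨kself ha ha2, hba, n2⟩, ⟨n3, n4⟩, kself hb hb2⟩
  · norm_num

end EllipticHyp

end

/-! ### The difference equation of the integral with six parameters -/

noncomputable section

namespace EllipticHyp

open Filter Topology Set

variable {p q : ℂ} {J : Type}

/-! ### Integrals over circles -/

theorem circleIntegral_inv_mul (f : ℂ → ℂ) {R : ℝ} (hR : R ≠ 0) :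
    (∮ z in C(0, R), z⁻¹ * f z) =
      Complex.I * ∫ θ in (0 : ℝ)..2 * Real.pi, f (circleMap 0 R θ) := by
  rw [circleIntegral, ← intervalIntegral.integral_const_mul]
  refine intervalIntegral.integral_congr fun θ _ => ?_
  have : circleMap 0 R θ ≠ 0 := circleMap_ne_center hR
  simp only [deriv_circleMap, smul_eq_mul]
  field_simp

theorem circleIntegral_inversion (f : ℂ → ℂ) {c : ℂ} (hc : c ≠ 0) :
    (∮ z in C(0, ‖c‖), z⁻¹ * f z) = ∮ z in C(0, 1), z⁻¹ * f (c * z⁻¹) := by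
  rw [circleIntegral_inv_mul _ (norm_ne_zero_iff.2 hc), circleIntegral_inv_mul _ one_ne_zero]
  congr 1
  have h1 (θ : ℝ) : c * (circleMap 0 1 θ)⁻¹ = circleMap 0 ‖c‖ (Complex.arg c - θ) := by
    conv_lhs => rw [← Complex.norm_mul_exp_arg_mul_I c]
    simp only [circleMap, zero_add, Complex.ofReal_one, one_mul, ← Complex.exp_neg]
    rw [mul_assoc, ← Complex.exp_add]
    push_cast
    ring_nf
  simp only [h1]
  rw [intervalIntegral.integral_comp_sub_left (fun θ => f (circleMap 0 ‖c‖ θ)), sub_zero]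
  have hper : Function.Periodic (fun θ => f (circleMap 0 ‖c‖ θ)) (2 * Real.pi) := fun θ => by
    simp only [periodic_circleMap 0 ‖c‖ θ]
  have := hper.intervalIntegral_add_eq 0 (Complex.arg c - 2 * Real.pi)
  rw [zero_add, sub_add_cancel] at this
  exact this

/-! ### Parameters in the unit disk -/

/-- All parameters lie in the punctured unit disk. -/
def Small (t : J → ℂ) : Prop := ∀ j, t j ≠ 0 ∧ ‖t j‖ < 1

theorem norm_mul_lt_one {x y : ℂ} (hx : ‖x‖ ≤ 1) (hy : ‖y‖ < 1) : ‖x * y‖ < 1 := by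
  rw [norm_mul]
  nlinarith [norm_nonneg x, norm_nonneg y]

theorem norm_pow_mul_pow_le_one (hp : ‖p‖ < 1) (hq : ‖q‖ < 1) (a b : ℕ) : ‖p ^ a * q ^ b‖ ≤ 1 := by
  rw [norm_mul, norm_pow, norm_pow]
  exact mul_le_one₀ (pow_le_one₀ (norm_nonneg _) hp.le) (by positivity)
    (pow_le_one₀ (norm_nonneg _) hq.le)

theorem Small.separates (hp : ‖p‖ < 1) (hq : ‖q‖ < 1) (hp0 : p ≠ 0) (hq0 : q ≠ 0) {t : J → ℂ}
    (h : Small t) : (Chain.single (circle 0 1)).Separates p q t := by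
  have hlt (j : J) (a b : ℕ) : ‖t j * p ^ a * q ^ b‖ < 1 := by
    rw [mul_assoc, mul_comm]
    exact norm_mul_lt_one (norm_pow_mul_pow_le_one hp hq a b) (h j).2
  have hne (j : J) (a b : ℕ) : t j * p ^ a * q ^ b ≠ 0 :=
    mul_ne_zero (mul_ne_zero (h j).1 (pow_ne_zero a hp0)) (pow_ne_zero b hq0)
  have hA {w c : ℂ} (h : (circle 0 1).Avoids w ∧ (circle 0 1).winding w = c) :
      (Chain.single (circle 0 1)).Avoids w ∧ (Chain.single (circle 0 1)).winding w = c :=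
    ⟨fun _ => h.1, (Chain.single_winding _ _).trans h.2⟩
  refine ⟨hA (circle_encloses (by simp)), ?_, ?_⟩
  · rintro w ⟨j, a, b, rfl⟩
    exact hA (circle_encloses (by simpa using hlt j a b))
  · rintro w ⟨j, a, b, rfl⟩
    refine hA (circle_excludes zero_le_one ?_)
    rw [sub_zero, norm_inv]
    exact (one_lt_inv₀ (norm_pos_iff.2 (hne j a b))).2 (hlt j a b)

theorem Small.admissible (hp : ‖p‖ < 1) (hq : ‖q‖ < 1) (hp0 : p ≠ 0) (hq0 : q ≠ 0) {t : J → ℂ}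
    (h : Small t) : Admissible p q t := ⟨_, h.separates hp hq hp0 hq0⟩

theorem Small.hypI_eq [Fintype J] (hp : ‖p‖ < 1) (hq : ‖q‖ < 1) (hp0 : p ≠ 0) (hq0 : q ≠ 0)
    {t : J → ℂ} (h : Small t) : hypI p q t = ∮ z in C(0, 1), z⁻¹ * hypF p q t z := by
  rw [(h.separates hp hq hp0 hq0).hypI_eq hp hq, Chain.single_integral, circle_integral]
  simp only [div_eq_mul_inv, mul_comm]

theorem Small.regular (hp : ‖p‖ < 1) (hq : ‖q‖ < 1) {t : J → ℂ} (h : Small t) {z : ℂ}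
    (hz : ‖z‖ = 1) : Regular p q t z := by
  refine ⟨norm_ne_zero_iff.1 (by rw [hz]; exact one_ne_zero), fun j => (h j).1, fun j => ?_,
    fun j => ?_⟩
  · exact E_ne_zero hp hq (by rw [norm_mul, hz, mul_one]; exact (h j).2)
  · exact E_ne_zero hp hq (by rw [norm_mul, norm_inv, hz, inv_one, mul_one]; exact (h j).2)

theorem Small.continuousOn [Fintype J] (hp : ‖p‖ < 1) (hq : ‖q‖ < 1) {t : J → ℂ} (h : Small t) :
    ContinuousOn (hypF p q t) (Metric.sphere 0 1) := fun z hz =>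
  (hypF_differentiableAt hp hq (differentiableAt_const t) differentiableAt_id
    (h.regular hp hq (by simpa using hz))).continuousAt.continuousWithinAt

theorem hypF_comp_equiv {J' : Type} [Fintype J] [Fintype J'] (e : J' ≃ J) (t : J → ℂ) (z : ℂ) :
    hypF p q (fun j => t (e j)) z = hypF p q t z := by
  rw [hypF, hypF, e.prod_comp fun j => Gam p q (t j * z) * Gam p q (t j * z⁻¹)]

theorem hypI_comp_equiv {J' : Type} [Fintype J] [Fintype J'] (hp : ‖p‖ < 1) (hq : ‖q‖ < 1)
    (e : J' ≃ J) (t : J → ℂ) : hypI p q (fun j => t (e j)) = hypI p q t := by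
  have hin : innerPoles p q (fun j => t (e j)) = innerPoles p q t := by
    ext w
    exact e.exists_congr_left.trans (by simp [innerPoles])
  have hout : outerPoles p q (fun j => t (e j)) = outerPoles p q t := by
    ext w
    exact e.exists_congr_left.trans (by simp [outerPoles])
  have hsep (K : Chain) : K.Separates p q (fun j => t (e j)) ↔ K.Separates p q t :=
    ⟨fun h => ⟨h.zero, hin ▸ h.inner, hout ▸ h.outer⟩,
      fun h => ⟨h.zero, hin.symm ▸ h.inner, hout.symm ▸ h.outer⟩⟩
  by_cases hA : Admissible p q t
  · obtain ⟨K, hK⟩ := hA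
    rw [hK.hypI_eq hp hq, ((hsep K).2 hK).hypI_eq hp hq]
    simp only [hypF_comp_equiv]
  · have hA' : ¬ Admissible p q fun j => t (e j) := fun ⟨K, hK⟩ => hA ⟨K, (hsep K).1 hK⟩
    rw [hypI, hypI, dif_neg hA, dif_neg hA']

/-! ### The difference equation of the elliptic beta integral -/

/-- The parameter vector `(a, b, c₀, …, c₃)`. -/
def vec (a b : ℂ) (c : Fin 4 → ℂ) : Fin 6 → ℂ := Fin.cons a (Fin.cons b c)

theorem prod_vec (a b : ℂ) (c : Fin 4 → ℂ) (f : ℂ → ℂ) :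
    ∏ j, f (vec a b c j) = f a * f b * ∏ j, f (c j) := by
  rw [vec, Fin.prod_univ_succ, Fin.prod_univ_succ]
  simp [mul_assoc]

theorem forall_vec {a b : ℂ} {c : Fin 4 → ℂ} {P : ℂ → Prop} :
    (∀ j, P (vec a b c j)) ↔ P a ∧ P b ∧ ∀ j, P (c j) := by
  rw [vec, Fin.forall_fin_succ, Fin.forall_fin_succ]
  simp

/-- The function G is holomorphic for 1 ≤ |z| ≤ 1/|q|, so the circle may be expanded to radius
1/|q|. The substitution z ↦ 1/(qz) takes it back to the unit circle and changes the sign of G. Hence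
the integral equals its own negative. -/
theorem circleIntegral_telescoping (hp : ‖p‖ < 1) (hq : ‖q‖ < 1) (hq0 : q ≠ 0)
    {t : Fin 6 → ℂ} (ht : Small t) :
    (∮ z in C(0, 1), z⁻¹ * ((∏ j, Gam p q (q * t j * z) * Gam p q (t j * z⁻¹)) *
      (theta q (z ^ 2)⁻¹ * z⁻¹))) = 0 := by
  set G : ℂ → ℂ := fun z => (∏ j, Gam p q (q * t j * z) * Gam p q (t j * z⁻¹)) *
      (theta q (z ^ 2)⁻¹ * z⁻¹) with hG
  have hq0' : 0 < ‖q‖ := norm_pos_iff.2 hq0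
  have hodd (z : ℂ) (hz : z ≠ 0) : G (q⁻¹ * z⁻¹) = -G z := by
    have e1 (j : Fin 6) : Gam p q (q * t j * (q⁻¹ * z⁻¹)) * Gam p q (t j * (q⁻¹ * z⁻¹)⁻¹) =
        Gam p q (q * t j * z) * Gam p q (t j * z⁻¹) := by
      rw [mul_comm (Gam p q (q * t j * z))]
      congr 2 <;> field_simp
    have e2 : theta q ((q⁻¹ * z⁻¹) ^ 2)⁻¹ = -(q * z ^ 2)⁻¹ * theta q (z ^ 2)⁻¹ := by
      rw [show ((q⁻¹ * z⁻¹) ^ 2)⁻¹ = q * (q * z ^ 2) by field_simp,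
        theta_mul hq0 hq (mul_ne_zero hq0 (pow_ne_zero 2 hz)),
        theta_mul hq0 hq (pow_ne_zero 2 hz), theta_inv hq0 hq (pow_ne_zero 2 hz)]
    simp only [hG, e1, e2]
    generalize (∏ j, Gam p q (q * t j * z) * Gam p q (t j * z⁻¹)) = A
    field_simp
  have hd (z : ℂ) (h1 : 1 ≤ ‖z‖) (h2 : ‖z‖ ≤ ‖q‖⁻¹) : DifferentiableAt ℂ G z := by
    have hz : z ≠ 0 := norm_pos_iff.1 (one_pos.trans_le h1)
    refine DifferentiableAt.mul (differentiableAt_prod _ fun j _ => DifferentiableAt.mul ?_ ?_)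
      (DifferentiableAt.mul ?_ (differentiableAt_inv hz))
    · refine (Gam_differentiableAt hp hq (mul_ne_zero (mul_ne_zero hq0 (ht j).1) hz)
        (E_ne_zero hp hq ?_)).comp z (by fun_prop)
      rw [show q * t j * z = q * z * t j by ring]
      refine norm_mul_lt_one ?_ (ht j).2
      rw [norm_mul]
      calc ‖q‖ * ‖z‖ ≤ ‖q‖ * ‖q‖⁻¹ := by gcongr
        _ = 1 := mul_inv_cancel₀ hq0'.ne'
    · refine (Gam_differentiableAt hp hq (mul_ne_zero (ht j).1 (inv_ne_zero hz))
        (E_ne_zero hp hq ?_)).comp (f := fun z => t j * z⁻¹) z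
          (by fun_prop (disch := assumption))
      rw [mul_comm]
      refine norm_mul_lt_one ?_ (ht j).2
      rw [norm_inv]
      exact inv_le_one_of_one_le₀ h1
    · exact (theta_differentiableAt hq (inv_ne_zero (pow_ne_zero 2 hz))).comp
        (f := fun z => (z ^ 2)⁻¹) z ((differentiableAt_id.pow 2).inv (pow_ne_zero 2 hz))
  have hshift : (∮ z in C(0, ‖q‖⁻¹), z⁻¹ * G z) = ∮ z in C(0, 1), z⁻¹ * G z := by
    have := Complex.circleIntegral_sub_center_inv_smul_eq_of_differentiable_on_annulus_off_countable
      (c := 0) (r := 1) (R := ‖q‖⁻¹) one_pos ((one_le_inv₀ hq0').2 hq.le) (f := G)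
      countable_empty (fun z hz => by
        refine (hd z ?_ ?_).continuousAt.continuousWithinAt
        · simpa using hz.2
        · simpa using hz.1) (fun z hz => by
        refine hd z ?_ ?_
        · simpa using (not_le.1 fun h => hz.1.2 (by simpa using h)).le
        · simpa using (mem_ball_zero_iff.1 hz.1.1).le)
    simpa using this
  rw [← norm_inv, circleIntegral_inversion G (inv_ne_zero hq0)] at hshift
  have hneg : (∮ z in C(0, 1), z⁻¹ * G (q⁻¹ * z⁻¹)) = -∮ z in C(0, 1), z⁻¹ * G z := by
    have : (∮ z in C(0, 1), z⁻¹ * G (q⁻¹ * z⁻¹)) = ∮ z in C(0, 1), (-1 : ℂ) * (z⁻¹ * G z) := by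
      refine circleIntegral.integral_congr zero_le_one fun z hz => ?_
      have hz0 : z ≠ 0 := norm_ne_zero_iff.1 (by
        rw [mem_sphere_zero_iff_norm.1 hz]
        exact one_ne_zero)
      simp only [hodd z hz0]
      ring
    rw [this, circleIntegral.integral_const_mul, neg_one_mul]
  rw [hneg] at hshift
  exact self_eq_neg.1 hshift.symm

/-- By `theta_identity` with p in place of q, the difference of the two integrands is a θ(b/a;p)
(G(z) + G(1/z)), where G is the function in `circleIntegral_telescoping`. -/
theorem hypI_difference (hp : ‖p‖ < 1) (hq : ‖q‖ < 1) (hp0 : p ≠ 0) (hq0 : q ≠ 0)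
    {a b : ℂ} {c : Fin 4 → ℂ} (ht : Small (vec a b c)) (hprod : a * b * ∏ j, c j = p)
    (ha2 : ∀ k : ℤ, a ^ 2 ≠ p ^ k) (hb2 : ∀ k : ℤ, b ^ 2 ≠ p ^ k) (hab : ∀ k : ℤ, a * b ≠ p ^ k)
    (hba : ∀ k : ℤ, b ≠ p ^ k * a) :
    hypI p q (vec a (q * b) c) * ∏ j, theta p (c j * a) =
      hypI p q (vec (q * a) b c) * ∏ j, theta p (c j * b) := by
  obtain ⟨⟨ha0, ha1⟩, ⟨hb0, hb1⟩, hc⟩ := (forall_vec (P := fun x => x ≠ 0 ∧ ‖x‖ < 1)).1 ht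
  have hta : Small (vec (q * a) b c) := (forall_vec (P := fun x => x ≠ 0 ∧ ‖x‖ < 1)).2
    ⟨⟨mul_ne_zero hq0 ha0, norm_mul_lt_one hq.le ha1⟩, ⟨hb0, hb1⟩, hc⟩
  have htb : Small (vec a (q * b) c) := (forall_vec (P := fun x => x ≠ 0 ∧ ‖x‖ < 1)).2
    ⟨⟨ha0, ha1⟩, ⟨mul_ne_zero hq0 hb0, norm_mul_lt_one hq.le hb1⟩, hc⟩
  set G : ℂ → ℂ := fun z => (∏ j, Gam p q (q * vec a b c j * z) * Gam p q (vec a b c j * z⁻¹)) *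
      (theta q (z ^ 2)⁻¹ * z⁻¹) with hG
  have hG0 : (∮ z in C(0, 1), z⁻¹ * G z) = 0 := circleIntegral_telescoping hp hq hq0 ht
  have hG1 : (∮ z in C(0, 1), z⁻¹ * G z⁻¹) = 0 := by
    have := circleIntegral_inversion G one_ne_zero
    rw [norm_one, hG0] at this
    simpa using this.symm
  have hnorm {z : ℂ} (hz : z ∈ Metric.sphere (0 : ℂ) 1) : ‖z‖ = 1 := by simpa using hz
  have hshift {x z : ℂ} (hx : ‖x‖ < 1) (hz : ‖z‖ = 1) :
      Gam p q (q * x * z) = theta p (x * z) * Gam p q (x * z) := by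
    rw [mul_assoc, Gam_shift hp hq hq0 (E_ne_zero hp hq _)]
    rw [norm_mul, hz, mul_one]
    exact hx
  have key (z : ℂ) (hz : ‖z‖ = 1) :
      hypF p q (vec a (q * b) c) z * ∏ j, theta p (c j * a) -
        hypF p q (vec (q * a) b c) z * ∏ j, theta p (c j * b) =
      a * theta p (b / a) * (G z + G z⁻¹) := by
    have hz0 : z ≠ 0 := norm_ne_zero_iff.1 (by rw [hz]; exact one_ne_zero)
    have hzi : ‖z⁻¹‖ = 1 := by rw [norm_inv, hz, inv_one]
    have hid := theta_identity hp0 hp hprod ha2 hb2 hab hba hz0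
    have e1 : theta q ((z⁻¹) ^ 2)⁻¹ = -z ^ 2 * theta q (z ^ 2)⁻¹ := by
      rw [inv_pow, inv_inv, theta_inv hq0 hq (pow_ne_zero 2 hz0)]
      field_simp
    simp only [hG, hypF, Finset.prod_mul_distrib, inv_inv,
      prod_vec _ _ _ fun x => Gam p q (x * z), prod_vec _ _ _ fun x => Gam p q (x * z⁻¹),
      prod_vec _ _ _ fun x => Gam p q (q * x * z), prod_vec _ _ _ fun x => Gam p q (q * x * z⁻¹),
      hshift ha1 hz, hshift ha1 hzi, hshift hb1 hz, hshift hb1 hzi,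
      fun j => hshift (hc j).2 hz, fun j => hshift (hc j).2 hzi, e1]
    simp only [← div_eq_mul_inv] at hid ⊢
    generalize (∏ j, theta p (c j * a)) = A1 at hid ⊢
    generalize (∏ j, theta p (c j * b)) = A2 at hid ⊢
    generalize (∏ j, theta p (c j * z)) = A3 at hid ⊢
    generalize (∏ j, theta p (c j / z)) = A4 at hid ⊢
    generalize (∏ j, Gam p q (c j * z)) = A5
    generalize (∏ j, Gam p q (c j / z)) = A6
    have hz1 : z * z⁻¹ = 1 := mul_inv_cancel₀ hz0
    linear_combination (-(Gam p q (a * z) * Gam p q (a / z) * Gam p q (b * z) * Gam p q (b / z) *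
      A5 * A6 * theta q (z ^ 2)⁻¹)) * hid
  have hc1 : ContinuousOn G (Metric.sphere 0 1) := fun z hz => by
    have hz0 : z ≠ 0 := norm_ne_zero_iff.1 (by rw [hnorm hz]; exact one_ne_zero)
    refine ContinuousAt.continuousWithinAt (DifferentiableAt.continuousAt (𝕜 := ℂ) ?_)
    refine DifferentiableAt.mul (differentiableAt_prod _ fun j _ => DifferentiableAt.mul ?_ ?_)
      (DifferentiableAt.mul ?_ (differentiableAt_inv hz0))
    · refine (Gam_differentiableAt hp hq (mul_ne_zero (mul_ne_zero hq0 (ht j).1) hz0)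
        (E_ne_zero hp hq ?_)).comp z (by fun_prop)
      rw [norm_mul, hnorm hz, mul_one]
      exact norm_mul_lt_one hq.le (ht j).2
    · refine (Gam_differentiableAt hp hq (mul_ne_zero (ht j).1 (inv_ne_zero hz0))
        (E_ne_zero hp hq ?_)).comp (f := fun z => vec a b c j * z⁻¹) z
          (by fun_prop (disch := assumption))
      rw [norm_mul, norm_inv, hnorm hz, inv_one, mul_one]
      exact (ht j).2
    · exact (theta_differentiableAt hq (inv_ne_zero (pow_ne_zero 2 hz0))).comp
        (f := fun z => (z ^ 2)⁻¹) z ((differentiableAt_id.pow 2).inv (pow_ne_zero 2 hz0))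
  have hinv : ContinuousOn (fun z : ℂ => z⁻¹) (Metric.sphere (0 : ℂ) 1) :=
    continuousOn_inv₀.mono fun z hz => norm_ne_zero_iff.1 (by rw [hnorm hz]; exact one_ne_zero)
  have hc2 : ContinuousOn (fun z => G z⁻¹) (Metric.sphere 0 1) :=
    hc1.comp hinv fun z hz => by simp [hnorm hz]
  have hint {f : ℂ → ℂ} (h : ContinuousOn f (Metric.sphere 0 1)) :
      CircleIntegrable (fun z => z⁻¹ * f z) 0 1 :=
    (hinv.mul h).circleIntegrable zero_le_one
  rw [hta.hypI_eq hp hq hp0 hq0, htb.hypI_eq hp hq hp0 hq0, ← sub_eq_zero, mul_comm, mul_comm _ (∏ j,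
    theta p (c j * b)), ← circleIntegral.integral_const_mul, ← circleIntegral.integral_const_mul,
    ← circleIntegral.integral_sub]
  · calc _ = ∮ z in C(0, 1), (a * theta p (b / a)) * (z⁻¹ * G z + z⁻¹ * G z⁻¹) := by
          refine circleIntegral.integral_congr zero_le_one fun z hz => ?_
          linear_combination z⁻¹ * key z (hnorm hz)
      _ = 0 := by
          rw [circleIntegral.integral_const_mul, circleIntegral.integral_add (hint hc1) (hint hc2),
            hG0, hG1, add_zero, mul_zero]
  · exact (continuousOn_const.mul (hinv.mul (htb.continuousOn hp hq))).circleIntegrable zero_le_one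
  · exact (continuousOn_const.mul (hinv.mul (hta.continuousOn hp hq))).circleIntegrable zero_le_one

end EllipticHyp

end

/-! ### The elliptic beta integral up to a constant factor -/

noncomputable section

namespace EllipticHyp

open Filter Topology Set

variable {p q : ℂ} {J : Type}

/-! ### Products over pairs -/

theorem prod_pairs_eq {M : Type*} [CommMonoid M] {n : ℕ} (h : Fin n → Fin n → M)
    (hh : ∀ i j, h i j = h j i) :
    ∏ j, ∏ k ∈ Finset.Ioi j, h j k =
      ∏ e ∈ (Finset.univ : Finset (Sym2 (Fin n))) with ¬ e.IsDiag, Sym2.lift ⟨h, hh⟩ e := by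
  have h1 := Finset.sum_sym2_filter_not_isDiag (M := Additive M) (Finset.univ : Finset (Fin n))
    fun e => Additive.ofMul (Sym2.lift ⟨h, hh⟩ e)
  have h2 : (∏ e ∈ (Finset.univ : Finset (Fin n)).sym2 with ¬ e.IsDiag, Sym2.lift ⟨h, hh⟩ e) =
      ∏ i ∈ (Finset.univ : Finset (Fin n)).offDiag with i.1 < i.2, h i.1 i.2 := h1
  rw [Finset.sym2_univ] at h2
  rw [h2, Finset.prod_finset_product' _ Finset.univ fun j => Finset.Ioi j]
  rintro ⟨j, k⟩
  simp only [Finset.mem_filter, Finset.mem_offDiag, Finset.mem_univ, true_and, Finset.mem_Ioi]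
  exact ⟨fun h => h.2, fun h => ⟨h.ne, h⟩⟩

theorem prod_pairs_perm {M : Type*} [CommMonoid M] {n : ℕ} (h : Fin n → Fin n → M)
    (hh : ∀ i j, h i j = h j i) (σ : Equiv.Perm (Fin n)) :
    ∏ j, ∏ k ∈ Finset.Ioi j, h (σ j) (σ k) = ∏ j, ∏ k ∈ Finset.Ioi j, h j k := by
  rw [prod_pairs_eq h hh, prod_pairs_eq (fun i j => h (σ i) (σ j)) fun i j => hh _ _]
  refine Finset.prod_nbij' (Sym2.map σ) (Sym2.map σ.symm) ?_ ?_ ?_ ?_ ?_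
  all_goals
    intro e
    induction e with | _ x y => simp

/-- The product `∏_{j<k} Γ(t_j t_k)`. -/
def pairG (p q : ℂ) {n : ℕ} (t : Fin n → ℂ) : ℂ :=
  ∏ j, ∏ k ∈ Finset.Ioi j, Gam p q (t j * t k)

theorem pairG_comp_perm {n : ℕ} (t : Fin n → ℂ) (σ : Equiv.Perm (Fin n)) :
    pairG p q (fun j => t (σ j)) = pairG p q t :=
  prod_pairs_perm (fun j k => Gam p q (t j * t k)) (fun i j => by rw [mul_comm]) σ

theorem pairG_vec (a b : ℂ) (c : Fin 4 → ℂ) :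
    pairG p q (vec a b c) =
      Gam p q (a * b) * (∏ j, Gam p q (c j * a)) * (∏ j, Gam p q (c j * b)) * pairG p q c := by
  rw [pairG, vec, Fin.prod_univ_succ, Fin.prod_univ_succ, Fin.prod_Ioi_zero, Fin.prod_Ioi_succ,
    Fin.prod_Ioi_zero, Fin.prod_univ_succ]
  simp only [Fin.prod_Ioi_succ, Fin.cons_zero, Fin.cons_succ, pairG, fun j => mul_comm (c j) a,
    fun j => mul_comm (c j) b]
  ring

/-! ### The elliptic beta integral -/

theorem Gam_ne_zero (hp : ‖p‖ < 1) (hq : ‖q‖ < 1) {x : ℂ}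
    (h1 : ‖x‖ < 1) (h2 : ‖p * q‖ < ‖x‖) : Gam p q x ≠ 0 := by
  rw [Gam_eq]
  refine div_ne_zero (E_ne_zero hp hq ?_) (E_ne_zero hp hq h1)
  rw [norm_div, div_lt_one ((norm_nonneg _).trans_lt h2)]
  exact h2

theorem norm_prod_le_one {K : Type*} (s : Finset K) {t : K → ℂ} (h : ∀ j ∈ s, ‖t j‖ ≤ 1) :
    ‖∏ j ∈ s, t j‖ ≤ 1 := by
  rw [norm_prod]
  exact Finset.prod_le_one (fun _ _ => norm_nonneg _) h

/-- If the total product is pq, this gives |pq| < |t_j t_k| < 1, a range without zeros and poles of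
Γ. -/
theorem Small.norm_prod_lt {t : Fin 6 → ℂ} (h : Small t) {j k : Fin 6} (hjk : j ≠ k) :
    ‖∏ i, t i‖ < ‖t j * t k‖ := by
  have hne (i) : 0 < ‖t i‖ := norm_pos_iff.2 (h i).1
  have hk : k ∈ Finset.univ.erase j := Finset.mem_erase.2 ⟨hjk.symm, Finset.mem_univ k⟩
  rw [← Finset.mul_prod_erase _ _ (Finset.mem_univ j), ← Finset.mul_prod_erase _ _ hk, ← mul_assoc,
    norm_mul]
  refine mul_lt_of_lt_one_right (by rw [norm_mul]; exact mul_pos (hne j) (hne k)) ?_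
  obtain ⟨l, hl⟩ : ((Finset.univ.erase j).erase k).Nonempty := by
    rw [← Finset.card_pos, Finset.card_erase_of_mem hk, Finset.card_erase_of_mem (Finset.mem_univ _)]
    simp
  rw [← Finset.mul_prod_erase _ _ hl, mul_comm]
  exact norm_mul_lt_one (norm_prod_le_one _ fun i _ => (h i).2.le) (h l).2

theorem Small.pairG_ne_zero (hp : ‖p‖ < 1) (hq : ‖q‖ < 1) {t : Fin 6 → ℂ} (h : Small t) (hprod : ∏ j, t j = p * q) : pairG p q t ≠ 0 :=
  Finset.prod_ne_zero_iff.2 fun j _ => Finset.prod_ne_zero_iff.2 fun k hk =>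
    Gam_ne_zero hp hq (norm_mul_lt_one (h j).2.le (h k).2)
      (hprod ▸ h.norm_prod_lt (Finset.mem_Ioi.1 hk).ne)

/-- The theta factors in `hypI_difference` are exactly those by which ∏ Γ(t_j t_k) changes. The
condition there on ab is automatic, since |p| < |ab| < 1. -/
theorem hypI_mul_pairG_shift_of_generic (hp : ‖p‖ < 1) (hq : ‖q‖ < 1) (hp0 : p ≠ 0) (hq0 : q ≠ 0)
    {a b : ℂ} {c : Fin 4 → ℂ} (ht : Small (vec a b c)) (hprod : a * b * ∏ j, c j = p)
    (ha2 : ∀ k : ℤ, a ^ 2 ≠ p ^ k) (hb2 : ∀ k : ℤ, b ^ 2 ≠ p ^ k)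
    (hba : ∀ k : ℤ, b ≠ p ^ k * a) :
    hypI p q (vec a (q * b) c) * pairG p q (vec (q * a) b c) =
      hypI p q (vec (q * a) b c) * pairG p q (vec a (q * b) c) := by
  obtain ⟨⟨ha0, ha1⟩, ⟨hb0, hb1⟩, hc⟩ := (forall_vec (P := fun x => x ≠ 0 ∧ ‖x‖ < 1)).1 ht
  have hab (k : ℤ) : a * b ≠ p ^ k := by
    intro h
    have h1 : ‖a * b‖ < 1 := norm_mul_lt_one ha1.le hb1
    have h2 : ‖p‖ < ‖a * b‖ := by
      have := ht.norm_prod_lt (j := 0) (k := 1) (by decide)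
      rw [prod_vec a b c fun x => x, hprod] at this
      exact this
    have hp0' : 0 < ‖p‖ := norm_pos_iff.2 hp0
    rw [h, norm_zpow] at h1 h2
    rw [zpow_lt_one_iff_right_of_lt_one₀ hp0' hp] at h1
    have h2' : ‖p‖ ^ (1 : ℤ) < ‖p‖ ^ k := by rwa [zpow_one]
    rw [zpow_lt_zpow_iff_right_of_lt_one₀ hp0' hp] at h2'
    omega
  have key := hypI_difference hp hq hp0 hq0 ht hprod ha2 hb2 hab hba
  have hs {x : ℂ} (hx : ‖x‖ < 1) (j : Fin 4) :
      Gam p q (c j * (q * x)) = theta p (c j * x) * Gam p q (c j * x) := by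
    rw [mul_left_comm, Gam_shift hp hq hq0 (E_ne_zero hp hq (norm_mul_lt_one (hc j).2.le hx))]
  simp only [pairG_vec, hs ha1, hs hb1, Finset.prod_mul_distrib, mul_left_comm a q, mul_assoc q]
  linear_combination (Gam p q (q * (a * b)) * (∏ j, Gam p q (c j * a)) *
    (∏ j, Gam p q (c j * b)) * pairG p q c) * key

theorem isPreconnected_annulus {r R : ℝ} (hr : 0 < r) (hR : 0 < R) :
    IsPreconnected (annulus r R) := by
  have h : annulus r R = Complex.exp '' (Complex.re ⁻¹' Ioo (Real.log r) (Real.log R)) := by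
    ext z
    constructor
    · intro hz
      refine ⟨Complex.log z, ?_, Complex.exp_log (ne_zero_of_mem_annulus hr hz)⟩
      have h0 : 0 < ‖z‖ := hr.trans hz.1
      rw [mem_preimage, Complex.log_re]
      exact ⟨Real.log_lt_log hr hz.1, Real.log_lt_log h0 hz.2⟩
    · rintro ⟨u, hu, rfl⟩
      rw [annulus, mem_ofPred_eq, Complex.norm_exp]
      exact ⟨(Real.log_lt_iff_lt_exp hr).1 hu.1, (Real.lt_log_iff_exp_lt hR).1 hu.2⟩
  rw [h]
  exact (((convex_Ioo _ _).linear_preimage Complex.reLm).isPreconnected).image _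
    Complex.continuous_exp.continuousOn

theorem Small.differentiableAt_hypI_vec (hp : ‖p‖ < 1) (hq : ‖q‖ < 1) (hp0 : p ≠ 0) (hq0 : q ≠ 0)
    {P x : ℂ} {c : Fin 4 → ℂ} (h : Small (vec x (P / x) c)) :
    DifferentiableAt ℂ (fun x => hypI p q (vec x (P / x) c)) x := by
  have hx : x ≠ 0 := (h 0).1
  refine hypI_differentiableAt hp hq hp0 hq0 ?_ (h.admissible hp hq hp0 hq0)
  filter_upwards [isOpen_compl_singleton.mem_nhds (show x ∈ ({0}ᶜ : Set ℂ) from hx)] with y hy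
  have hy : y ≠ 0 := hy
  refine differentiableAt_pi.2 fun j => ?_
  refine Fin.cases ?_ (fun j => Fin.cases ?_ (fun j => ?_) j) j
  · simp [vec]
  · simp only [vec, Fin.cons_succ, Fin.cons_zero]
    fun_prop (disch := assumption)
  · simp [vec]

theorem Small.differentiableAt_pairG_vec (hp : ‖p‖ < 1) (hq : ‖q‖ < 1)
    {P x : ℂ} {c : Fin 4 → ℂ} (h : Small (vec x (P / x) c)) :
    DifferentiableAt ℂ (fun x => pairG p q (vec x (P / x) c)) x := by
  obtain ⟨⟨ha0, ha1⟩, ⟨hb0, hb1⟩, hc⟩ := (forall_vec (P := fun x => x ≠ 0 ∧ ‖x‖ < 1)).1 h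
  have hP (y : ℂ) (hy : y ≠ 0) : y * (P / y) = P := mul_div_cancel₀ P hy
  have hΓ {f : ℂ → ℂ} (hf : DifferentiableAt ℂ f x) (h0 : f x ≠ 0) (h1 : ‖f x‖ < 1) :
      DifferentiableAt ℂ (fun y => Gam p q (f y)) x :=
    (Gam_differentiableAt hp hq h0 (E_ne_zero hp hq h1)).comp x hf
  have hdiv : DifferentiableAt ℂ (fun y => P / y) x := (differentiableAt_const P).div
    differentiableAt_id ha0
  simp only [pairG_vec]
  refine DifferentiableAt.mul (DifferentiableAt.mul (DifferentiableAt.mul ?_ ?_) ?_)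
    (differentiableAt_const _)
  · exact hΓ (differentiableAt_id.mul hdiv) (mul_ne_zero ha0 hb0) (norm_mul_lt_one ha1.le hb1)
  · exact differentiableAt_prod _ fun j _ => hΓ (differentiableAt_id.const_mul _)
      (mul_ne_zero (hc j).1 ha0) (norm_mul_lt_one (hc j).2.le ha1)
  · exact differentiableAt_prod _ fun j _ => hΓ (hdiv.const_mul _)
      (mul_ne_zero (hc j).1 hb0) (norm_mul_lt_one (hc j).2.le hb1)

/-- The quotient of the elliptic beta integral and its evaluation. -/
def betaF (p q : ℂ) (t : Fin 6 → ℂ) : ℂ := hypI p q t / pairG p q t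

theorem betaF_comp_perm (hp : ‖p‖ < 1) (hq : ‖q‖ < 1) (t : Fin 6 → ℂ) (σ : Equiv.Perm (Fin 6)) :
    betaF p q (fun j => t (σ j)) = betaF p q t := by
  rw [betaF, betaF, hypI_comp_equiv hp hq, pairG_comp_perm]

theorem small_vec_of_mem_annulus {P x : ℂ} {c : Fin 4 → ℂ} (hP : P ≠ 0) (hc : Small c)
    (hx : x ∈ annulus ‖P‖ 1) : Small (vec x (P / x) c) := by
  have h0 : 0 < ‖x‖ := (norm_nonneg P).trans_lt hx.1
  refine (forall_vec (P := fun x => x ≠ 0 ∧ ‖x‖ < 1)).2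
    ⟨⟨norm_pos_iff.1 h0, hx.2⟩, ⟨div_ne_zero hP (norm_pos_iff.1 h0), ?_⟩, hc⟩
  rw [norm_div, div_lt_one h0]
  exact hx.1

theorem prod_vec_div {P x : ℂ} (hx : x ≠ 0) (c : Fin 4 → ℂ) :
    ∏ j, vec x (P / x) c j = P * ∏ j, c j := by
  rw [prod_vec x (P / x) c fun x => x, mul_div_cancel₀ P hx]

theorem differentiableAt_betaF (hp : ‖p‖ < 1) (hq : ‖q‖ < 1) (hp0 : p ≠ 0) (hq0 : q ≠ 0)
    {P x : ℂ} {c : Fin 4 → ℂ} (hP : P ≠ 0) (hc : Small c) (hprod : P * ∏ j, c j = p * q)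
    (hx : x ∈ annulus ‖P‖ 1) : DifferentiableAt ℂ (fun x => betaF p q (vec x (P / x) c)) x := by
  have h := small_vec_of_mem_annulus hP hc hx
  exact (h.differentiableAt_hypI_vec hp hq hp0 hq0).div (h.differentiableAt_pairG_vec hp hq)
    (h.pairG_ne_zero hp hq (by rw [prod_vec_div (x := x) (h 0).1, hprod]))

theorem countable_setOf_sq_eq (f : ℤ → ℂ) : {x : ℂ | ∃ k, x ^ 2 = f k}.Countable := by
  rw [show {x : ℂ | ∃ k, x ^ 2 = f k} = ⋃ k : ℤ, {x | x ^ 2 = f k} by ext; simp]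
  refine countable_iUnion fun k => Set.Finite.countable ?_
  refine ((Polynomial.nthRoots 2 (f k)).toFinset.finite_toSet).subset fun x hx => ?_
  simpa [Polynomial.mem_nthRoots two_pos] using hx

/-- This is `hypI_mul_pairG_shift_of_generic` with a = x and b = P/(qx). The conditions assumed
there exclude only countably many x, which are recovered by continuity. -/
theorem betaF_shift (hp : ‖p‖ < 1) (hq : ‖q‖ < 1) (hp0 : p ≠ 0) (hq0 : q ≠ 0)
    {P x : ℂ} {c : Fin 4 → ℂ} (hP : P ≠ 0) (hc : Small c) (hprod : P * ∏ j, c j = p * q)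
    (hx : x ∈ annulus ‖P‖ 1) (hqx : q * x ∈ annulus ‖P‖ 1) :
    betaF p q (vec (q * x) (P / (q * x)) c) = betaF p q (vec x (P / x) c) := by
  set U : Set ℂ := annulus ‖P‖ 1 ∩ (fun x => q * x) ⁻¹' annulus ‖P‖ 1 with hU
  have hUo : IsOpen U := (isOpen_annulus _ _).inter
    ((isOpen_annulus _ _).preimage (continuous_const.mul continuous_id))
  set D : Set ℂ := {x | ∃ k : ℤ, x ^ 2 = p ^ k} ∪ {x | ∃ k : ℤ, x ^ 2 = (P / q) ^ 2 / p ^ k} ∪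
    {x | ∃ k : ℤ, x ^ 2 = P / q / p ^ k} with hD
  have hDc : D.Countable := ((countable_setOf_sq_eq _).union (countable_setOf_sq_eq _)).union
    (countable_setOf_sq_eq _)
  have heq : EqOn (fun x => betaF p q (vec (q * x) (P / (q * x)) c))
      (fun x => betaF p q (vec x (P / x) c)) (U ∩ Dᶜ) := by
    rintro y ⟨⟨hy, hqy⟩, hyD⟩
    have hy0 : y ≠ 0 := ne_zero_of_mem_annulus (norm_pos_iff.2 hP) hy
    have h1 := small_vec_of_mem_annulus hP hc hy
    have h2 := small_vec_of_mem_annulus hP hc hqy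
    obtain ⟨⟨ha0, ha1⟩, -, -⟩ := (forall_vec (P := fun x => x ≠ 0 ∧ ‖x‖ < 1)).1 h1
    obtain ⟨-, ⟨hb0, hb1⟩, -⟩ := (forall_vec (P := fun x => x ≠ 0 ∧ ‖x‖ < 1)).1 h2
    have h3 : Small (vec y (P / (q * y)) c) := (forall_vec (P := fun x => x ≠ 0 ∧ ‖x‖ < 1)).2
      ⟨⟨ha0, ha1⟩, ⟨hb0, hb1⟩, hc⟩
    have hpk (k : ℤ) : p ^ k ≠ 0 := zpow_ne_zero k hp0
    have key := hypI_mul_pairG_shift_of_generic hp hq hp0 hq0 h3 ?_ ?_ ?_ ?_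
    · rw [show q * (P / (q * y)) = P / y by field_simp] at key
      have e1 : pairG p q (vec (q * y) (P / (q * y)) c) ≠ 0 :=
        h2.pairG_ne_zero hp hq (by rw [prod_vec_div (x := q * y) (mul_ne_zero hq0 hy0), hprod])
      have e2 : pairG p q (vec y (P / y) c) ≠ 0 :=
        h1.pairG_ne_zero hp hq (by rw [prod_vec_div (x := y) hy0, hprod])
      simp only [betaF]
      rw [div_eq_div_iff e1 e2, key]
    · rw [show y * (P / (q * y)) = P / q by field_simp, div_mul_eq_mul_div, hprod,
        mul_div_cancel_right₀ p hq0]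
    · exact fun k hk => hyD (Or.inl (Or.inl ⟨k, hk⟩))
    · refine fun k hk => hyD (Or.inl (Or.inr ⟨k, ?_⟩))
      rw [← hk]
      field_simp
    · refine fun k hk => hyD (Or.inr ⟨k, ?_⟩)
      have := hpk k
      rw [eq_div_iff this]
      have h : P / (q * y) * y = P / q := by field_simp
      rw [← h, hk]
      ring
  have hφ (y : ℂ) (hy : y ∈ annulus ‖P‖ 1) :
      ContinuousAt (fun x => betaF p q (vec x (P / x) c)) y :=
    (differentiableAt_betaF hp hq hp0 hq0 hP hc hprod hy).continuousAt
  refine heq.of_subset_closure (t := U) (fun y hy => ?_) (fun y hy => ?_) inter_subset_left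
    ((hDc.dense_compl ℝ).open_subset_closure_inter hUo) ⟨hx, hqx⟩
  · exact (ContinuousAt.comp (f := fun y => q * y) (hφ _ hy.2)
      (by fun_prop)).continuousWithinAt
  · exact (hφ y hy.1).continuousWithinAt

/-- If |P| < |q|, the annulus |P| < |z| < 1 contains a closed fundamental annulus for multiplication
by q. By periodicity the maximum of |φ| over the latter is a local maximum in the former, so φ is
constant. -/
theorem betaF_vec_eq (hp : ‖p‖ < 1) (hq : ‖q‖ < 1) (hp0 : p ≠ 0) (hq0 : q ≠ 0)
    {P x y : ℂ} {c : Fin 4 → ℂ} (hP : P ≠ 0) (hc : Small c) (hprod : P * ∏ j, c j = p * q)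
    (hPq : ‖P‖ < ‖q‖) (hx : x ∈ annulus ‖P‖ 1) (hy : y ∈ annulus ‖P‖ 1) :
    betaF p q (vec x (P / x) c) = betaF p q (vec y (P / y) c) := by
  set φ : ℂ → ℂ := fun x => betaF p q (vec x (P / x) c) with hφ
  have hd (z : ℂ) (hz : z ∈ annulus ‖P‖ 1) : DifferentiableAt ℂ φ z :=
    differentiableAt_betaF hp hq hp0 hq0 hP hc hprod hz
  have hP0 : 0 < ‖P‖ := norm_pos_iff.2 hP
  have hq0' : 0 < ‖q‖ := norm_pos_iff.2 hq0
  -- R |q| > |P| keeps the fundamental annulus inside the domain; R > |q| ensures that q z belongs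
  -- to it whenever R < |z| < 1.
  obtain ⟨R, hR, hR1⟩ := exists_between (max_lt hq ((div_lt_one hq0').2 hPq))
  obtain ⟨hqR, hPR⟩ := max_lt_iff.1 hR
  rw [div_lt_iff₀ hq0'] at hPR
  have hR0 : 0 < R := hq0'.trans hqR
  set K : Set ℂ := {z | R * ‖q‖ ≤ ‖z‖ ∧ ‖z‖ ≤ R} with hK
  have hKA : K ⊆ annulus ‖P‖ 1 := fun z hz => ⟨hPR.trans_le hz.1, hz.2.trans_lt hR1⟩
  have hKc : IsCompact K := by
    refine (isCompact_closedBall (0 : ℂ) R).of_isClosed_subset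
      ((isClosed_le continuous_const continuous_norm).inter
        (isClosed_le continuous_norm continuous_const)) fun z hz => ?_
    simpa using hz.2
  have hRK : (R : ℂ) ∈ K := by
    simp only [hK, mem_ofPred_eq, Complex.norm_real, Real.norm_of_nonneg hR0.le]
    exact ⟨mul_le_of_le_one_right hR0.le hq.le, le_rfl⟩
  obtain ⟨z₀, hz₀, hmax⟩ := hKc.exists_isMaxOn ⟨_, hRK⟩ (f := fun z => ‖φ z‖)
    fun z hz => (hd z (hKA hz)).continuousAt.norm.continuousWithinAt
  have hloc : IsLocalMax (norm ∘ φ) z₀ := by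
    have hV : annulus (max ‖P‖ (R * ‖q‖ * ‖q‖)) 1 ∈ 𝓝 z₀ := by
      refine (isOpen_annulus _ _).mem_nhds ⟨max_lt (hKA hz₀).1 ?_, (hKA hz₀).2⟩
      exact (mul_lt_of_lt_one_right (by positivity) hq).trans_le hz₀.1
    filter_upwards [hV] with z hz
    obtain ⟨h1, h2⟩ := max_lt_iff.1 hz.1
    have hzA : z ∈ annulus ‖P‖ 1 := ⟨h1, hz.2⟩
    rcases le_or_gt ‖z‖ R with h3 | h3
    · rcases le_or_gt (R * ‖q‖) ‖z‖ with h4 | h4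
      · exact hmax ⟨h4, h3⟩
      · have h5 : z / q ∈ K := by
          simp only [hK, mem_ofPred_eq, norm_div, le_div_iff₀ hq0', div_le_iff₀ hq0']
          exact ⟨h2.le, h4.le⟩
        have h6 : φ z = φ (z / q) := by
          have := betaF_shift hp hq hp0 hq0 hP hc hprod (hKA h5)
            (by rwa [mul_div_cancel₀ z hq0])
          rwa [mul_div_cancel₀ z hq0] at this
        simp only [Function.comp_apply, h6]
        exact hmax h5
    · have h5 : q * z ∈ K := by
        simp only [hK, mem_ofPred_eq, norm_mul, mul_comm ‖q‖]
        exact ⟨by gcongr, (mul_le_of_le_one_left hq0'.le hz.2.le).trans hqR.le⟩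
      have h6 : φ z = φ (q * z) := (betaF_shift hp hq hp0 hq0 hP hc hprod hzA (hKA h5)).symm
      simp only [Function.comp_apply, h6]
      exact hmax h5
  have hconst := Complex.eventually_eq_of_isLocalMax_norm
    (eventually_of_mem ((isOpen_annulus _ _).mem_nhds (hKA hz₀)) hd) hloc
  have hA : AnalyticOnNhd ℂ φ (annulus ‖P‖ 1) :=
    DifferentiableOn.analyticOnNhd (fun z hz => (hd z hz).differentiableWithinAt)
      (isOpen_annulus _ _)
  have := hA.eqOn_of_preconnected_of_eventuallyEq (g := fun _ => φ z₀) analyticOnNhd_const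
    (isPreconnected_annulus hP0 one_pos) (hKA hz₀) hconst
  exact (this hx).trans (this hy).symm

theorem exists_perm_comp_eq_vec {i j : Fin 6} (hij : i ≠ j) :
    ∃ σ : Equiv.Perm (Fin 6), σ 0 = i ∧ σ 1 = j := by
  refine ⟨(Equiv.swap 1 (Equiv.swap 0 i j)).trans (Equiv.swap 0 i), ?_, by simp⟩
  have : (0 : Fin 6) ≠ Equiv.swap 0 i j := by
    intro h
    have h2 := congrArg (Equiv.swap 0 i) h
    rw [Equiv.swap_apply_left, Equiv.swap_apply_self] at h2
    exact hij h2
  rw [Equiv.trans_apply, Equiv.swap_apply_of_ne_of_ne (by decide) this, Equiv.swap_apply_left]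

/-- By symmetry, any two parameters can take the places of x and P/x in `betaF_vec_eq`. -/
theorem betaF_update (hp : ‖p‖ < 1) (hq : ‖q‖ < 1) (hp0 : p ≠ 0) (hq0 : q ≠ 0)
    {t : Fin 6 → ℂ} (ht : Small t) (hprod : ∏ j, t j = p * q) {i j : Fin 6} (hij : i ≠ j)
    (hlt : ‖t i * t j‖ < ‖q‖) {x y : ℂ} (hx : ‖x‖ < 1) (hy : ‖y‖ < 1)
    (hxy : x * y = t i * t j) :
    betaF p q (Function.update (Function.update t i x) j y) = betaF p q t := by
  obtain ⟨σ, h0, h1⟩ := exists_perm_comp_eq_vec hij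
  set c : Fin 4 → ℂ := fun l => t (σ l.succ.succ) with hc
  have hP : t i * t j ≠ 0 := mul_ne_zero (ht i).1 (ht j).1
  have hx0 : x ≠ 0 := by
    rintro rfl
    exact hP (by rw [← hxy, zero_mul])
  have e1 : (fun l => t (σ l)) = vec (t i) (t i * t j / t i) c := by
    rw [mul_div_cancel_left₀ _ (ht i).1]
    funext l
    refine Fin.cases ?_ (fun l => Fin.cases ?_ (fun l => ?_) l) l
    · simp [vec, h0]
    · simpa [vec] using congrArg t h1
    · simp [vec, hc]
  have e2 : (fun l => Function.update (Function.update t i x) j y (σ l)) =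
      vec x (t i * t j / x) c := by
    rw [← hxy, mul_div_cancel_left₀ _ hx0]
    funext l
    refine Fin.cases ?_ (fun l => Fin.cases ?_ (fun l => ?_) l) l
    · simp [vec, h0, hij]
    · simp [vec, h1]
    · have h2 : σ l.succ.succ ≠ j := by
        rw [← h1]
        exact σ.injective.ne fun h => Fin.succ_ne_zero l (Fin.succ_injective _ h)
      have h3 : σ l.succ.succ ≠ i := by
        rw [← h0]
        exact σ.injective.ne (Fin.succ_ne_zero _)
      simp [vec, h2, h3, hc]
  have hprodc : t i * t j * ∏ l, c l = p * q := by
    have h := Equiv.prod_comp σ t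
    rw [Fin.prod_univ_succ, Fin.prod_univ_succ, h0, show σ (Fin.succ 0) = j from h1] at h
    rw [← hprod, ← h, mul_assoc]
  rw [← betaF_comp_perm hp hq _ σ, e2, ← betaF_comp_perm hp hq t σ, e1]
  refine betaF_vec_eq hp hq hp0 hq0 hP (fun l => ht _) hprodc hlt ⟨?_, hx⟩ ⟨?_, (ht i).2⟩
  · rw [← hxy, norm_mul]
    exact mul_lt_of_lt_one_right (norm_pos_iff.2 hx0) hy
  · rw [norm_mul]
    exact mul_lt_of_lt_one_right (norm_pos_iff.2 (ht i).1) (ht j).2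

/-- Replace the parameters in `S` by `r`, changing the last one such that the product persists. -/
def replaceBy (t : Fin 6 → ℂ) (r : ℂ) (S : Finset (Fin 6)) (j : Fin 6) : ℂ :=
  if j = 5 then t 5 * ∏ i ∈ S, (t i / r) else if j ∈ S then r else t j

/-- Each step changes one parameter and compensates in the last one. Since |t_j| ≤ |r|, the last
parameter never grows and stays below |q| in modulus, so `betaF_update` remains applicable. -/
theorem betaF_replaceBy (hp : ‖p‖ < 1) (hq : ‖q‖ < 1) (hp0 : p ≠ 0) (hq0 : q ≠ 0)
    {t : Fin 6 → ℂ} (ht : Small t) (hprod : ∏ j, t j = p * q) (hlt : ‖t 5‖ < ‖q‖) {r : ℂ}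
    (hr0 : r ≠ 0) (hr1 : ‖r‖ < 1) (hr : ∀ j, j ≠ 5 → ‖t j‖ ≤ ‖r‖) (S : Finset (Fin 6))
    (hS : 5 ∉ S) :
    (Small (replaceBy t r S) ∧ ∏ j, replaceBy t r S j = p * q) ∧
      betaF p q (replaceBy t r S) = betaF p q t := by
  have h5 (S : Finset (Fin 6)) (hS : 5 ∉ S) : ‖replaceBy t r S 5‖ ≤ ‖t 5‖ := by
    rw [replaceBy, if_pos rfl, norm_mul]
    refine mul_le_of_le_one_right (norm_nonneg _) (norm_prod_le_one _ fun j hj => ?_)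
    rw [norm_div, div_le_one (norm_pos_iff.2 hr0)]
    exact hr j fun h => hS (h ▸ hj)
  induction S using Finset.induction_on with
  | empty =>
    have : replaceBy t r ∅ = t := by
      funext j
      by_cases hj : j = 5
      · simp [replaceBy, hj]
      · simp [replaceBy, hj]
    rw [this]
    exact ⟨⟨ht, hprod⟩, rfl⟩
  | insert i S hi ih =>
    have hi5 : i ≠ 5 := fun h => hS (h ▸ Finset.mem_insert_self i S)
    have hS5 : 5 ∉ S := fun h => hS (Finset.mem_insert_of_mem h)
    obtain ⟨⟨ih1, ih2⟩, ih3⟩ := ih hS5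
    have e : replaceBy t r (insert i S) = Function.update (Function.update (replaceBy t r S) i r) 5
        (t 5 * ∏ i ∈ insert i S, (t i / r)) := by
      funext j
      by_cases hj : j = 5
      · simp [replaceBy, hj]
      · by_cases hji : j = i
        · simp [replaceBy, hji, hi5]
        · simp [replaceBy, hj, hji]
    have hti : replaceBy t r S i = t i := by simp [replaceBy, hi5, hi]
    have hsmall : Small (replaceBy t r (insert i S)) := fun j => by
      by_cases hj : j = 5
      · refine ⟨?_, ?_⟩
        · rw [replaceBy, if_pos hj]
          exact mul_ne_zero (ht 5).1 (Finset.prod_ne_zero_iff.2 fun i _ => div_ne_zero (ht i).1 hr0)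
        · rw [hj]
          exact (h5 _ hS).trans_lt (ht 5).2
      · by_cases hjS : j ∈ insert i S
        · rw [replaceBy, if_neg hj, if_pos hjS]
          exact ⟨hr0, hr1⟩
        · rw [replaceBy, if_neg hj, if_neg hjS]
          exact ht j
    have hxy : r * (t 5 * ∏ i ∈ insert i S, (t i / r)) =
        replaceBy t r S i * replaceBy t r S 5 := by
      rw [hti, replaceBy, if_pos rfl, Finset.prod_insert hi]
      field_simp
    have hb : betaF p q (replaceBy t r (insert i S)) = betaF p q (replaceBy t r S) := by
      rw [e]
      refine betaF_update hp hq hp0 hq0 ih1 ih2 hi5 ?_ hr1 ?_ hxy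
      · rw [norm_mul]
        exact (mul_le_of_le_one_left (norm_nonneg _) (ih1 i).2.le).trans_lt ((h5 S hS5).trans_lt hlt)
      · have := (h5 _ hS).trans_lt (ht 5).2
        rwa [replaceBy, if_pos rfl] at this
    refine ⟨⟨hsmall, ?_⟩, hb.trans ih3⟩
    have h6 : (5 : Fin 6) ∈ Finset.univ.erase i := Finset.mem_erase.2 ⟨hi5.symm, Finset.mem_univ _⟩
    rw [← ih2, ← Finset.mul_prod_erase _ _ (Finset.mem_univ i), ← Finset.mul_prod_erase _ _ h6,
      ← Finset.mul_prod_erase _ (replaceBy t r S) (Finset.mem_univ i),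
      ← Finset.mul_prod_erase _ (replaceBy t r S) h6, ← mul_assoc, ← mul_assoc, ← hxy]
    congr 1
    · simp [replaceBy, hi5]
    · refine Finset.prod_congr rfl fun j hj => ?_
      obtain ⟨hj5, hj⟩ := Finset.mem_erase.1 hj
      obtain ⟨hji, -⟩ := Finset.mem_erase.1 hj
      simp [replaceBy, hj5, hji]

/-- The quotient `betaF` takes the same value at all parameters two of which have a product
smaller than `q`. -/
theorem betaF_eq_betaF (hp : ‖p‖ < 1) (hq : ‖q‖ < 1) (hp0 : p ≠ 0) (hq0 : q ≠ 0)
    {t t' : Fin 6 → ℂ} (ht : Small t) (hprod : ∏ j, t j = p * q) (hlt : ∃ i j, i ≠ j ∧ ‖t i * t j‖ < ‖q‖)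
    (ht' : Small t') (hprod' : ∏ j, t' j = p * q)
    (hlt' : ∃ i j, i ≠ j ∧ ‖t' i * t' j‖ < ‖q‖) : betaF p q t = betaF p q t' := by
  -- Every vector is connected to the normal form (r, r, r, r, r, pq/r⁵), for all real r < 1 close
  -- to 1, so that a common r serves two given vectors.
  have key (t : Fin 6 → ℂ) (ht : Small t) (hprod : ∏ j, t j = p * q)
      (hlt : ∃ i j, i ≠ j ∧ ‖t i * t j‖ < ‖q‖) : ∀ᶠ r : ℝ in 𝓝[<] 1,
      betaF p q t = betaF p q fun j => if j = 5 then p * q / (r : ℂ) ^ 5 else r := by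
    obtain ⟨i, j, hij, hlt⟩ := hlt
    obtain ⟨σ, h0, h1⟩ := exists_perm_comp_eq_vec hij
    set τ : Equiv.Perm (Fin 6) := (Equiv.swap 1 5).trans σ with hτ
    have h5 : τ 5 = j := by rw [hτ, Equiv.trans_apply, Equiv.swap_apply_right, h1]
    have h0' : τ 0 = i := by
      rw [hτ, Equiv.trans_apply, Equiv.swap_apply_of_ne_of_ne (by decide) (by decide), h0]
    have hq0' : 0 < ‖q‖ := norm_pos_iff.2 hq0
    filter_upwards [Ioo_mem_nhdsLT (zero_lt_one' ℝ), Ioo_mem_nhdsLT ((div_lt_one hq0').2 hlt),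
      eventually_all.2 fun j => Ioo_mem_nhdsLT (ht j).2] with r hr hr' hrt
    have hr0 : (r : ℂ) ≠ 0 := Complex.ofReal_ne_zero.2 hr.1.ne'
    have hrn : ‖(r : ℂ)‖ = r := by rw [Complex.norm_real, Real.norm_of_nonneg hr.1.le]
    -- The pair with small product is moved to the places 0 and 5 and replaced by r and t_i t_j / r.
    -- The latter has modulus less than |q|, as `betaF_replaceBy` requires.
    set s : Fin 6 → ℂ := Function.update (Function.update (fun l => t (τ l)) 0 (r : ℂ)) 5
      (t i * t j / r) with hs
    have hs5 : ‖t i * t j / r‖ < ‖q‖ := by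
      rw [norm_div, hrn, div_lt_iff₀ hr.1]
      exact ((div_lt_iff₀ hq0').1 hr'.1).trans_eq (mul_comm _ _)
    have e5 : s 5 = t i * t j / r := by simp [hs]
    have e0 : s 0 = r := by simp [hs]
    have el (l : Fin 6) (h0 : l ≠ 0) (h5 : l ≠ 5) : s l = t (τ l) := by simp [hs, h0, h5]
    have hss : Small s := fun l => by
      by_cases h5 : l = 5
      · rw [h5, e5]
        exact ⟨div_ne_zero (mul_ne_zero (ht i).1 (ht j).1) hr0, hs5.trans hq⟩
      · by_cases h0 : l = 0
        · rw [h0, e0, hrn]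
          exact ⟨hr0, hr.2⟩
        · rw [el l h0 h5]
          exact ht _
    have hsp : ∏ l, s l = p * q := by
      have hA : ∏ l, t (τ l) = p * q := (Equiv.prod_comp τ t).trans hprod
      have h6 : (5 : Fin 6) ∈ Finset.univ.erase 0 := by decide
      rw [← Finset.mul_prod_erase _ _ (Finset.mem_univ 0), ← Finset.mul_prod_erase _ _ h6,
        ← mul_assoc] at hA ⊢
      rw [e0, e5, mul_div_cancel₀ _ hr0, ← hA, h0', h5]
      refine congrArg (t i * t j * ·) (Finset.prod_congr rfl fun l hl => el l ?_ ?_)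
      · exact (Finset.mem_erase.1 (Finset.mem_erase.1 hl).2).1
      · exact (Finset.mem_erase.1 hl).1
    have hb : betaF p q s = betaF p q t := by
      rw [← betaF_comp_perm hp hq t τ]
      refine betaF_update hp hq hp0 hq0 (fun l => ht _)
        ((Equiv.prod_comp τ t).trans hprod) (by decide) ?_ (by rw [hrn]; exact hr.2)
        (hs5.trans hq) ?_
      · rw [h0', h5]
        exact hlt
      · rw [h0', h5, mul_div_cancel₀ _ hr0]
    rw [← hb, ← (betaF_replaceBy hp hq hp0 hq0 hss hsp (e5 ▸ hs5) hr0 (by rw [hrn]; exact hr.2)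
      (fun l hl => ?_) (Finset.univ.erase 5) (by simp)).2]
    · congr 1
      funext l
      by_cases hl : l = 5
      · rw [replaceBy, if_pos hl, if_pos hl, Finset.prod_div_distrib, ← mul_div_assoc,
          Finset.mul_prod_erase _ s (Finset.mem_univ 5), hsp]
        simp
      · simp [replaceBy, hl]
    · rw [hrn]
      by_cases h0 : l = 0
      · rw [h0, e0, hrn]
      · rw [el l h0 hl]
        exact (hrt _).1.le
  obtain ⟨r, h1, h2⟩ := ((key t ht hprod hlt).and (key t' ht' hprod' hlt')).exists
  exact h1.trans h2.symm

end EllipticHyp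

end

/-! ### The constant in the elliptic beta integral is not zero -/

noncomputable section

namespace EllipticHyp

open Filter Topology Set

variable {p q : ℂ} {J : Type}

/-! ### Cauchy's formula on annuli -/

/-- The difference quotient (h(z) - h(w)) / (z - w) extends holomorphically and has the same
integral over both circles. The rest is h(w) times the integrals of 1/(z - w), which are 2πi and 0.
-/
theorem circleIntegral_sub_circleIntegral_div_sub {r R : ℝ} (hr : 0 < r) {w : ℂ} (hw : w ∈ annulus r R)
    {h : ℂ → ℂ} (hd : ∀ z, r ≤ ‖z‖ → ‖z‖ ≤ R → DifferentiableAt ℂ h z) :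
    (∮ z in C(0, R), (z - w)⁻¹ * h z) - (∮ z in C(0, r), (z - w)⁻¹ * h z) =
      2 * Real.pi * Complex.I * h w := by
  have hrR : r ≤ R := (hw.1.trans hw.2).le
  set A : Set ℂ := {z | r ≤ ‖z‖ ∧ ‖z‖ ≤ R} with hA
  have hAw : A ∈ 𝓝 w := mem_of_superset ((isOpen_annulus r R).mem_nhds hw)
    fun z hz => ⟨hz.1.le, hz.2.le⟩
  have hdA : DifferentiableOn ℂ (dslope h w) A :=
    (Complex.differentiableOn_dslope hAw).2 fun z hz => (hd z hz.1 hz.2).differentiableWithinAt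
  have hcirc : (∮ z in C(0, R), dslope h w z) = ∮ z in C(0, r), dslope h w z := by
    refine Complex.circleIntegral_eq_of_differentiable_on_annulus_off_countable hr hrR
      countable_empty ?_ ?_
    · refine hdA.continuousOn.mono fun z hz => ?_
      exact ⟨by simpa using hz.2, by simpa using hz.1⟩
    · intro z hz
      have h1 : ‖z‖ < R := by simpa using hz.1.1
      have h2 : r < ‖z‖ := not_le.1 fun h => hz.1.2 (by simpa using h)
      exact hdA.differentiableAt (mem_of_superset ((isOpen_annulus r R).mem_nhds ⟨h2, h1⟩)
        fun z hz => ⟨hz.1.le, hz.2.le⟩)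
  have hsplit {ρ : ℝ} (hρ : 0 < ρ) (hρw : ρ ≠ ‖w‖) (hρr : r ≤ ρ) (hρR : ρ ≤ R) :
      (∮ z in C(0, ρ), (z - w)⁻¹ * h z) =
        (∮ z in C(0, ρ), dslope h w z) + h w * ∮ z in C(0, ρ), (z - w)⁻¹ := by
    have hne {z : ℂ} (hz : z ∈ Metric.sphere (0 : ℂ) ρ) : z - w ≠ 0 := by
      rw [sub_ne_zero]
      rintro rfl
      exact hρw (by simpa using hz.symm)
    have hinv : ContinuousOn (fun z : ℂ => (z - w)⁻¹) (Metric.sphere (0 : ℂ) ρ) :=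
      (continuousOn_id.sub continuousOn_const).inv₀ fun z hz => hne hz
    rw [← circleIntegral.integral_const_mul, ← circleIntegral.integral_add]
    · refine circleIntegral.integral_congr hρ.le fun z hz => ?_
      simp only [dslope_of_ne h (sub_ne_zero.1 (hne hz)), slope_def_field]
      have := hne hz
      field_simp
      ring
    · refine (hdA.continuousOn.mono fun z hz => ?_).circleIntegrable hρ.le
      have : ‖z‖ = ρ := by simpa using hz
      exact ⟨this ▸ hρr, this ▸ hρR⟩
    · exact (continuousOn_const.mul hinv).circleIntegrable hρ.le
  have h1 : (∮ z in C(0, R), (z - w)⁻¹) = 2 * Real.pi * Complex.I :=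
    circleIntegral.integral_sub_inv_of_mem_ball (by simpa using hw.2)
  have h2 : (∮ z in C(0, r), (z - w)⁻¹) = 0 := by
    have hne (z : ℂ) (hz : ‖z‖ ≤ r) : DifferentiableAt ℂ (fun z => (z - w)⁻¹) z := by
      refine (differentiableAt_id.sub_const w).inv ?_
      rw [id, sub_ne_zero]
      rintro rfl
      exact absurd hw.1 (not_lt.2 hz)
    refine Complex.circleIntegral_eq_zero_of_differentiable_on_off_countable hr.le countable_empty
      (fun z hz => (hne z (by simpa using hz)).continuousAt.continuousWithinAt) fun z hz => ?_
    exact hne z (by simpa using (mem_ball_zero_iff.1 hz.1).le)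
  rw [hsplit (hr.trans (hw.1.trans hw.2)) hw.2.ne' hrR le_rfl, hsplit hr hw.1.ne le_rfl hrR, hcirc,
    h1, h2]
  ring

/-- The factor (1 - z²)/(1 + z²) is odd under z ↦ 1/z, so the integral over the circle of radius 1/ρ
is the negative of the given one. Their difference comes from the poles ±i of z⁻¹ - (z - i)⁻¹ - (z +
i)⁻¹ and equals -4πi h(i), because h(-i) = h(i). -/
theorem circleIntegral_symmetric_mul {ρ : ℝ} (hρ : 0 < ρ) (hρ1 : ρ < 1) {h : ℂ → ℂ}
    (hd : ∀ z, ρ ≤ ‖z‖ → ‖z‖ ≤ ρ⁻¹ → DifferentiableAt ℂ h z) (hs : ∀ z, z ≠ 0 → h z⁻¹ = h z) :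
    (∮ z in C(0, ρ), z⁻¹ * (h z * ((1 - z ^ 2) / (1 + z ^ 2)))) =
      2 * Real.pi * Complex.I * h Complex.I := by
  have hρ' : 1 < ρ⁻¹ := (one_lt_inv₀ hρ).2 hρ1
  set φ : ℂ → ℂ := fun z => h z * ((1 - z ^ 2) / (1 + z ^ 2)) with hφ
  have hI : Complex.I ∈ annulus ρ ρ⁻¹ := by
    rw [annulus, mem_ofPred_eq, Complex.norm_I]
    exact ⟨hρ1, hρ'⟩
  have hI' : -Complex.I ∈ annulus ρ ρ⁻¹ := by
    rw [annulus, mem_ofPred_eq, norm_neg]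
    exact hI
  have h0 : (0 : ℂ) ∈ Metric.ball (0 : ℂ) ρ := by simpa using hρ
  have hodd (z : ℂ) (hz : z ≠ 0) : φ z⁻¹ = -φ z := by
    simp only [hφ, hs z hz]
    rcases eq_or_ne (1 + z ^ 2) 0 with h1 | h1
    · have h2 : 1 + z⁻¹ ^ 2 = 0 := by
        have : 1 + z⁻¹ ^ 2 = (1 + z ^ 2) * z⁻¹ ^ 2 := by field_simp; ring
        rw [this, h1, zero_mul]
      rw [h1, h2]
      simp
    · have h2 : 1 + z⁻¹ ^ 2 ≠ 0 := by
        have : 1 + z⁻¹ ^ 2 = (1 + z ^ 2) * z⁻¹ ^ 2 := by field_simp; ring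
        rw [this]
        exact mul_ne_zero h1 (pow_ne_zero 2 (inv_ne_zero hz))
      have : (1 - z⁻¹ ^ 2) / (1 + z⁻¹ ^ 2) = -((1 - z ^ 2) / (1 + z ^ 2)) := by
        rw [← neg_div, div_eq_div_iff h2 h1]
        field_simp
        ring
      rw [this]
      ring
  have hanti : (∮ z in C(0, ρ⁻¹), z⁻¹ * φ z) = -∮ z in C(0, ρ), z⁻¹ * φ z := by
    have hρc : (ρ : ℂ) ≠ 0 := Complex.ofReal_ne_zero.2 hρ.ne'
    have hn : ‖(ρ : ℂ)‖ = ρ := by rw [Complex.norm_real, Real.norm_of_nonneg hρ.le]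
    have e1 := circleIntegral_inversion φ (inv_ne_zero hρc)
    have e2 := circleIntegral_inversion φ hρc
    have e3 := circleIntegral_inversion (fun z => φ (ρ * z⁻¹)) one_ne_zero
    rw [norm_inv, hn] at e1
    rw [hn] at e2
    rw [norm_one] at e3
    rw [e1, e2, e3, ← neg_one_mul, ← circleIntegral.integral_const_mul]
    refine circleIntegral.integral_congr zero_le_one fun z hz => ?_
    have hz0 : z ≠ 0 := norm_ne_zero_iff.1 (by
      rw [mem_sphere_zero_iff_norm.1 hz]
      exact one_ne_zero)
    simp only [one_mul, inv_inv]
    rw [← mul_inv, hodd _ (mul_ne_zero hρc hz0)]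
    ring
  have hsplit {R : ℝ} (hR : 0 < R) (h1 : ρ ≤ R) (h2 : R ≤ ρ⁻¹) (hR1 : R ≠ 1) :
      (∮ z in C(0, R), z⁻¹ * φ z) = (∮ z in C(0, R), (z - 0)⁻¹ * h z) -
        (∮ z in C(0, R), (z - Complex.I)⁻¹ * h z) - ∮ z in C(0, R), (z - -Complex.I)⁻¹ * h z := by
    have hnorm {z : ℂ} (hz : z ∈ Metric.sphere (0 : ℂ) R) : ‖z‖ = R := by simpa using hz
    have hne {w z : ℂ} (hw : ‖w‖ ≠ R) (hz : z ∈ Metric.sphere (0 : ℂ) R) : z - w ≠ 0 := by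
      rw [sub_ne_zero]
      rintro rfl
      exact hw (hnorm hz)
    have hint {w : ℂ} (hw : ‖w‖ ≠ R) : CircleIntegrable (fun z => (z - w)⁻¹ * h z) 0 R := by
      refine (((continuousOn_id.sub continuousOn_const).inv₀ fun z hz => hne hw hz).mul
        fun z hz => ?_).circleIntegrable hR.le
      exact (hd z ((hnorm hz).symm ▸ h1) ((hnorm hz).symm ▸ h2)).continuousAt.continuousWithinAt
    have w0 : ‖(0 : ℂ)‖ ≠ R := by rw [norm_zero]; exact hR.ne
    have w1 : ‖Complex.I‖ ≠ R := by rw [Complex.norm_I]; exact hR1.symm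
    have w2 : ‖-Complex.I‖ ≠ R := by rw [norm_neg]; exact w1
    rw [← circleIntegral.integral_sub (hint w0) (hint w1), ← circleIntegral.integral_sub
      (f := fun z => (z - 0)⁻¹ * h z - (z - Complex.I)⁻¹ * h z)
      ((hint w0).sub (hint w1)) (hint w2)]
    refine circleIntegral.integral_congr hR.le fun z hz => ?_
    have n0 := hne w0 hz
    have n1 := hne w1 hz
    have n2 := hne w2 hz
    have n3 : 1 + z ^ 2 = (z - Complex.I) * (z - -Complex.I) := by
      ring_nf
      rw [Complex.I_sq]
      ring
    have n4 : (1 - z ^ 2) / (1 + z ^ 2) = 1 - z * (z - Complex.I)⁻¹ - z * (z - -Complex.I)⁻¹ := by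
      rw [n3, div_eq_iff (mul_ne_zero n1 n2), ← n3]
      have m1 : (z - Complex.I)⁻¹ * (1 + z ^ 2) = z - -Complex.I := by
        rw [n3, inv_mul_cancel_left₀ n1]
      have m2 : (z - -Complex.I)⁻¹ * (1 + z ^ 2) = z - Complex.I := by
        rw [n3, mul_comm (z - Complex.I), inv_mul_cancel_left₀ n2]
      linear_combination z * m1 + z * m2
    rw [sub_zero] at n0
    simp only [hφ, n4, sub_zero]
    have m0 : z⁻¹ * z = 1 := inv_mul_cancel₀ n0
    linear_combination (-(h z * (z - Complex.I)⁻¹) - h z * (z - -Complex.I)⁻¹) * m0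
  have hzero : (∮ z in C(0, ρ⁻¹), (z - 0)⁻¹ * h z) = ∮ z in C(0, ρ), (z - 0)⁻¹ * h z := by
    have := Complex.circleIntegral_sub_center_inv_smul_eq_of_differentiable_on_annulus_off_countable
      (c := 0) (r := ρ) (R := ρ⁻¹) hρ (hρ1.trans hρ').le (f := h)
      countable_empty (fun z hz => by
        refine (hd z ?_ ?_).continuousAt.continuousWithinAt
        · simpa using hz.2
        · simpa using hz.1) (fun z hz => by
        refine hd z ?_ ?_
        · simpa using (not_le.1 fun h => hz.1.2 (by simpa using h)).le
        · simpa using (mem_ball_zero_iff.1 hz.1.1).le)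
    simpa using this
  have c1 := circleIntegral_sub_circleIntegral_div_sub hρ hI hd
  have c2 := circleIntegral_sub_circleIntegral_div_sub hρ hI' hd
  have hm : h (-Complex.I) = h Complex.I := by
    rw [← hs Complex.I Complex.I_ne_zero, Complex.inv_I]
  have s1 := hsplit hρ le_rfl (hρ1.trans hρ').le hρ1.ne
  have s2 := hsplit (one_pos.trans hρ') (hρ1.trans hρ').le le_rfl hρ'.ne'
  rw [hm] at c2
  rw [hanti, hzero] at s2
  linear_combination (1 / 2) * s1 - (1 / 2) * s2 + (1 / 2) * c1 + (1 / 2) * c2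

/-! ### The elliptic beta integral does not vanish -/

/-- The function `(1 - x) Γ(x)`. -/
def regGam (p q x : ℂ) : ℂ := E p q (p * q / x) / (poch q (q * x) * E p q (p * x))

theorem Gam_mul_one_sub (hp : ‖p‖ < 1) (hq : ‖q‖ < 1) {x : ℂ} (hx : x ≠ 1) :
    Gam p q x * (1 - x) = regGam p q x := by
  have : 1 - x ≠ 0 := sub_ne_zero.2 hx.symm
  rw [Gam_eq, regGam, E_shift_left hp hq x, poch_shift hq x, mul_assoc, ← div_div, div_right_comm,
    div_mul_cancel₀ _ this]

theorem regGam_differentiableAt (hp : ‖p‖ < 1) (hq : ‖q‖ < 1) {x : ℂ} (hx : x ≠ 0)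
    (hpx : ‖p * x‖ < 1) (hqx : ‖q * x‖ < 1) : DifferentiableAt ℂ (regGam p q) x := by
  have h := E_differentiable hp hq
  have h' := poch_differentiable hq
  refine DifferentiableAt.div ((h _).comp (f := fun x => p * q / x) x
    (by fun_prop (disch := assumption))) (DifferentiableAt.mul ((h' _).comp x (by fun_prop))
    ((h _).comp x (by fun_prop))) ?_
  exact mul_ne_zero (poch_ne_zero hq hqx) (E_ne_zero hp hq hpx)

theorem regGam_ne_zero (hp : ‖p‖ < 1) (hq : ‖q‖ < 1) {x : ℂ} (hx : ‖x‖ = 1) :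
    regGam p q x ≠ 0 := by
  refine div_ne_zero (E_ne_zero hp hq ?_) (mul_ne_zero (poch_ne_zero hq ?_) (E_ne_zero hp hq ?_))
  · rw [norm_div, hx, div_one]
    exact norm_mul_lt_one hp.le hq
  · rwa [norm_mul, hx, mul_one]
  · rwa [norm_mul, hx, mul_one]

theorem hypF_inv [Fintype J] (hp : ‖p‖ < 1) (hq : ‖q‖ < 1) (hp0 : p ≠ 0) (hq0 : q ≠ 0)
    (t : J → ℂ) {z : ℂ} (hz : z ≠ 0) : hypF p q t z⁻¹ = hypF p q t z := by
  have h2 := pow_ne_zero 2 hz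
  have e1 : theta p (z⁻¹ ^ 2) = -(z ^ 2)⁻¹ * theta p (z ^ 2) := by
    rw [inv_pow, theta_inv hp0 hp h2]
  have e2 : theta q (z⁻¹ ^ 2)⁻¹ = theta q (z ^ 2) := by rw [inv_pow, inv_inv]
  rw [hypF, hypF, e1, e2, theta_inv hq0 hq h2]
  simp only [inv_inv, mul_comm (Gam p q (_ * z⁻¹))]
  ring

/-- The integrand of the elliptic beta integral with parameters `±ir, c₀, …, c₃`, times
`(1 + r² z⁻²) (1 - r² z²)`, without the removable singularities at `z = ±ir`. -/
def betaK (p q r : ℂ) (c : Fin 4 → ℂ) (z : ℂ) : ℂ :=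
  regGam p q (Complex.I * r * z⁻¹) * regGam p q (-(Complex.I * r) * z⁻¹) *
    (Gam p q (Complex.I * r * z) * Gam p q (-(Complex.I * r) * z)) *
    ((∏ j, Gam p q (c j * z) * Gam p q (c j * z⁻¹)) * (theta p (z ^ 2) * theta q (z ^ 2)⁻¹)) *
    (1 - r ^ 2 * z ^ 2)

theorem betaK_eq (hp : ‖p‖ < 1) (hq : ‖q‖ < 1) {r z : ℂ} (c : Fin 4 → ℂ)
    (h : 1 + r ^ 2 * z⁻¹ ^ 2 ≠ 0) :
    betaK p q r c z = hypF p q (vec (Complex.I * r) (-(Complex.I * r)) c) z *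
      ((1 + r ^ 2 * z⁻¹ ^ 2) * (1 - r ^ 2 * z ^ 2)) := by
  have hI := Complex.I_sq
  have e : (1 - Complex.I * r * z⁻¹) * (1 - -(Complex.I * r) * z⁻¹) = 1 + r ^ 2 * z⁻¹ ^ 2 := by
    linear_combination (-(r ^ 2 * z⁻¹ ^ 2)) * hI
  rw [← e] at h
  obtain ⟨h1, h2⟩ := mul_ne_zero_iff.1 h
  rw [betaK, hypF, prod_vec _ _ _ fun x => Gam p q (x * z) * Gam p q (x * z⁻¹), ← e,
    ← Gam_mul_one_sub hp hq (sub_ne_zero.1 h1).symm, ← Gam_mul_one_sub hp hq (sub_ne_zero.1 h2).symm]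
  ring

theorem betaK_differentiableAt (hp : ‖p‖ < 1) (hq : ‖q‖ < 1) {X : Type*} [NormedAddCommGroup X]
    [NormedSpace ℂ X] {f g : X → ℂ} {c : X → Fin 4 → ℂ} {x : X} (hf : DifferentiableAt ℂ f x)
    (hc : DifferentiableAt ℂ c x) (hg : DifferentiableAt ℂ g x) (hf0 : f x ≠ 0) (hg0 : g x ≠ 0)
    (hc0 : ∀ j, c x j ≠ 0) (hpr : ‖p * f x‖ < ‖g x‖) (hqr : ‖q * f x‖ < ‖g x‖)
    (hrz : ‖f x * g x‖ < 1) (hcz : ∀ j, ‖c x j * g x‖ < 1) (hcz' : ∀ j, ‖c x j‖ < ‖g x‖) :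
    DifferentiableAt ℂ (fun y => betaK p q (f y) (c y) (g y)) x := by
  have hcj (j : Fin 4) : DifferentiableAt ℂ (fun y => c y j) x := differentiableAt_pi.1 hc j
  have hgi : DifferentiableAt ℂ (fun y => (g y)⁻¹) x := hg.inv hg0
  have hg2 : DifferentiableAt ℂ (fun y => ((g y) ^ 2)⁻¹) x := (hg.pow 2).inv (pow_ne_zero 2 hg0)
  have hg0' : 0 < ‖g x‖ := norm_pos_iff.2 hg0
  have hI0 : Complex.I * f x ≠ 0 := mul_ne_zero Complex.I_ne_zero hf0
  have hIf : DifferentiableAt ℂ (fun y => Complex.I * f y) x := hf.const_mul _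
  have hdiv {a : ℂ} (ha : ‖a‖ < ‖g x‖) : ‖a * (g x)⁻¹‖ < 1 := by
    rwa [norm_mul, norm_inv, ← div_eq_mul_inv, div_lt_one hg0']
  have hI1 {a : ℂ} (ha : ‖a * f x‖ < ‖g x‖) : ‖a * (Complex.I * f x * (g x)⁻¹)‖ < 1 := by
    rw [show a * (Complex.I * f x * (g x)⁻¹) = Complex.I * (a * f x) * (g x)⁻¹ by ring]
    exact hdiv (by rwa [norm_mul, Complex.norm_I, one_mul])
  have hI2 {a : ℂ} (ha : ‖a * f x‖ < ‖g x‖) : ‖a * (-(Complex.I * f x) * (g x)⁻¹)‖ < 1 := by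
    rw [neg_mul, mul_neg, norm_neg]
    exact hI1 ha
  have hI3 : ‖Complex.I * f x * g x‖ < 1 := by
    rwa [mul_assoc, norm_mul, Complex.norm_I, one_mul]
  refine DifferentiableAt.mul (DifferentiableAt.mul (DifferentiableAt.mul (DifferentiableAt.mul
    ?_ ?_) (DifferentiableAt.mul ?_ ?_)) (DifferentiableAt.mul (differentiableAt_prod _ fun j _ =>
    DifferentiableAt.mul ?_ ?_) (DifferentiableAt.mul ?_ ?_))) ?_
  · exact (regGam_differentiableAt hp hq (mul_ne_zero hI0 (inv_ne_zero hg0)) (hI1 hpr)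
      (hI1 hqr)).comp x (hIf.mul hgi)
  · exact (regGam_differentiableAt hp hq (mul_ne_zero (neg_ne_zero.2 hI0) (inv_ne_zero hg0))
      (hI2 hpr) (hI2 hqr)).comp x (hIf.neg.mul hgi)
  · exact (Gam_differentiableAt hp hq (mul_ne_zero hI0 hg0) (E_ne_zero hp hq hI3)).comp x
      (hIf.mul hg)
  · exact (Gam_differentiableAt hp hq (mul_ne_zero (neg_ne_zero.2 hI0) hg0) (E_ne_zero hp hq
      (by rwa [neg_mul, norm_neg]))).comp x (hIf.neg.mul hg)
  · exact (Gam_differentiableAt hp hq (mul_ne_zero (hc0 j) hg0) (E_ne_zero hp hq (hcz j))).comp x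
      ((hcj j).mul hg)
  · exact (Gam_differentiableAt hp hq (mul_ne_zero (hc0 j) (inv_ne_zero hg0))
      (E_ne_zero hp hq (hdiv (hcz' j)))).comp x ((hcj j).mul hgi)
  · exact (theta_differentiableAt hp (pow_ne_zero 2 hg0)).comp x (hg.pow 2)
  · exact (theta_differentiableAt hq (inv_ne_zero (pow_ne_zero 2 hg0))).comp x hg2
  · exact (differentiableAt_const _).sub ((hf.pow 2).mul (hg.pow 2))

/-- One has (1 + r² z⁻²)(1 - r² z²) = 1 - r⁴ + r² (z⁻² - z²), and the last term integrates to zero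
against the inversion invariant integrand. The factor 1 + r² z⁻² cancels the poles at ±ir, so the
circle can be shrunk to a radius ρ < 1 that works up to r = 1. -/
theorem circleIntegral_betaK (hp : ‖p‖ < 1) (hq : ‖q‖ < 1) (hp0 : p ≠ 0) (hq0 : q ≠ 0)
    {r ρ : ℝ} (hr0 : 0 < r) (hr1 : r < 1) (hρ1 : ρ < 1) (hpρ : ‖p‖ < ρ) (hqρ : ‖q‖ < ρ)
    {c : Fin 4 → ℂ} (hc0 : ∀ j, c j ≠ 0) (hcρ : ∀ j, ‖c j‖ < ρ) :
    (∮ z in C(0, ρ), z⁻¹ * betaK p q r c z) =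
      (1 - (r : ℂ) ^ 4) * hypI p q (vec (Complex.I * r) (-(Complex.I * r)) c) := by
  have hrn : ‖(r : ℂ)‖ = r := by rw [Complex.norm_real, Real.norm_of_nonneg hr0.le]
  have hrc : (r : ℂ) ≠ 0 := Complex.ofReal_ne_zero.2 hr0.ne'
  have hρ0 : 0 < ρ := (norm_nonneg p).trans_lt hpρ
  have hsmall : Small (vec (Complex.I * r) (-(Complex.I * r)) c) := by
    refine (forall_vec (P := fun x => x ≠ 0 ∧ ‖x‖ < 1)).2 ⟨⟨mul_ne_zero Complex.I_ne_zero hrc, ?_⟩,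
      ⟨neg_ne_zero.2 (mul_ne_zero Complex.I_ne_zero hrc), ?_⟩, fun j => ⟨hc0 j, (hcρ j).trans hρ1⟩⟩
    · rwa [norm_mul, Complex.norm_I, one_mul, hrn]
    · rwa [norm_neg, norm_mul, Complex.norm_I, one_mul, hrn]
  have hd (z : ℂ) (h1 : ρ ≤ ‖z‖) (h2 : ‖z‖ ≤ 1) : DifferentiableAt ℂ (betaK p q r c) z := by
    refine betaK_differentiableAt (f := fun _ => (r : ℂ)) (c := fun _ => c) (g := fun z => z) hp hq
      (differentiableAt_const _) (differentiableAt_const _) differentiableAt_id hrc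
      (norm_pos_iff.1 (hρ0.trans_le h1)) hc0 ?_ ?_ ?_ ?_ ?_
    · rw [norm_mul, hrn]
      exact (mul_le_of_le_one_right (norm_nonneg _) hr1.le).trans_lt (hpρ.trans_le h1)
    · rw [norm_mul, hrn]
      exact (mul_le_of_le_one_right (norm_nonneg _) hr1.le).trans_lt (hqρ.trans_le h1)
    · rw [mul_comm]
      exact norm_mul_lt_one h2 (hrn.trans_lt hr1)
    · intro j
      rw [mul_comm]
      exact norm_mul_lt_one h2 ((hcρ j).trans hρ1)
    · exact fun j => (hcρ j).trans_le h1
  have hshift : (∮ z in C(0, 1), z⁻¹ * betaK p q r c z) = ∮ z in C(0, ρ), z⁻¹ * betaK p q r c z := by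
    have := Complex.circleIntegral_sub_center_inv_smul_eq_of_differentiable_on_annulus_off_countable
      (c := 0) (r := ρ) (R := 1) hρ0 hρ1.le (f := betaK p q r c)
      countable_empty (fun z hz => by
        refine (hd z ?_ ?_).continuousAt.continuousWithinAt
        · simpa using hz.2
        · simpa using hz.1) (fun z hz => by
        refine hd z ?_ ?_
        · simpa using (not_le.1 fun h => hz.1.2 (by simpa using h)).le
        · simpa using (mem_ball_zero_iff.1 hz.1.1).le)
    simpa using this
  set F := hypF p q (vec (Complex.I * r) (-(Complex.I * r)) c) with hF
  have hnorm {z : ℂ} (hz : z ∈ Metric.sphere (0 : ℂ) 1) : ‖z‖ = 1 := by simpa using hz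
  have hne {z : ℂ} (hz : z ∈ Metric.sphere (0 : ℂ) 1) : z ≠ 0 :=
    norm_ne_zero_iff.1 (by rw [hnorm hz]; exact one_ne_zero)
  have hinv : ContinuousOn (fun z : ℂ => z⁻¹) (Metric.sphere (0 : ℂ) 1) :=
    continuousOn_inv₀.mono fun z hz => hne hz
  have hFc : ContinuousOn F (Metric.sphere 0 1) := hsmall.continuousOn hp hq
  have hanti : (∮ z in C(0, 1), z⁻¹ * (F z * (z⁻¹ ^ 2 - z ^ 2))) = 0 := by
    have h := circleIntegral_inversion (fun z => F z * (z⁻¹ ^ 2 - z ^ 2)) one_ne_zero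
    rw [norm_one] at h
    rw [← self_eq_neg]
    conv_lhs => rw [h]
    rw [← neg_one_mul, ← circleIntegral.integral_const_mul]
    refine circleIntegral.integral_congr zero_le_one fun z hz => ?_
    simp only [one_mul, inv_inv, hF, hypF_inv hp hq hp0 hq0 _ (hne hz)]
    ring
  rw [← hshift, hsmall.hypI_eq hp hq hp0 hq0, ← circleIntegral.integral_const_mul]
  have hsum : (∮ z in C(0, 1), z⁻¹ * betaK p q r c z) = ∮ z in C(0, 1),
      ((1 - (r : ℂ) ^ 4) * (z⁻¹ * F z) + (r : ℂ) ^ 2 * (z⁻¹ * (F z * (z⁻¹ ^ 2 - z ^ 2)))) := by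
    refine circleIntegral.integral_congr zero_le_one fun z hz => ?_
    have h1 : 1 + (r : ℂ) ^ 2 * z⁻¹ ^ 2 ≠ 0 := by
      intro h
      have h2 : ‖(r : ℂ) ^ 2 * z⁻¹ ^ 2‖ = 1 := by
        rw [eq_neg_of_add_eq_zero_right h, norm_neg, norm_one]
      rw [norm_mul, norm_pow, norm_pow, norm_inv, hnorm hz, hrn, inv_one, one_pow, mul_one] at h2
      exact (pow_lt_one₀ hr0.le hr1 two_ne_zero).ne h2
    simp only [betaK_eq hp hq c h1, ← hF]
    have h2 : z⁻¹ * z = 1 := inv_mul_cancel₀ (hne hz)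
    linear_combination (-(r : ℂ) ^ 4 * z⁻¹ * F z) * (z⁻¹ * z + 1) * h2
  have hcont : ContinuousOn (fun z : ℂ => F z * (z⁻¹ ^ 2 - z ^ 2)) (Metric.sphere 0 1) :=
    hFc.mul ((hinv.pow 2).sub (continuousOn_id.pow 2))
  rw [hsum, circleIntegral.integral_add, circleIntegral.integral_const_mul ((r : ℂ) ^ 2), hanti,
    mul_zero, add_zero]
  · exact (continuousOn_const.mul (hinv.mul hFc)).circleIntegrable zero_le_one
  · exact (continuousOn_const.mul (hinv.mul hcont)).circleIntegrable zero_le_one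

theorem theta_mul_theta_inv (hp : ‖p‖ < 1) (hq : ‖q‖ < 1) (hp0 : p ≠ 0) (hq0 : q ≠ 0) {x : ℂ}
    (hx : x ≠ 0) : theta p x⁻¹ * theta q x = theta p x * theta q x⁻¹ := by
  rw [theta_inv hp0 hp hx, theta_inv hq0 hq hx]
  ring

theorem theta_neg_one_ne_zero (hq : ‖q‖ < 1) (hq0 : q ≠ 0) : theta q (-1) ≠ 0 := by
  rw [Ne, theta_eq_zero_iff hq0 hq (by norm_num)]
  rintro ⟨k, hk⟩
  have h := congrArg norm hk
  rw [norm_neg, norm_one, norm_zpow, eq_comm,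
    zpow_eq_one_iff_right₀ (norm_nonneg q) hq.ne] at h
  rw [h, zpow_zero] at hk
  norm_num at hk

/-- At r = 1 the factors Γ(±iz) contribute 1/(1 + z²) times regular functions. What remains besides
(1 - z²)/(1 + z²) is invariant under inversion, so the integral is 2πi h(i), and no factor of h
vanishes at i. -/
theorem circleIntegral_betaK_one_ne_zero (hp : ‖p‖ < 1) (hq : ‖q‖ < 1) (hp0 : p ≠ 0) (hq0 : q ≠ 0)
    {ρ : ℝ} (hρ1 : ρ < 1) (hpρ : ‖p‖ < ρ) (hqρ : ‖q‖ < ρ)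
    {c : Fin 4 → ℂ} (hcρ : ∀ j, ‖c j‖ < ρ) (hpqc : ∀ j, ‖p * q‖ < ‖c j‖) :
    (∮ z in C(0, ρ), z⁻¹ * betaK p q 1 c z) ≠ 0 := by
  have hρ0 : 0 < ρ := (norm_nonneg p).trans_lt hpρ
  have hc0 (j : Fin 4) : c j ≠ 0 := norm_pos_iff.1 ((norm_nonneg _).trans_lt (hpqc j))
  set R : ℂ → ℂ := fun x => regGam p q (Complex.I * x) * regGam p q (-Complex.I * x) with hR
  set h : ℂ → ℂ := fun z => R z * R z⁻¹ *
    ((∏ j, Gam p q (c j * z) * Gam p q (c j * z⁻¹)) * (theta p (z ^ 2) * theta q (z ^ 2)⁻¹)) with hh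
  have hK {z : ℂ} (hz : z ∈ Metric.sphere (0 : ℂ) ρ) :
      z⁻¹ * betaK p q 1 c z = z⁻¹ * (h z * ((1 - z ^ 2) / (1 + z ^ 2))) := by
    have hzn : ‖z‖ = ρ := by simpa using hz
    have h1 : ‖Complex.I * z‖ < 1 := by rwa [norm_mul, Complex.norm_I, one_mul, hzn]
    have h2 : Complex.I * z ≠ 1 := by
      intro h
      rw [h, norm_one] at h1
      exact lt_irrefl _ h1
    have h3 : -Complex.I * z ≠ 1 := by
      intro h
      rw [← norm_neg, ← neg_mul, h, norm_one] at h1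
      exact lt_irrefl _ h1
    have h4 : 1 + z ^ 2 = (1 - Complex.I * z) * (1 - -Complex.I * z) := by
      linear_combination z ^ 2 * Complex.I_sq
    have h5 : 1 + z ^ 2 ≠ 0 := by
      rw [h4]
      exact mul_ne_zero (sub_ne_zero.2 h2.symm) (sub_ne_zero.2 h3.symm)
    simp only [betaK, hh, hR, ← Gam_mul_one_sub hp hq h2, ← Gam_mul_one_sub hp hq h3, mul_one]
    rw [mul_div_assoc', eq_comm, eq_comm, ← mul_div_assoc, eq_div_iff h5, h4]
    ring
  rw [circleIntegral.integral_congr hρ0.le fun z hz => hK hz, circleIntegral_symmetric_mul hρ0 hρ1]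
  · refine mul_ne_zero Complex.two_pi_I_ne_zero ?_
    have r1 : R Complex.I ≠ 0 :=
      mul_ne_zero (regGam_ne_zero hp hq (by simp)) (regGam_ne_zero hp hq (by simp))
    have r2 : R Complex.I⁻¹ ≠ 0 :=
      mul_ne_zero (regGam_ne_zero hp hq (by simp)) (regGam_ne_zero hp hq (by simp))
    refine mul_ne_zero (mul_ne_zero r1 r2) (mul_ne_zero ?_ (mul_ne_zero ?_ ?_))
    · refine Finset.prod_ne_zero_iff.2 fun j _ => mul_ne_zero (Gam_ne_zero hp hq ?_ ?_)
        (Gam_ne_zero hp hq ?_ ?_)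
      · simpa using (hcρ j).trans hρ1
      · simpa using hpqc j
      · simpa using (hcρ j).trans hρ1
      · simpa using hpqc j
    · rw [Complex.I_sq]
      exact theta_neg_one_ne_zero hp hp0
    · rw [Complex.I_sq, inv_neg, inv_one]
      exact theta_neg_one_ne_zero hq hq0
  · intro z h1 h2
    have hz0 : 0 < ‖z‖ := hρ0.trans_le h1
    have hz : z ≠ 0 := norm_pos_iff.1 hz0
    have hi0 : z⁻¹ ≠ 0 := inv_ne_zero hz
    have h1' : ‖z⁻¹‖ ≤ ρ⁻¹ := by
      rw [norm_inv]
      gcongr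
    have hlt {a x : ℂ} (ha : ‖a‖ < ρ) (hx : ‖x‖ ≤ ρ⁻¹) : ‖a * x‖ < 1 := by
      rw [norm_mul]
      calc ‖a‖ * ‖x‖ ≤ ‖a‖ * ρ⁻¹ := by gcongr
        _ < ρ * ρ⁻¹ := by gcongr
        _ = 1 := mul_inv_cancel₀ hρ0.ne'
    have hinv : DifferentiableAt ℂ (fun z : ℂ => z⁻¹) z := differentiableAt_inv hz
    have hRd {x : ℂ} (hx0 : x ≠ 0) (hx : ‖x‖ ≤ ρ⁻¹) : DifferentiableAt ℂ R x := by
      have hI1 : ‖Complex.I * x‖ ≤ ρ⁻¹ := by simpa using hx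
      have hI2 : ‖-Complex.I * x‖ ≤ ρ⁻¹ := by simpa using hx
      refine DifferentiableAt.mul ?_ ?_
      · exact (regGam_differentiableAt hp hq (mul_ne_zero Complex.I_ne_zero hx0) (hlt hpρ hI1)
          (hlt hqρ hI1)).comp x (by fun_prop)
      · exact (regGam_differentiableAt hp hq (mul_ne_zero (neg_ne_zero.2 Complex.I_ne_zero) hx0)
          (hlt hpρ hI2) (hlt hqρ hI2)).comp x (by fun_prop)
    refine DifferentiableAt.mul (DifferentiableAt.mul (hRd hz h2)
      (DifferentiableAt.comp (f := fun z : ℂ => z⁻¹) z (hRd hi0 h1') hinv))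
      (DifferentiableAt.mul (differentiableAt_prod _ fun j _ => DifferentiableAt.mul ?_ ?_)
        (DifferentiableAt.mul ?_ ?_))
    · exact (Gam_differentiableAt hp hq (mul_ne_zero (hc0 j) hz)
        (E_ne_zero hp hq (hlt (hcρ j) h2))).comp z (by fun_prop)
    · exact (Gam_differentiableAt hp hq (mul_ne_zero (hc0 j) hi0)
        (E_ne_zero hp hq (hlt (hcρ j) h1'))).comp (f := fun z : ℂ => c j * z⁻¹) z
          (hinv.const_mul _)
    · exact (theta_differentiableAt hp (pow_ne_zero 2 hz)).comp (f := fun z : ℂ => z ^ 2) z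
        (differentiableAt_id.pow 2)
    · exact (theta_differentiableAt hq (inv_ne_zero (pow_ne_zero 2 hz))).comp
        (f := fun z : ℂ => (z ^ 2)⁻¹) z ((differentiableAt_id.pow 2).inv (pow_ne_zero 2 hz))
  · intro z hz
    have := theta_mul_theta_inv hp hq hp0 hq0 (pow_ne_zero 2 hz)
    simp only [hh, inv_inv, inv_pow, this, mul_comm (R z⁻¹), mul_comm (Gam p q (_ * z⁻¹))]

/-- If all these integrals vanished, so would the limit for r → 1 of 1 - r⁴ times the integral with
the parameters ±ir, ±a, ±b/r. This limit is the integral in `circleIntegral_betaK_one_ne_zero`. -/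
theorem exists_hypI_ne_zero (hp : ‖p‖ < 1) (hq : ‖q‖ < 1) (hp0 : p ≠ 0) (hq0 : q ≠ 0) :
    ∃ t : Fin 6 → ℂ, Small t ∧ ∏ j, t j = p * q ∧ (∃ i j, i ≠ j ∧ ‖t i * t j‖ < ‖q‖) ∧
      hypI p q t ≠ 0 := by
  -- With s² = p, a² = s and b² = sq the product of ±ir, ±a, ±b/r is a² b² = pq. Moreover |b/r|² =
  -- |s| |q| / r² is smaller than |q| as soon as r > |a|.
  obtain ⟨s, hs⟩ := IsAlgClosed.exists_pow_nat_eq p two_pos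
  obtain ⟨a, ha⟩ := IsAlgClosed.exists_pow_nat_eq s two_pos
  obtain ⟨b, hb⟩ := IsAlgClosed.exists_pow_nat_eq (s * q) two_pos
  have hs0 : s ≠ 0 := by rintro rfl; exact hp0 (by rw [← hs]; simp)
  have ha0 : a ≠ 0 := by rintro rfl; exact hs0 (by rw [← ha]; simp)
  have hb0 : b ≠ 0 := by rintro rfl; exact mul_ne_zero hs0 hq0 (by rw [← hb]; simp)
  have hq0' : 0 < ‖q‖ := norm_pos_iff.2 hq0
  have hs0' : 0 < ‖s‖ := norm_pos_iff.2 hs0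
  have hsn : ‖s‖ ^ 2 = ‖p‖ := by rw [← norm_pow, hs]
  have han : ‖a‖ ^ 2 = ‖s‖ := by rw [← norm_pow, ha]
  have hbn : ‖b‖ ^ 2 = ‖s‖ * ‖q‖ := by rw [← norm_pow, hb, norm_mul]
  have hs1 : ‖s‖ < 1 := (sq_lt_one_iff₀ (norm_nonneg s)).1 (hsn.trans_lt hp)
  have ha1 : ‖a‖ < 1 := (sq_lt_one_iff₀ (norm_nonneg a)).1 (han.trans_lt hs1)
  have hb1 : ‖b‖ < 1 := (sq_lt_one_iff₀ (norm_nonneg b)).1 (hbn.trans_lt (by nlinarith))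
  have hpqs : ‖p * q‖ < ‖s‖ * ‖q‖ := by
    rw [norm_mul, ← hsn]
    exact mul_lt_mul_of_pos_right (by nlinarith) hq0'
  have hpqa : ‖p * q‖ < ‖a‖ := by
    nlinarith [norm_nonneg a]
  have hpqb : ‖p * q‖ < ‖b‖ := by
    nlinarith [norm_nonneg b]
  obtain ⟨ρ, hρ, hρ1⟩ := exists_between (max_lt (max_lt hp hq) (max_lt ha1 hb1))
  obtain ⟨⟨hpρ, hqρ⟩, haρ, hbρ⟩ : (‖p‖ < ρ ∧ ‖q‖ < ρ) ∧ ‖a‖ < ρ ∧ ‖b‖ < ρ := by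
    simpa [max_lt_iff] using hρ
  have hρ0 : 0 < ρ := (norm_nonneg p).trans_lt hpρ
  set c : ℂ → Fin 4 → ℂ := fun r => ![a, -a, b / r, -(b / r)] with hc
  have hcall {P : ℂ → Prop} {r : ℂ} : (∀ j, P (c r j)) ↔ P a ∧ P (-a) ∧ P (b / r) ∧ P (-(b / r)) := by
    simp [hc, Fin.forall_fin_succ]
  have hcd {r : ℂ} (hr : r ≠ 0) : DifferentiableAt ℂ c r := by
    refine differentiableAt_pi.2 fun j => ?_
    have : DifferentiableAt ℂ (fun r => b / r) r := by fun_prop (disch := assumption)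
    fin_cases j
    · exact differentiableAt_const _
    · exact differentiableAt_const _
    · exact this
    · exact this.neg
  by_contra! hcon
  -- Open conditions, satisfied at r = 1, under which `betaK` is holomorphic in r and z along the
  -- circle of radius ρ. They make the integral continuous at r = 1.
  have hev : ∀ᶠ r : ℂ in 𝓝 1, r ≠ 0 ∧ ‖p * r‖ < ρ ∧ ‖q * r‖ < ρ ∧ ‖r‖ * ρ < 1 ∧ ‖b / r‖ < ρ := by
    have hone : (1 : ℂ) ≠ 0 := one_ne_zero
    have hlt {f : ℂ → ℝ} {m : ℝ} (hf : ContinuousAt f 1) (h : f 1 < m) : ∀ᶠ r in 𝓝 1, f r < m :=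
      hf.eventually_lt continuousAt_const h
    refine (eventually_ne_nhds hone).and
      ((hlt (by fun_prop) (by simpa)).and ((hlt (by fun_prop) (by simpa)).and
        ((hlt (by fun_prop) (by simpa)).and (hlt ?_ (by simpa)))))
    exact (continuousAt_const.div continuousAt_id one_ne_zero).norm
  obtain ⟨U, hU, hUo, hU1⟩ := eventually_nhds_iff.1 hev
  have himg {z : ℂ} (hz : z ∈ (circle 0 ρ).toFun '' Icc 0 1) : ‖z‖ = ρ := by
    obtain ⟨x, -, rfl⟩ := hz
    simp [circle, hρ0.le]
  have hK {X : Type} [NormedAddCommGroup X] [NormedSpace ℂ X] {f g : X → ℂ} {x : X}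
      (hf : DifferentiableAt ℂ f x) (hg : DifferentiableAt ℂ g x) (hfU : f x ∈ U)
      (hgρ : ‖g x‖ = ρ) : DifferentiableAt ℂ (fun y => (g y)⁻¹ * betaK p q (f y) (c (f y)) (g y)) x := by
    obtain ⟨h1, h2, h3, h4, h5⟩ := hU _ hfU
    have hg0 : g x ≠ 0 := norm_pos_iff.1 (by rwa [hgρ])
    have hbr : b / f x ≠ 0 := div_ne_zero hb0 h1
    have hcρ : ∀ j, ‖c (f x) j‖ < ρ :=
      (hcall (P := fun x => ‖x‖ < ρ)).2 ⟨haρ, by rwa [norm_neg], h5, by rwa [norm_neg]⟩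
    refine (hg.inv hg0).mul (betaK_differentiableAt (c := fun y => c (f y)) hp hq hf
      ((hcd h1).comp x hf) hg h1 hg0 ?_ (by rwa [hgρ]) (by rwa [hgρ]) (by rwa [norm_mul, hgρ])
      (fun j => ?_) (by rwa [hgρ]))
    · exact (hcall (P := fun x => x ≠ 0)).2 ⟨ha0, neg_ne_zero.2 ha0, hbr, neg_ne_zero.2 hbr⟩
    · rw [mul_comm]
      exact norm_mul_lt_one (hgρ.trans_lt hρ1).le ((hcρ j).trans hρ1)
  have hJ : DifferentiableOn ℂ (fun r => (circle 0 ρ).integral fun z => z⁻¹ * betaK p q r (c r) z) U := by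
    refine Contour.differentiableOn_integral (circle 0 ρ) hUo
      (G := fun r z => z⁻¹ * betaK p q r (c r) z) (fun y hy => ?_) fun x hx r hr => ?_
    · exact (hK differentiableAt_fst differentiableAt_snd hy.1
        (himg hy.2)).continuousAt.continuousWithinAt
    · exact (hK differentiableAt_id (differentiableAt_const _) hr
        (himg (mem_image_of_mem _ hx))).differentiableWithinAt
  have hJc := (hJ.differentiableAt (hUo.mem_nhds hU1)).continuousAt
  have hof : Tendsto (fun r : ℝ => (r : ℂ)) (𝓝[<] 1) (𝓝 1) := by
    have : ContinuousAt (fun r : ℝ => (r : ℂ)) 1 := Complex.continuous_ofReal.continuousAt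
    have := this.tendsto
    rw [Complex.ofReal_one] at this
    exact this.mono_left nhdsWithin_le_nhds
  have hzero : (fun r : ℝ => (circle 0 ρ).integral fun z => z⁻¹ * betaK p q r (c r) z) =ᶠ[𝓝[<] 1]
      fun _ => 0 := by
    filter_upwards [hof (hUo.mem_nhds hU1), Ioo_mem_nhdsLT (zero_lt_one' ℝ), Ioo_mem_nhdsLT ha1]
      with r hrU hr hrs
    obtain ⟨h1, h2, h3, h4, h5⟩ := hU _ hrU
    have hrn : ‖(r : ℂ)‖ = r := by rw [Complex.norm_real, Real.norm_of_nonneg hr.1.le]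
    have hbr : b / r ≠ 0 := div_ne_zero hb0 h1
    have hc0 : ∀ j, c r j ≠ 0 :=
      (hcall (P := fun x => x ≠ 0)).2 ⟨ha0, neg_ne_zero.2 ha0, hbr, neg_ne_zero.2 hbr⟩
    have hcρ : ∀ j, ‖c r j‖ < ρ :=
      (hcall (P := fun x => ‖x‖ < ρ)).2 ⟨haρ, by rwa [norm_neg], h5, by rwa [norm_neg]⟩
    rw [circle_integral, circleIntegral_betaK hp hq hp0 hq0 hr.1 hr.2 hρ1 hpρ hqρ hc0 hcρ]
    have hI0 : Complex.I * r ≠ 0 := mul_ne_zero Complex.I_ne_zero h1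
    have hIr : ‖Complex.I * r‖ < 1 := by
      rw [norm_mul, Complex.norm_I, one_mul, hrn]
      exact hr.2
    rw [hcon (vec (Complex.I * r) (-(Complex.I * r)) (c r)), mul_zero]
    · exact (forall_vec (P := fun x => x ≠ 0 ∧ ‖x‖ < 1)).2 ⟨⟨hI0, hIr⟩,
        ⟨neg_ne_zero.2 hI0, by rwa [norm_neg]⟩, fun j => ⟨hc0 j, (hcρ j).trans hρ1⟩⟩
    · rw [prod_vec _ _ _ fun x => x, Fin.prod_univ_four]
      have e1 : b / (r : ℂ) * (Complex.I * r) = Complex.I * b := by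
        field_simp
      calc _ = (b / (r : ℂ) * (Complex.I * r)) ^ 2 * a ^ 2 * -1 := by simp [hc]; ring
        _ = p * q := by
          rw [e1, mul_pow, Complex.I_sq, hb, ha, ← hs]
          ring
    · refine ⟨4, 5, by decide, ?_⟩
      have e : vec (Complex.I * r) (-(Complex.I * r)) (c r) 4 *
          vec (Complex.I * r) (-(Complex.I * r)) (c r) 5 = b / r * -(b / r) := rfl
      rw [e, norm_mul, norm_neg, norm_div, hrn, div_mul_div_comm, ← sq, ← sq, hbn,
        div_lt_iff₀ (pow_pos hr.1 2), mul_comm]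
      refine mul_lt_mul_of_pos_left ?_ hq0'
      rw [← han]
      exact pow_lt_pow_left₀ hrs.1 (norm_nonneg a) two_ne_zero
  have hlim : (circle 0 ρ).integral (fun z => z⁻¹ * betaK p q 1 (c 1) z) = 0 :=
    tendsto_nhds_unique (hJc.tendsto.comp hof) (tendsto_const_nhds.congr' hzero.symm)
  rw [circle_integral] at hlim
  refine circleIntegral_betaK_one_ne_zero hp hq hp0 hq0 hρ1 hpρ hqρ ?_ ?_ hlim
  · exact (hcall (P := fun x => ‖x‖ < ρ)).2 ⟨haρ, by rwa [norm_neg], by rwa [div_one],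
      by rwa [norm_neg, div_one]⟩
  · exact (hcall (P := fun x => ‖p * q‖ < ‖x‖)).2 ⟨hpqa, by rwa [norm_neg], by rwa [div_one],
      by rwa [norm_neg, div_one]⟩

/-- The elliptic beta integral, for parameters two of which have a product smaller than `q`, up
to the value of the constant. -/
theorem exists_hypI_eq_mul_pairG (hp : ‖p‖ < 1) (hq : ‖q‖ < 1) (hp0 : p ≠ 0) (hq0 : q ≠ 0) :
    ∃ A : ℂ, A ≠ 0 ∧ ∀ t : Fin 6 → ℂ, Small t → ∏ j, t j = p * q →
      (∃ i j, i ≠ j ∧ ‖t i * t j‖ < ‖q‖) → hypI p q t = A * pairG p q t := by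
  obtain ⟨t₀, h1, h2, h3, h4⟩ := exists_hypI_ne_zero hp hq hp0 hq0
  refine ⟨betaF p q t₀, div_ne_zero h4 (h1.pairG_ne_zero hp hq h2), fun t g1 g2 g3 => ?_⟩
  rw [← betaF_eq_betaF hp hq hp0 hq0 g1 g2 g3 h1 h2 h3, betaF,
    div_mul_cancel₀ _ (g1.pairG_ne_zero hp hq g2)]

end EllipticHyp

end

/-! ### A double integral evaluated in two orders -/

noncomputable section

namespace EllipticHyp

open Filter Topology Set

variable {p q : ℂ} {J : Type}

/-! ### The first transformation for small parameters -/

theorem circleIntegral_swap {Φ : ℂ → ℂ → ℂ}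
    (hΦ : ContinuousOn (Function.uncurry Φ) (Metric.sphere 0 1 ×ˢ Metric.sphere 0 1)) :
    (∮ w in C(0, 1), w⁻¹ * ∮ z in C(0, 1), z⁻¹ * Φ z w) =
      ∮ z in C(0, 1), z⁻¹ * ∮ w in C(0, 1), w⁻¹ * Φ z w := by
  have hmem (θ : ℝ) : circleMap 0 1 θ ∈ Metric.sphere (0 : ℂ) 1 := circleMap_mem_sphere 0 zero_le_one θ
  have hc : Continuous fun y : ℝ × ℝ => Φ (circleMap 0 1 y.1) (circleMap 0 1 y.2) := by
    have h : Continuous fun y : ℝ × ℝ => (circleMap (0 : ℂ) 1 y.1, circleMap (0 : ℂ) 1 y.2) :=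
      ((continuous_circleMap 0 1).comp continuous_fst).prodMk
        ((continuous_circleMap 0 1).comp continuous_snd)
    exact hΦ.comp_continuous h fun y => ⟨hmem _, hmem _⟩
  simp only [circleIntegral_inv_mul _ one_ne_zero, intervalIntegral.integral_const_mul]
  congr 2
  have := MeasureTheory.intervalIntegral_intervalIntegral_swap (a := 0) (b := 2 * Real.pi) (c := 0)
    (d := 2 * Real.pi) (F := fun w z => Φ (circleMap 0 1 z) (circleMap 0 1 w)) ?_
  · exact this
  · exact ((hc.comp continuous_swap).continuousOn.integrableOn_compact
      (isCompact_uIcc.prod isCompact_uIcc)).mono_set (prod_mono uIoc_subset_uIcc uIoc_subset_uIcc)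

theorem prod_fin_eight (f : Fin 8 → ℂ) :
    ∏ j, f j = (∏ j : Fin 4, f (Fin.castAdd 4 j)) * ∏ j : Fin 4, f (Fin.natAdd 4 j) :=
  Fin.prod_univ_add (a := 4) (b := 4) f

theorem prod_pairs_fin_four (h : Fin 4 → Fin 4 → ℂ) :
    ∏ j, ∏ k ∈ Finset.Ioi j, h j k =
      h 0 1 * h 0 2 * h 0 3 * (h 1 2 * h 1 3) * h 2 3 := by
  rw [Fin.prod_univ_four, show Finset.Ioi (0 : Fin 4) = {1, 2, 3} by decide,
    show Finset.Ioi (1 : Fin 4) = {2, 3} by decide, show Finset.Ioi (2 : Fin 4) = {3} by decide,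
    show Finset.Ioi (3 : Fin 4) = ∅ by decide]
  simp [mul_assoc]

/-- For the four different indices i, j, k, l one has (m b_i)(m b_j) = pq / (b_k b_l), and the
reflection equation applies to each pair of complementary factors. -/
theorem pairG_const_mul (hp0 : p ≠ 0) (hq0 : q ≠ 0) {b : Fin 4 → ℂ} (hb : ∀ j, b j ≠ 0) {m : ℂ}
    (h : m ^ 2 * ∏ j, b j = p * q) : pairG p q (fun j => m * b j) = (pairG p q b)⁻¹ := by
  rw [Fin.prod_univ_four] at h
  have key (i j k l : Fin 4) (e : b i * b j * (b k * b l) = b 0 * b 1 * b 2 * b 3) :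
      Gam p q (m * b i * (m * b j)) = (Gam p q (b k * b l))⁻¹ := by
    rw [← Gam_reflect hp0 hq0]
    congr 1
    rw [eq_div_iff (mul_ne_zero (hb k) (hb l)), ← h, ← e]
    ring
  rw [pairG, pairG, prod_pairs_fin_four, prod_pairs_fin_four, key 0 1 2 3 (by ring),
    key 0 2 1 3 (by ring), key 0 3 1 2 (by ring), key 1 2 0 3 (by ring), key 1 3 0 2 (by ring),
    key 2 3 0 1 (by ring)]
  simp only [mul_inv]
  ring

/-- The kernel of the double integral. -/
def kernelF (p q l : ℂ) (a b : Fin 4 → ℂ) (z w : ℂ) : ℂ :=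
  hypF p q (vec (l * w) (l * w⁻¹) b) z * hypF p q a w

/-- The factors that couple z and w are Γ(l w^± z^±), with all four choices of signs. -/
theorem kernelF_symm (l : ℂ) (a b : Fin 4 → ℂ) (z w : ℂ) :
    kernelF p q l a b z w = kernelF p q l b a w z := by
  simp only [kernelF, hypF, prod_vec _ _ _ fun x => Gam p q (x * z) * Gam p q (x * z⁻¹),
    prod_vec _ _ _ fun x => Gam p q (x * w) * Gam p q (x * w⁻¹), mul_right_comm l w,
    mul_right_comm l w⁻¹]
  ring

theorem small_vec_of_norm_eq_one {l w : ℂ} {b : Fin 4 → ℂ} (hl0 : l ≠ 0) (hl : ‖l‖ < 1)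
    (hb : Small b) (hw : ‖w‖ = 1) : Small (vec (l * w) (l * w⁻¹) b) := by
  have hw0 : w ≠ 0 := norm_ne_zero_iff.1 (by rw [hw]; exact one_ne_zero)
  refine (forall_vec (P := fun x => x ≠ 0 ∧ ‖x‖ < 1)).2 ⟨⟨mul_ne_zero hl0 hw0, ?_⟩,
    ⟨mul_ne_zero hl0 (inv_ne_zero hw0), ?_⟩, hb⟩
  · rwa [norm_mul, hw, mul_one]
  · rwa [norm_mul, norm_inv, hw, inv_one, mul_one]

theorem continuousOn_kernelF (hp : ‖p‖ < 1) (hq : ‖q‖ < 1) {l : ℂ} (hl0 : l ≠ 0) (hl : ‖l‖ < 1)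
    {a b : Fin 4 → ℂ} (ha : Small a) (hb : Small b) :
    ContinuousOn (Function.uncurry (kernelF p q l a b))
      (Metric.sphere 0 1 ×ˢ Metric.sphere 0 1) := by
  rintro ⟨z, w⟩ ⟨hz, hw⟩
  have hz : ‖z‖ = 1 := by simpa using hz
  have hw : ‖w‖ = 1 := by simpa using hw
  have hw0 : w ≠ 0 := norm_ne_zero_iff.1 (by rw [hw]; exact one_ne_zero)
  refine ContinuousAt.continuousWithinAt (DifferentiableAt.continuousAt (𝕜 := ℂ)
    (DifferentiableAt.mul (hypF_differentiableAt (f := fun y : ℂ × ℂ => vec (l * y.2) (l * y.2⁻¹) b)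
    hp hq ?_ differentiableAt_fst ((small_vec_of_norm_eq_one hl0 hl hb hw).regular hp hq hz))
    (hypF_differentiableAt hp hq (differentiableAt_const a) differentiableAt_snd
      (ha.regular hp hq hw))))
  have h2 : DifferentiableAt ℂ (fun y : ℂ × ℂ => y.2) (z, w) := differentiableAt_snd
  refine differentiableAt_pi.2 fun j => ?_
  refine Fin.cases ?_ (fun j => Fin.cases ?_ (fun j => ?_) j) j
  · exact h2.const_mul l
  · exact (h2.inv hw0).const_mul l
  · exact differentiableAt_const _

/-- The parameters `(a, l b)`. -/
def vec8 (l : ℂ) (a b : Fin 4 → ℂ) : Fin 8 → ℂ := Fin.append (m := 4) (n := 4) a fun j => l * b j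

theorem vec8_castAdd (l : ℂ) (a b : Fin 4 → ℂ) (j : Fin 4) : vec8 l a b (Fin.castAdd 4 j) = a j :=
  Fin.append_left a _ j

theorem vec8_natAdd (l : ℂ) (a b : Fin 4 → ℂ) (j : Fin 4) :
    vec8 l a b (Fin.natAdd 4 j) = l * b j :=
  Fin.append_right a (fun j => l * b j) j

theorem Small.vec8 {l : ℂ} {a b : Fin 4 → ℂ} (hl0 : l ≠ 0) (hl : ‖l‖ < 1) (ha : Small a)
    (hb : Small b) : Small (vec8 l a b) := fun j => by
  refine Fin.addCases (m := 4) (n := 4) (motive := fun j => EllipticHyp.vec8 l a b j ≠ 0 ∧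
    ‖EllipticHyp.vec8 l a b j‖ < 1) (fun j => ?_) (fun j => ?_) j
  · rw [vec8_castAdd]
    exact ha j
  · rw [vec8_natAdd]
    exact ⟨mul_ne_zero hl0 (hb j).1, norm_mul_lt_one hl.le (hb j).2⟩

/-- The inner integral is an elliptic beta integral with the parameters lw, l/w and b, where |lw ·
l/w| = |l²| < |q|. The factors Γ(l b_j w^±) of its value extend the parameters a of the outer
integral by l b. -/
theorem circleIntegral_kernelF (hp : ‖p‖ < 1) (hq : ‖q‖ < 1) (hp0 : p ≠ 0) (hq0 : q ≠ 0) {A : ℂ}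
    (hA : ∀ t : Fin 6 → ℂ, Small t → ∏ j, t j = p * q →
      (∃ i j, i ≠ j ∧ ‖t i * t j‖ < ‖q‖) → hypI p q t = A * pairG p q t)
    {l : ℂ} (hl0 : l ≠ 0) (hl : ‖l‖ < 1) (hlq : ‖l ^ 2‖ < ‖q‖) {a b : Fin 4 → ℂ} (ha : Small a)
    (hb : Small b) (hbprod : l ^ 2 * ∏ j, b j = p * q) :
    (∮ w in C(0, 1), w⁻¹ * ∮ z in C(0, 1), z⁻¹ * kernelF p q l a b z w) =
      A * Gam p q (l ^ 2) * pairG p q b * hypI p q (vec8 l a b) := by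
  rw [(ha.vec8 hl0 hl hb).hypI_eq hp hq hp0 hq0, ← circleIntegral.integral_const_mul]
  refine circleIntegral.integral_congr zero_le_one fun w hw => ?_
  have hw : ‖w‖ = 1 := by simpa using hw
  have hw0 : w ≠ 0 := norm_ne_zero_iff.1 (by rw [hw]; exact one_ne_zero)
  have hs := small_vec_of_norm_eq_one hl0 hl hb hw
  have hll : l * w * (l * w⁻¹) = l ^ 2 := by field_simp
  have e1 : (∮ z in C(0, 1), z⁻¹ * kernelF p q l a b z w) =
      hypI p q (vec (l * w) (l * w⁻¹) b) * hypF p q a w := by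
    rw [hs.hypI_eq hp hq hp0 hq0, mul_comm _ (hypF p q a w), ← circleIntegral.integral_const_mul]
    refine circleIntegral.integral_congr zero_le_one fun z _ => ?_
    simp only [kernelF]
    ring
  have e2 : hypI p q (vec (l * w) (l * w⁻¹) b) = A * pairG p q (vec (l * w) (l * w⁻¹) b) := by
    refine hA _ hs ?_ ⟨0, 1, by decide, ?_⟩
    · rw [prod_vec _ _ _ fun x => x, hll, hbprod]
    · rw [show vec (l * w) (l * w⁻¹) b 0 * vec (l * w) (l * w⁻¹) b 1 = l * w * (l * w⁻¹) from rfl,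
        hll]
      exact hlq
  have e3 : hypF p q (vec8 l a b) w = hypF p q a w *
      ((∏ j, Gam p q (b j * (l * w))) * ∏ j, Gam p q (b j * (l * w⁻¹))) := by
    have h (x : ℂ) (j : Fin 4) : l * b j * x = b j * (l * x) := by ring
    rw [hypF, hypF, prod_fin_eight]
    simp only [vec8_castAdd, vec8_natAdd, Finset.prod_mul_distrib, h]
    ring
  simp only [e1, e2, e3, pairG_vec, hll]
  ring

/-- Fubini's theorem and the symmetry of the kernel. The common factor A Γ(l²) cancels, which
requires A ≠ 0. -/
theorem hypI_vec8 (hp : ‖p‖ < 1) (hq : ‖q‖ < 1) (hp0 : p ≠ 0) (hq0 : q ≠ 0)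
    {l : ℂ} (hl0 : l ≠ 0) (hl : ‖l‖ < 1) (hlq : ‖l ^ 2‖ < ‖q‖) {a b : Fin 4 → ℂ} (ha : Small a)
    (hb : Small b) (haprod : l ^ 2 * ∏ j, a j = p * q) (hbprod : l ^ 2 * ∏ j, b j = p * q) :
    pairG p q b * hypI p q (vec8 l a b) = pairG p q a * hypI p q (vec8 l b a) := by
  obtain ⟨A, hA0, hA⟩ := exists_hypI_eq_mul_pairG hp hq hp0 hq0
  have h1 := circleIntegral_kernelF hp hq hp0 hq0 hA hl0 hl hlq ha hb hbprod
  have h2 := circleIntegral_kernelF hp hq hp0 hq0 hA hl0 hl hlq hb ha haprod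
  have h3 : Gam p q (l ^ 2) ≠ 0 := by
    refine Gam_ne_zero hp hq (hlq.trans hq) ?_
    rw [← haprod, norm_mul]
    refine mul_lt_of_lt_one_right (norm_pos_iff.2 (pow_ne_zero 2 hl0)) ?_
    rw [Fin.prod_univ_succ]
    exact (mul_comm (a 0) _ ▸ norm_mul_lt_one (norm_prod_le_one _ fun j _ => (ha _).2.le) (ha 0).2)
  rw [circleIntegral_swap (continuousOn_kernelF hp hq hl0 hl ha hb)] at h1
  simp only [kernelF_symm l a b] at h1
  rw [h1] at h2
  refine mul_left_cancel₀ (mul_ne_zero hA0 h3) ?_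
  linear_combination h2

/-- The factor in the first transformation. -/
def blockG (p q : ℂ) (t : Fin 8 → ℂ) : ℂ :=
  ∏ j : Fin 4, ∏ k ∈ Finset.Ioi j, Gam p q (t (Fin.castAdd 4 j) * t (Fin.castAdd 4 k)) *
    Gam p q (t (Fin.natAdd 4 j) * t (Fin.natAdd 4 k))

theorem blockG_eq (t : Fin 8 → ℂ) : blockG p q t =
    pairG p q (fun j : Fin 4 => t (Fin.castAdd 4 j)) *
      pairG p q (fun j : Fin 4 => t (Fin.natAdd 4 j)) := by
  simp only [blockG, pairG, Finset.prod_mul_distrib]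

theorem shift_castAdd (ε : ℂ) (t : Fin 8 → ℂ) (j : Fin 4) :
    shift ε t (Fin.castAdd 4 j) = ε⁻¹ * t (Fin.castAdd 4 j) := by
  simp [shift]

theorem shift_natAdd (ε : ℂ) (t : Fin 8 → ℂ) (j : Fin 4) :
    shift ε t (Fin.natAdd 4 j) = ε * t (Fin.natAdd 4 j) := by
  simp [shift]

theorem ext_fin_eight {t s : Fin 8 → ℂ} (h1 : ∀ j : Fin 4, t (Fin.castAdd 4 j) = s (Fin.castAdd 4 j))
    (h2 : ∀ j : Fin 4, t (Fin.natAdd 4 j) = s (Fin.natAdd 4 j)) : t = s :=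
  funext fun j => Fin.addCases (m := 4) (n := 4) (motive := fun j => t j = s j) h1 h2 j

/-- With l = ε⁻¹ the parameters are (a, l b), and the transformed ones (l a, b) are a permutation of
(b, l a). So this is `hypI_vec8`, together with the reflection equation for the block l b. -/
theorem hypI_shift_of_small (hp : ‖p‖ < 1) (hq : ‖q‖ < 1) (hp0 : p ≠ 0) (hq0 : q ≠ 0)
    {t : Fin 8 → ℂ} {ε : ℂ} (hε0 : ε ≠ 0) (hε : 1 < ‖ε‖) (hεq : 1 < ‖ε ^ 2 * q‖)
    (ha : Small fun j : Fin 4 => t (Fin.castAdd 4 j))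
    (hb : Small fun j : Fin 4 => ε * t (Fin.natAdd 4 j))
    (haprod : ∏ j : Fin 4, t (Fin.castAdd 4 j) = ε ^ 2 * (p * q))
    (hbprod : ε ^ 2 * ∏ j : Fin 4, t (Fin.natAdd 4 j) = p * q) :
    hypI p q t = blockG p q t * hypI p q (shift ε t) := by
  set a : Fin 4 → ℂ := fun j => t (Fin.castAdd 4 j) with ha'
  set b : Fin 4 → ℂ := fun j => ε * t (Fin.natAdd 4 j) with hb'
  have hε2 : 0 < ‖ε ^ 2‖ := norm_pos_iff.2 (pow_ne_zero 2 hε0)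
  have e1 : t = vec8 ε⁻¹ a b := ext_fin_eight (fun j => (vec8_castAdd ε⁻¹ a b j).symm) fun j => by
    rw [vec8_natAdd, hb', inv_mul_cancel_left₀ hε0]
  have e2 : (fun j => shift ε t (finAddFlip (m := 4) (n := 4) j)) = vec8 ε⁻¹ b a :=
    ext_fin_eight (fun j => by
      rw [finAddFlip_apply_castAdd, vec8_castAdd]
      exact shift_natAdd ε t j) fun j => by
      rw [finAddFlip_apply_natAdd, vec8_natAdd]
      exact shift_castAdd ε t j
  have hB : ∏ j, b j = ε ^ 4 * ∏ j : Fin 4, t (Fin.natAdd 4 j) := by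
    rw [hb', Finset.prod_mul_distrib, Finset.prod_const]
    simp
  have hB' : ε⁻¹ ^ 2 * ∏ j, b j = p * q := by
    rw [hB, ← hbprod]
    field_simp
  have key := hypI_vec8 hp hq hp0 hq0 (inv_ne_zero hε0) (by
    rw [norm_inv]
    exact inv_lt_one_of_one_lt₀ hε) (by
    rw [norm_mul] at hεq
    rw [inv_pow, norm_inv, inv_lt_iff_one_lt_mul₀ hε2, mul_comm]
    exact hεq) ha hb (by rw [haprod]; field_simp) hB'
  rw [← e1, ← e2, hypI_comp_equiv hp hq] at key
  have hbG : pairG p q b ≠ 0 := by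
    have hε' : ε⁻¹ ≠ 0 ∧ ‖ε⁻¹‖ < 1 :=
      ⟨inv_ne_zero hε0, by rw [norm_inv]; exact inv_lt_one_of_one_lt₀ hε⟩
    -- The four parameters b are completed to six small ones with product pq, so that
    -- `Small.pairG_ne_zero` applies.
    have hs : Small (vec ε⁻¹ ε⁻¹ b) :=
      (forall_vec (P := fun x => x ≠ 0 ∧ ‖x‖ < 1)).2 ⟨hε', hε', hb⟩
    have h := hs.pairG_ne_zero hp hq (by rw [prod_vec _ _ _ fun x => x, ← sq, hB'])
    rw [pairG_vec] at h
    exact right_ne_zero_of_mul h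
  have hG : pairG p q (fun j : Fin 4 => t (Fin.natAdd 4 j)) = (pairG p q b)⁻¹ := by
    have h : (fun j : Fin 4 => t (Fin.natAdd 4 j)) = fun j => ε⁻¹ * b j :=
      funext fun j => by rw [hb', inv_mul_cancel_left₀ hε0]
    rw [h]
    exact pairG_const_mul hp0 hq0 (fun j => (hb j).1) hB'
  rw [blockG_eq, hG]
  field_simp
  linear_combination key

end EllipticHyp

end

/-! ### Analytic continuation of the first transformation -/

noncomputable section

namespace EllipticHyp

open Filter Topology Set

variable {p q : ℂ} {J : Type}

/-! ### Exponential curves of parameters -/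

/-- The curve of parameters through `t` with direction `d`. -/
def tpath (t d : J → ℂ) (u : ℂ) (j : J) : ℂ := t j * Complex.exp (u * d j)

theorem tpath_zero (t d : J → ℂ) : tpath t d 0 = t := funext fun j => by simp [tpath]

theorem tpath_ne_zero {t d : J → ℂ} (ht : ∀ j, t j ≠ 0) (u : ℂ) (j : J) : tpath t d u j ≠ 0 :=
  mul_ne_zero (ht j) (Complex.exp_ne_zero _)

theorem tpath_mul_tpath (t d : J → ℂ) (u : ℂ) (j k : J) :
    tpath t d u j * tpath t d u k = t j * t k * Complex.exp (u * (d j + d k)) := by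
  rw [tpath, tpath, mul_add, Complex.exp_add]
  ring

theorem differentiable_tpath [Fintype J] (t d : J → ℂ) : Differentiable ℂ (tpath t d) :=
  differentiable_pi.2 fun j => by
    unfold tpath
    fun_prop

theorem countable_setOf_mul_exp_eq {x d : ℂ} (hx : x ≠ 0) (hd : d ≠ 0) (w : ℂ) :
    {u : ℂ | x * Complex.exp (u * d) = w}.Countable := by
  rcases eq_empty_or_nonempty {u : ℂ | x * Complex.exp (u * d) = w} with h | ⟨u₀, h₀⟩
  · rw [h]
    exact countable_empty
  · refine (countable_range fun n : ℤ => u₀ + n * (2 * Real.pi * Complex.I) / d).mono fun u hu => ?_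
    have h : Complex.exp (u * d) = Complex.exp (u₀ * d) :=
      mul_left_cancel₀ hx (hu.trans h₀.symm)
    obtain ⟨n, hn⟩ := Complex.exp_eq_exp_iff_exists_int.1 h
    refine ⟨n, ?_⟩
    simp only
    field_simp
    linear_combination -hn

theorem countable_setOf_E_eq_zero (hp : ‖p‖ < 1) (hq : ‖q‖ < 1) {x d : ℂ} (hx : x ≠ 0) (h : d ≠ 0 ∨ E p q x ≠ 0) :
    {u : ℂ | E p q (x * Complex.exp (u * d)) = 0}.Countable := by
  rcases eq_or_ne d 0 with rfl | hd
  · have : {u : ℂ | E p q (x * Complex.exp (u * 0)) = 0} = ∅ := by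
      simpa [eq_empty_iff_forall_notMem] using h
    rw [this]
    exact countable_empty
  · have : {u : ℂ | E p q (x * Complex.exp (u * d)) = 0} ⊆
        ⋃ n : ℕ × ℕ, {u : ℂ | x * Complex.exp (u * d) = (p ^ n.1 * q ^ n.2)⁻¹} := by
      intro u hu
      obtain ⟨a, b, hab⟩ := (E_eq_zero_iff hp hq _).1 hu
      rw [mul_assoc] at hab
      exact mem_iUnion.2 ⟨(a, b), eq_inv_of_mul_eq_one_left hab⟩
    exact (countable_iUnion fun n => countable_setOf_mul_exp_eq hx hd _).mono this

/-- Along the curve t_j t_k is multiplied by exp(u (d_j + d_k)). Each of countably many equations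
thus has countably many solutions u, unless d_j + d_k = 0, when the product is constant and harmless
by assumption. -/
theorem countable_not_admissible [Fintype J] (hp : ‖p‖ < 1) (hq : ‖q‖ < 1) (hp0 : p ≠ 0)
    (hq0 : q ≠ 0) {t d : J → ℂ} (ht : ∀ j, t j ≠ 0)
    (h : ∀ j k, d j + d k ≠ 0 ∨ E p q (t j * t k) ≠ 0) :
    {u | ¬ Admissible p q (tpath t d u)}.Countable := by
  have : {u | ¬ Admissible p q (tpath t d u)} ⊆
      ⋃ i : J × J, {u : ℂ | E p q (t i.1 * t i.2 * Complex.exp (u * (d i.1 + d i.2))) = 0} := by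
    intro u hu
    rw [mem_ofPred_eq, admissible_iff hp hq hp0 hq0, not_and] at hu
    have := hu (tpath_ne_zero ht u)
    push Not at this
    obtain ⟨j, k, hjk⟩ := this
    rw [tpath_mul_tpath] at hjk
    exact mem_iUnion.2 ⟨(j, k), hjk⟩
  exact (countable_iUnion fun i => countable_setOf_E_eq_zero hp hq
    (mul_ne_zero (ht _) (ht _)) (h _ _)).mono this

theorem isOpen_setOf_admissible [Fintype J] (hp : ‖p‖ < 1) (hq : ‖q‖ < 1) (hp0 : p ≠ 0)
    (hq0 : q ≠ 0) (t d : J → ℂ) : IsOpen {u | Admissible p q (tpath t d u)} :=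
  isOpen_iff_eventually.2 fun _ hu => (differentiable_tpath t d).continuous.continuousAt.eventually
    (Admissible.eventually hp hq hp0 hq0 hu)

theorem differentiableAt_hypI_tpath [Fintype J] (hp : ‖p‖ < 1) (hq : ‖q‖ < 1) (hp0 : p ≠ 0)
    (hq0 : q ≠ 0) {t d : J → ℂ} {u : ℂ} (h : Admissible p q (tpath t d u)) :
    DifferentiableAt ℂ (fun u => hypI p q (tpath t d u)) u :=
  hypI_differentiableAt hp hq hp0 hq0 (.of_forall fun u => differentiable_tpath t d u) h

theorem pairG_differentiableAt (hp : ‖p‖ < 1) (hq : ‖q‖ < 1) {n : ℕ} {t : ℂ → Fin n → ℂ} {u : ℂ}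
    (ht : DifferentiableAt ℂ t u) (h0 : ∀ j, t u j ≠ 0)
    (h : ∀ j k, j < k → E p q (t u j * t u k) ≠ 0) :
    DifferentiableAt ℂ (fun u => pairG p q (t u)) u :=
  differentiableAt_prod _ fun j _ => differentiableAt_prod _ fun k hk =>
    (Gam_differentiableAt hp hq (mul_ne_zero (h0 j) (h0 k)) (h j k (Finset.mem_Ioi.1 hk))).comp
      (f := fun u => t u j * t u k) u ((differentiableAt_pi.1 ht j).mul (differentiableAt_pi.1 ht k))

theorem blockG_differentiableAt (hp : ‖p‖ < 1) (hq : ‖q‖ < 1) {t : ℂ → Fin 8 → ℂ} {u : ℂ}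
    (ht : DifferentiableAt ℂ t u) (h0 : ∀ j, t u j ≠ 0)
    (h : ∀ j k, j < k → E p q (t u j * t u k) ≠ 0) :
    DifferentiableAt ℂ (fun u => blockG p q (t u)) u := by
  simp only [blockG_eq]
  have htj := differentiableAt_pi.1 ht
  have h1 := pairG_differentiableAt hp hq (t := fun u (j : Fin 4) => t u (Fin.castAdd 4 j))
    (differentiableAt_pi.2 fun j => htj _) (fun j => h0 _) fun j k hjk => h _ _ hjk
  have h2 := pairG_differentiableAt hp hq (t := fun u (j : Fin 4) => t u (Fin.natAdd 4 j))
    (differentiableAt_pi.2 fun j => htj _) (fun j => h0 _) fun j k hjk => h _ _ (Nat.add_lt_add_left hjk 4)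
  exact h1.mul h2

/-! ### The first transformation -/

/-- One of the logarithms is adjusted, so that the sum is S itself and not only S modulo 2πi. -/
theorem exists_log_sum_eq {n : ℕ} {f : Fin (n + 1) → ℂ} {S : ℂ} (hS : Complex.exp S = ∏ j, f j) :
    ∃ a : Fin (n + 1) → ℂ, (∀ j, Complex.exp (a j) = f j) ∧ ∑ j, a j = S := by
  have hf (j) : f j ≠ 0 := fun h =>
    Complex.exp_ne_zero S (hS.trans (Finset.prod_eq_zero (Finset.mem_univ j) h))
  have hsum : ∑ j : Fin (n + 1), (Fin.cons (S - ∑ j : Fin n, Complex.log (f j.succ))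
      fun j => Complex.log (f j.succ) : Fin (n + 1) → ℂ) j = S := by
    rw [Fin.sum_univ_succ]
    simp
  refine ⟨_, fun j => Fin.cases ?_ (fun j => ?_) j, hsum⟩
  · rw [Fin.cons_zero, Complex.exp_sub, Complex.exp_sum, hS, Fin.prod_univ_succ]
    simp only [Complex.exp_log (hf _)]
    exact mul_div_cancel_right₀ _ (Finset.prod_ne_zero_iff.2 fun j _ => hf _)
  · rw [Fin.cons_succ, Complex.exp_log (hf _)]

theorem shift_tpath {t d : Fin 8 → ℂ} {ε m u : ℂ} :
    shift (ε * Complex.exp (u * m)) (tpath t d u) =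
      tpath (shift ε t) (fun j => if j.val < 4 then d j - m else d j + m) u := by
  funext j
  by_cases hj : j.val < 4
  · simp only [shift, tpath, if_pos hj, mul_inv, ← Complex.exp_neg]
    rw [show u * (d j - m) = -(u * m) + u * d j by ring, Complex.exp_add]
    ring
  · simp only [shift, tpath, if_neg hj]
    rw [mul_add, Complex.exp_add]
    ring

/-- The first transformation. -/
theorem hypI_shift (hp : ‖p‖ < 1) (hq : ‖q‖ < 1) (hp0 : p ≠ 0) (hq0 : q ≠ 0)
    {t : Fin 8 → ℂ} {ε : ℂ} (hprod : ∏ j, t j = p ^ 2 * q ^ 2)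
    (hε : ε ^ 2 = t 0 * t 1 * t 2 * t 3 / (p * q)) (ht : Admissible p q t)
    (hs : Admissible p q (shift ε t)) :
    hypI p q t = blockG p q t * hypI p q (shift ε t) := by
  have hpq : p * q ≠ 0 := mul_ne_zero hp0 hq0
  have ht0 := ((admissible_iff hp hq hp0 hq0).1 ht).1
  have hprod1 : ∏ j : Fin 4, t (Fin.castAdd 4 j) = ε ^ 2 * (p * q) := by
    rw [hε, div_mul_cancel₀ _ hpq, Fin.prod_univ_four]
    rfl
  have hε0 : ε ≠ 0 := by
    rintro rfl
    refine Finset.prod_ne_zero_iff.2 (fun j _ => ht0 _) (hprod1.trans ?_)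
    simp
  have hprod2 : ε ^ 2 * ∏ j : Fin 4, t (Fin.natAdd 4 j) = p * q := by
    rw [prod_fin_eight, hprod1] at hprod
    refine mul_left_cancel₀ hpq ?_
    linear_combination hprod
  obtain ⟨lp, hlp⟩ : ∃ l, Complex.exp l = p := ⟨_, Complex.exp_log hp0⟩
  obtain ⟨lq, hlq⟩ : ∃ l, Complex.exp l = q := ⟨_, Complex.exp_log hq0⟩
  obtain ⟨le, hle⟩ : ∃ l, Complex.exp l = ε := ⟨_, Complex.exp_log hε0⟩
  have hS : Complex.exp (lp + lq + 2 * le) = ε ^ 2 * (p * q) := by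
    rw [Complex.exp_add, Complex.exp_add, hlp, hlq, two_mul, Complex.exp_add, hle]
    ring
  -- The logarithms of both blocks have exactly the required sums. The balancing conditions are
  -- linear in the logarithms, hence persist along the segment from the base point to t.
  obtain ⟨a, ha, has⟩ := exists_log_sum_eq (hS.trans hprod1.symm)
  obtain ⟨b, hb, hbs⟩ := exists_log_sum_eq (f := fun j : Fin 4 => ε * t (Fin.natAdd 4 j))
    (S := lp + lq + 2 * le) (by
      rw [hS, ← hprod2, Finset.prod_mul_distrib, Finset.prod_const]
      simp only [Finset.card_univ, Fintype.card_fin]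
      ring)
  have hpn : lp.re < 0 := by
    have := hp
    rwa [← hlp, Complex.norm_exp, Real.exp_lt_one_iff] at this
  have hqn : lq.re < 0 := by
    have := hq
    rwa [← hlq, Complex.norm_exp, Real.exp_lt_one_iff] at this
  -- the base point
  set e₀ : ℂ := -(lp / 4 + lq / 2) with he₀
  -- Formally ε₀ = p^(-1/4) q^(-1/2), and t₀ has the components p^(1/8) and p^(1/8)/ε₀, which its
  -- shift exchanges. All of them are small, |ε₀| > 1, and |ε₀² q| = |p|^(-1/2) > 1, so
  -- `hypI_shift_of_small` holds near u = 0.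
  set ε₀ : ℂ := Complex.exp e₀ with hε₀
  set t₀ : Fin 8 → ℂ := Fin.append (m := 4) (n := 4) (fun _ => Complex.exp (lp / 8))
    fun _ => Complex.exp (lp / 8 - e₀) with ht₀
  set d : Fin 8 → ℂ := Fin.append (m := 4) (n := 4) (fun j => a j - lp / 8)
    fun j => b j - le - (lp / 8 - e₀) with hd
  have htu1 (u : ℂ) (j : Fin 4) : tpath t₀ d u (Fin.castAdd 4 j) =
      Complex.exp (lp / 8 + u * (a j - lp / 8)) := by
    have h1 : t₀ (Fin.castAdd 4 j) = Complex.exp (lp / 8) := Fin.append_left _ _ j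
    have h2 : d (Fin.castAdd 4 j) = a j - lp / 8 := Fin.append_left _ _ j
    rw [tpath, h1, h2, Complex.exp_add]
  have htu2 (u : ℂ) (j : Fin 4) : tpath t₀ d u (Fin.natAdd 4 j) =
      Complex.exp (lp / 8 - e₀ + u * (b j - le - (lp / 8 - e₀))) := by
    have h1 : t₀ (Fin.natAdd 4 j) = Complex.exp (lp / 8 - e₀) := Fin.append_right _ _ j
    have h2 : d (Fin.natAdd 4 j) = b j - le - (lp / 8 - e₀) := Fin.append_right _ _ j
    rw [tpath, h1, h2, Complex.exp_add]
  have ht1 : tpath t₀ d 1 = t := ext_fin_eight (fun j => by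
    rw [htu1, one_mul, add_sub_cancel, ha]) fun j => by
    rw [htu2, one_mul, add_sub_cancel, Complex.exp_sub, hb, hle, mul_div_cancel_left₀ _ hε0]
  set f : ℂ → ℂ := fun u => ε₀ * Complex.exp (u * (le - e₀)) with hf
  have hfu (u : ℂ) : f u = Complex.exp (e₀ + u * (le - e₀)) := by rw [hf, Complex.exp_add]
  have hf1 : f 1 = ε := by rw [hfu, one_mul, add_sub_cancel, hle]
  have hre (u : ℂ) (j : Fin 4) : f u * tpath t₀ d u (Fin.natAdd 4 j) =
      Complex.exp (lp / 8 + u * (b j - lp / 8)) := by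
    rw [hfu, htu2, ← Complex.exp_add]
    ring_nf
  set d' : Fin 8 → ℂ := fun j => if j.val < 4 then d j - (le - e₀) else d j + (le - e₀) with hd'
  have hshift (u : ℂ) : shift (f u) (tpath t₀ d u) = tpath (shift ε₀ t₀) d' u := shift_tpath
  have he₀re : e₀.re = -(lp.re / 4 + lq.re / 2) := by
    rw [he₀]
    simp
  have hnear {g : ℂ → ℂ} (hg : Continuous g) (h0 : (g 0).re < 0) :
      ∀ᶠ u in 𝓝 0, ‖Complex.exp (g u)‖ < 1 := by
    have : ∀ᶠ u in 𝓝 0, (g u).re < 0 :=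
      (Complex.continuous_re.comp hg).continuousAt.eventually_lt continuousAt_const h0
    filter_upwards [this] with u hu
    rwa [Complex.norm_exp, Real.exp_lt_one_iff]
  have hnear' {g : ℂ → ℂ} (hg : Continuous g) (h0 : 0 < (g 0).re) :
      ∀ᶠ u in 𝓝 0, 1 < ‖Complex.exp (g u)‖ := by
    have : ∀ᶠ u in 𝓝 0, 0 < (g u).re :=
      continuousAt_const.eventually_lt (Complex.continuous_re.comp hg).continuousAt h0
    filter_upwards [this] with u hu
    rwa [Complex.norm_exp, Real.one_lt_exp_iff]
  have hexp {z : ℂ} (hz : z.re < 0) : Complex.exp z ≠ 0 ∧ ‖Complex.exp z‖ < 1 :=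
    ⟨Complex.exp_ne_zero z, by rwa [Complex.norm_exp, Real.exp_lt_one_iff]⟩
  have hsmall : Small t₀ := fun j => by
    refine Fin.addCases (m := 4) (n := 4) (motive := fun j => t₀ j ≠ 0 ∧ ‖t₀ j‖ < 1) (fun j => ?_)
      (fun j => ?_) j
    · rw [ht₀, Fin.append_left]
      exact hexp (by simp; linarith)
    · rw [ht₀, Fin.append_right]
      exact hexp (by simp [he₀re]; linarith)
  have ht00 (j : Fin 8) : t₀ j ≠ 0 := (hsmall j).1
  have hsmall' : Small (shift ε₀ t₀) := fun j => by
    refine Fin.addCases (m := 4) (n := 4) (motive := fun j => shift ε₀ t₀ j ≠ 0 ∧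
      ‖shift ε₀ t₀ j‖ < 1) (fun j => ?_) (fun j => ?_) j
    · rw [shift_castAdd, ht₀, Fin.append_left, hε₀, ← Complex.exp_neg, ← Complex.exp_add]
      exact hexp (by simp [he₀re]; linarith)
    · rw [shift_natAdd, ht₀, Fin.append_right, hε₀, ← Complex.exp_add]
      exact hexp (by simp; linarith)
  have hbase {t : Fin 8 → ℂ} (ht : Small t) (j k : Fin 8) : E p q (t j * t k) ≠ 0 :=
    E_ne_zero hp hq (norm_mul_lt_one (ht j).2.le (ht k).2)
  have hloc : ∀ᶠ u in 𝓝 0, hypI p q (tpath t₀ d u) =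
      blockG p q (tpath t₀ d u) * hypI p q (tpath (shift ε₀ t₀) d' u) := by
    have hA : ∀ᶠ u in 𝓝 0, ∀ j : Fin 4, ‖tpath t₀ d u (Fin.castAdd 4 j)‖ < 1 := by
      refine eventually_all.2 fun j => ?_
      simp only [htu1]
      exact hnear (by fun_prop) (by simp; linarith)
    have hB : ∀ᶠ u in 𝓝 0, ∀ j : Fin 4, ‖f u * tpath t₀ d u (Fin.natAdd 4 j)‖ < 1 := by
      refine eventually_all.2 fun j => ?_
      simp only [hre]
      exact hnear (by fun_prop) (by simp; linarith)
    have hC : ∀ᶠ u in 𝓝 0, 1 < ‖f u‖ := by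
      simp only [hfu]
      exact hnear' (by fun_prop) (by simp [he₀re]; linarith)
    have hD : ∀ᶠ u in 𝓝 0, 1 < ‖f u ^ 2 * q‖ := by
      simp only [hfu, ← hlq, sq, ← Complex.exp_add]
      exact hnear' (by fun_prop) (by simp [he₀re]; linarith)
    filter_upwards [hA, hB, hC, hD] with u h1 h2 h3 h4
    rw [← hshift]
    have hf0 : f u ≠ 0 := by
      rw [hfu]
      exact Complex.exp_ne_zero _
    have h0 := tpath_ne_zero (d := d) ht00 u
    refine hypI_shift_of_small hp hq hp0 hq0 hf0 h3 h4 (fun j => ⟨h0 _, h1 j⟩)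
      (fun j => ⟨mul_ne_zero hf0 (h0 _), h2 j⟩) ?_ ?_
    · simp only [htu1, hfu, ← hlp, ← hlq, sq, ← Complex.exp_add, ← Complex.exp_sum]
      congr 1
      simp only [Finset.sum_add_distrib, ← Finset.mul_sum, Finset.sum_sub_distrib, has,
        Finset.sum_const, Finset.card_univ, Fintype.card_fin, nsmul_eq_mul, he₀]
      push_cast
      ring
    · simp only [htu2, hfu, ← hlp, ← hlq, sq, ← Complex.exp_add, ← Complex.exp_sum]
      congr 1
      simp only [Finset.sum_add_distrib, ← Finset.mul_sum, Finset.sum_sub_distrib, hbs,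
        Finset.sum_const, Finset.card_univ, Fintype.card_fin, nsmul_eq_mul, he₀]
      push_cast
      ring
  set U : Set ℂ := {u | Admissible p q (tpath t₀ d u)} ∩
    {u | Admissible p q (tpath (shift ε₀ t₀) d' u)} with hU
  have hUo : IsOpen U := (isOpen_setOf_admissible hp hq hp0 hq0 _ _).inter
    (isOpen_setOf_admissible hp hq hp0 hq0 _ _)
  -- A countable set does not disconnect the complex plane, so the identity theorem leads from u = 0
  -- to u = 1.
  have hUc : IsPreconnected U := by
    have h : Uᶜ.Countable := by
      rw [hU, compl_inter]
      exact (countable_not_admissible hp hq hp0 hq0 (fun j => (hsmall j).1)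
        fun j k => Or.inr (hbase hsmall j k)).union (countable_not_admissible hp hq hp0 hq0
        (fun j => (hsmall' j).1) fun j k => Or.inr (hbase hsmall' j k))
    have := (h.isConnected_compl_of_one_lt_rank (by simp)).isPreconnected
    rwa [compl_compl] at this
  have h1 : DifferentiableOn ℂ (fun u => hypI p q (tpath t₀ d u)) U := fun u hu =>
    (differentiableAt_hypI_tpath hp hq hp0 hq0 hu.1).differentiableWithinAt
  have h2 : DifferentiableOn ℂ (fun u => blockG p q (tpath t₀ d u) *
      hypI p q (tpath (shift ε₀ t₀) d' u)) U := fun u hu => by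
    obtain ⟨g0, g1⟩ := (admissible_iff hp hq hp0 hq0).1 hu.1
    exact ((blockG_differentiableAt hp hq (differentiable_tpath t₀ d u) g0
      fun j k _ => g1 j k).mul
      (differentiableAt_hypI_tpath hp hq hp0 hq0 hu.2)).differentiableWithinAt
  have h0U : (0 : ℂ) ∈ U := by
    refine ⟨?_, ?_⟩
    · rw [mem_ofPred_eq, tpath_zero]
      exact hsmall.admissible hp hq hp0 hq0
    · rw [mem_ofPred_eq, tpath_zero]
      exact hsmall'.admissible hp hq hp0 hq0
  have h1U : (1 : ℂ) ∈ U := by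
    refine ⟨?_, ?_⟩
    · rwa [mem_ofPred_eq, ht1]
    · rwa [mem_ofPred_eq, ← hshift, ht1, hf1]
  have key := (h1.analyticOnNhd hUo).eqOn_of_preconnected_of_eventuallyEq (h2.analyticOnNhd hUo)
    hUc h0U hloc h1U
  simp only [← hshift, ht1, hf1] at key
  exact key

end EllipticHyp

end

/-! ### Action of the reflection and the permutations on parameters -/

noncomputable section

namespace EllipticHyp

open Filter Topology Set

variable {p q : ℂ} {J : Type}

/-! ### Coordinates on the space of parameters -/

theorem inner_Y (x y : Y) : inner ℝ x y = ∑ j, x.1 j * y.1 j := by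
  rw [Submodule.coe_inner, PiLp.inner_apply]
  simp [mul_comm]

theorem refl_eq (x : Y) : refl x = x - (inner ℝ vVec x) • vVec := by
  have h : ‖vVec‖ ^ 2 = 2 := by
    rw [← real_inner_self_eq_norm_sq, inner_Y, Fin.sum_univ_eight]
    simp [vVec]
    norm_num
  change ((ℝ ∙ vVec)ᗮ).reflection x = _
  rw [Submodule.reflection_orthogonal_apply, Submodule.reflection_singleton_apply]
  simp only [RCLike.ofReal_real_eq_id, id]
  rw [h]
  module

theorem sum_Y (x : Y) : x.1 0 + x.1 1 + x.1 2 + x.1 3 + x.1 4 + x.1 5 + x.1 6 + x.1 7 = 0 := by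
  have h : ∑ j, x.1 j = 0 := x.2
  rwa [Fin.sum_univ_eight] at h

theorem refl_apply (x : Y) (j : Fin 8) : (refl x).1 j =
    if j.val < 4 then x.1 j - (x.1 0 + x.1 1 + x.1 2 + x.1 3) / 2
    else x.1 j + (x.1 0 + x.1 1 + x.1 2 + x.1 3) / 2 := by
  have h := sum_Y x
  have h2 : inner ℝ vVec x = -(x.1 0 + x.1 1 + x.1 2 + x.1 3) := by
    rw [inner_Y, Fin.sum_univ_eight]
    simp [vVec]
    linarith
  rw [refl_eq, h2]
  by_cases hj : j.val < 4
  · simp [vVec, hj]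
    ring
  · simp [vVec, hj]
    ring

theorem prod_param (c : ℂ) (a b : Y) : ∏ j, param c a b j = c ^ 8 := by
  have ha := sum_Y a
  have hb := sum_Y b
  have ha' := congrArg (fun x : ℝ => (x : ℂ)) ha
  have hb' := congrArg (fun x : ℝ => (x : ℂ)) hb
  push_cast at ha' hb'
  simp only [param, Finset.prod_mul_distrib, ← Complex.exp_sum, ← Finset.mul_sum]
  rw [Fin.sum_univ_eight, show _ + _ = (0 : ℂ) by linear_combination ha' + Complex.I * hb']
  simp

theorem param_ne_zero {c : ℂ} (hc : c ≠ 0) (a b : Y) (j : Fin 8) : param c a b j ≠ 0 :=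
  mul_ne_zero hc (Complex.exp_ne_zero _)

theorem exists_param_eq {c : ℂ} (hc : c ≠ 0) {t : Fin 8 → ℂ} (ht : ∏ j, t j = c ^ 8) :
    ∃ a b : Y, t = param c a b := by
  obtain ⟨α, hα, hαs⟩ := exists_log_sum_eq (n := 7) (f := fun j => t j / c) (S := 0) (by
    rw [Finset.prod_div_distrib, ht, Finset.prod_const]
    simp [hc])
  set β : Fin 8 → ℂ := fun j => α j / (2 * Real.pi * Complex.I) with hβ
  have hβs : ∑ j, β j = 0 := by rw [hβ, ← Finset.sum_div, hαs, zero_div]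
  refine ⟨⟨WithLp.toLp 2 fun j => (β j).re, ?_⟩, ⟨WithLp.toLp 2 fun j => (β j).im, ?_⟩, ?_⟩
  · change ∑ j, (β j).re = 0
    rw [← Complex.re_sum, hβs, Complex.zero_re]
  · change ∑ j, (β j).im = 0
    rw [← Complex.im_sum, hβs, Complex.zero_im]
  · funext j
    have h : ((β j).re : ℂ) + Complex.I * (β j).im = β j := by
      rw [mul_comm]
      exact Complex.re_add_im _
    simp only [param, h]
    rw [hβ, mul_div_cancel₀ _ Complex.two_pi_I_ne_zero, hα, mul_div_cancel₀ _ hc]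

theorem param_perm (c : ℂ) (a b : Y) (σ : Equiv.Perm (Fin 8)) :
    param c (perm σ a) (perm σ b) = fun j => param c a b (σ j) := rfl

theorem exists_param_refl {c : ℂ} (hc : c ≠ 0) (a b : Y) : ∃ ε : ℂ,
    ε ^ 2 = param c a b 0 * param c a b 1 * param c a b 2 * param c a b 3 / c ^ 4 ∧
      param c (refl a) (refl b) = shift ε (param c a b) := by
  refine ⟨Complex.exp (Real.pi * Complex.I * ((a.1 0 + a.1 1 + a.1 2 + a.1 3 : ℝ) +
    Complex.I * (b.1 0 + b.1 1 + b.1 2 + b.1 3 : ℝ))), ?_, ?_⟩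
  · rw [eq_div_iff (pow_ne_zero 4 hc), sq, ← Complex.exp_add]
    simp only [param]
    rw [show ∀ x y z w : ℂ, c * x * (c * y) * (c * z) * (c * w) = x * y * z * w * c ^ 4 from
      fun x y z w => by ring, ← Complex.exp_add, ← Complex.exp_add, ← Complex.exp_add]
    congr 2
    push_cast
    ring
  · funext j
    by_cases hj : j.val < 4
    · simp only [param, shift, refl_apply, if_pos hj]
      rw [← Complex.exp_neg, mul_left_comm, ← Complex.exp_add]
      congr 2
      push_cast
      ring
    · simp only [param, shift, refl_apply, if_neg hj]
      rw [mul_left_comm, ← Complex.exp_add]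
      congr 2
      push_cast
      ring

theorem param_add_smul (c : ℂ) (a b d : Y) (u : ℂ) :
    param c (a + u.re • d) (b + u.im • d) =
      tpath (param c a b) (fun j => 2 * Real.pi * Complex.I * d.1 j) u := by
  funext j
  have h := Complex.re_add_im u
  have h1 : ((a + u.re • d).1 j : ℂ) = a.1 j + u.re * d.1 j := by simp
  have h2 : ((b + u.im • d).1 j : ℂ) = b.1 j + u.im * d.1 j := by simp
  simp only [param, tpath, h1, h2]
  rw [mul_assoc c, ← Complex.exp_add]
  congr 2
  linear_combination (2 * Real.pi * Complex.I * d.1 j) * h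

/-! ### Products over pairs of parameters -/

/-- The product `∏_{j<k} r(t_j t_k)`. -/
def pairP (r : ℂ → ℂ) {n : ℕ} (t : Fin n → ℂ) : ℂ := ∏ j, ∏ k ∈ Finset.Ioi j, r (t j * t k)

theorem pairG_eq_pairP {n : ℕ} (t : Fin n → ℂ) : pairG p q t = pairP (Gam p q) t := rfl

theorem pairP_comp_perm (r : ℂ → ℂ) {n : ℕ} (t : Fin n → ℂ) (σ : Equiv.Perm (Fin n)) :
    pairP r (fun j => t (σ j)) = pairP r t :=
  prod_pairs_perm (fun j k => r (t j * t k)) (fun i j => by rw [mul_comm]) σ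

theorem prod_pairs_fin_eight (h : Fin 8 → Fin 8 → ℂ) :
    ∏ j, ∏ k ∈ Finset.Ioi j, h j k =
      (∏ j : Fin 4, ∏ k ∈ Finset.Ioi j, h (Fin.castAdd 4 j) (Fin.castAdd 4 k)) *
      (∏ j : Fin 4, ∏ k : Fin 4, h (Fin.castAdd 4 j) (Fin.natAdd 4 k)) *
      ∏ j : Fin 4, ∏ k ∈ Finset.Ioi j, h (Fin.natAdd 4 j) (Fin.natAdd 4 k) := by
  rw [prod_fin_eight]
  have h1 (j : Fin 4) : ∏ k ∈ Finset.Ioi (Fin.castAdd 4 j), h (Fin.castAdd 4 j) k =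
      (∏ k ∈ Finset.Ioi j, h (Fin.castAdd 4 j) (Fin.castAdd 4 k)) *
        ∏ k : Fin 4, h (Fin.castAdd 4 j) (Fin.natAdd 4 k) := by
    have e : Finset.Ioi (Fin.castAdd 4 j) = ((Finset.Ioi j).map (Fin.castAddEmb 4)).disjUnion
        (Finset.univ.map (Fin.natAddEmb 4)) (by revert j; decide) := by
      revert j
      decide
    rw [e, Finset.prod_disjUnion, Finset.prod_map, Finset.prod_map]
    rfl
  have h2 (j : Fin 4) : ∏ k ∈ Finset.Ioi (Fin.natAdd 4 j), h (Fin.natAdd 4 j) k =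
      ∏ k ∈ Finset.Ioi j, h (Fin.natAdd 4 j) (Fin.natAdd 4 k) := by
    have e : Finset.Ioi (Fin.natAdd 4 j) = (Finset.Ioi j).map (Fin.natAddEmb 4) := by
      revert j
      decide
    rw [e, Finset.prod_map]
    rfl
  simp only [h1, h2, Finset.prod_mul_distrib]

theorem pairP_fin_eight (r : ℂ → ℂ) (t : Fin 8 → ℂ) : pairP r t =
    pairP r (fun j : Fin 4 => t (Fin.castAdd 4 j)) *
      (∏ j : Fin 4, ∏ k : Fin 4, r (t (Fin.castAdd 4 j) * t (Fin.natAdd 4 k))) *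
      pairP r (fun j : Fin 4 => t (Fin.natAdd 4 j)) :=
  prod_pairs_fin_eight fun j k => r (t j * t k)

/-- As for `pairG_const_mul`, but only the reflection equation of r is used, so that Γ and its
square root are both covered. -/
theorem pairP_const_mul {r : ℂ → ℂ} {b : Fin 4 → ℂ} {m s : ℂ} (hb : ∀ j, b j ≠ 0)
    (hr : ∀ j k, j < k → r (b j * b k) * r (s / (b j * b k)) = 1)
    (h : m ^ 2 * ∏ j, b j = s) : pairP r (fun j => m * b j) = (pairP r b)⁻¹ := by
  rw [Fin.prod_univ_four] at h
  have key (i j k l : Fin 4) (hkl : k < l) (e : b i * b j * (b k * b l) = b 0 * b 1 * b 2 * b 3) :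
      r (m * b i * (m * b j)) = (r (b k * b l))⁻¹ := by
    rw [← eq_inv_of_mul_eq_one_right (hr k l hkl)]
    congr 1
    rw [eq_div_iff (mul_ne_zero (hb k) (hb l)), ← h, ← e]
    ring
  rw [pairP, pairP, prod_pairs_fin_four, prod_pairs_fin_four,
    key 0 1 2 3 (by decide) (by ring), key 0 2 1 3 (by decide) (by ring),
    key 0 3 1 2 (by decide) (by ring), key 1 2 0 3 (by decide) (by ring),
    key 1 3 0 2 (by decide) (by ring), key 2 3 0 1 (by decide) (by ring)]
  simp only [mul_inv]
  ring

end EllipticHyp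

end

/-! ### Invariance under the group, and the third transformation -/

noncomputable section

namespace EllipticHyp

open Filter Topology Set

variable {p q : ℂ} {J : Type}

/-! ### Invariance of the normalised function -/

/-- The products of parameters from different blocks are unchanged. Within a block, the reflection
equation turns the product over pairs into its inverse, whence the squares. -/
theorem pairP_shift {r : ℂ → ℂ} {t : Fin 8 → ℂ} {ε s : ℂ} (ht : ∀ j, t j ≠ 0) (hs : s ≠ 0)
    (hr : ∀ j k, j < k → r (t j * t k) * r (s / (t j * t k)) = 1) (hprod : ∏ j, t j = s ^ 2)
    (hε : ε ^ 2 = t 0 * t 1 * t 2 * t 3 / s) :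
    pairP r t = pairP r (fun j : Fin 4 => t (Fin.castAdd 4 j)) ^ 2 *
      pairP r (fun j : Fin 4 => t (Fin.natAdd 4 j)) ^ 2 * pairP r (shift ε t) := by
  have h1 : ∏ j : Fin 4, t (Fin.castAdd 4 j) = ε ^ 2 * s := by
    rw [hε, div_mul_cancel₀ _ hs, Fin.prod_univ_four]
    rfl
  have hε0 : ε ≠ 0 := by
    rintro rfl
    exact Finset.prod_ne_zero_iff.2 (fun j _ => ht _) (h1.trans (by simp))
  have h2 : ε ^ 2 * ∏ j : Fin 4, t (Fin.natAdd 4 j) = s := by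
    rw [prod_fin_eight, h1] at hprod
    refine mul_left_cancel₀ hs ?_
    linear_combination hprod
  have hne {j k : Fin 8} (hjk : j < k) : r (t j * t k) ≠ 0 := left_ne_zero_of_mul_eq_one (hr j k hjk)
  have n1 : pairP r (fun j : Fin 4 => t (Fin.castAdd 4 j)) ≠ 0 :=
    Finset.prod_ne_zero_iff.2 fun j _ => Finset.prod_ne_zero_iff.2 fun k hk =>
      hne (show Fin.castAdd 4 j < Fin.castAdd 4 k from show j < k from Finset.mem_Ioi.1 hk)
  have n2 : pairP r (fun j : Fin 4 => t (Fin.natAdd 4 j)) ≠ 0 :=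
    Finset.prod_ne_zero_iff.2 fun j _ => Finset.prod_ne_zero_iff.2 fun k hk =>
      hne (show Fin.natAdd 4 j < Fin.natAdd 4 k from
        Nat.add_lt_add_left (show j < k from Finset.mem_Ioi.1 hk) 4)
  have e1 := pairP_const_mul (r := r) (b := fun j : Fin 4 => t (Fin.castAdd 4 j)) (m := ε⁻¹) (s := s)
    (fun j => ht _) (fun j k hjk => hr _ _ hjk) (by rw [h1]; field_simp)
  have e2 := pairP_const_mul (r := r) (b := fun j : Fin 4 => t (Fin.natAdd 4 j)) (m := ε) (s := s)
    (fun j => ht _) (fun j k hjk => hr _ _ (Nat.add_lt_add_left hjk 4)) h2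
  have e3 (j k : Fin 4) : ε⁻¹ * t (Fin.castAdd 4 j) * (ε * t (Fin.natAdd 4 k)) =
      t (Fin.castAdd 4 j) * t (Fin.natAdd 4 k) := by
    field_simp
  rw [pairP_fin_eight r (shift ε t), pairP_fin_eight r t]
  simp only [shift_castAdd, shift_natAdd, e1, e2, e3]
  field_simp

theorem blockG_eq_sq {r : ℂ → ℂ} (hr : ∀ u, r u ^ 2 = Gam p q u) (t : Fin 8 → ℂ) :
    blockG p q t = pairP r (fun j : Fin 4 => t (Fin.castAdd 4 j)) ^ 2 *
      pairP r (fun j : Fin 4 => t (Fin.natAdd 4 j)) ^ 2 := by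
  simp only [blockG_eq, pairG, pairP, ← hr, Finset.prod_pow]

theorem pairP_sq {r : ℂ → ℂ} (hr : ∀ u, r u ^ 2 = Gam p q u) {n : ℕ} (t : Fin n → ℂ) :
    pairP r t ^ 2 = pairG p q t := by
  simp only [pairG, pairP, ← hr, Finset.prod_pow]

theorem pairG_ne_zero_iff {n : ℕ} {t : Fin n → ℂ} :
    pairG p q t ≠ 0 ↔ ∀ j k, j < k → Gam p q (t j * t k) ≠ 0 := by
  simp [pairG, Finset.prod_ne_zero_iff]

theorem E_ne_zero_of_Gam_ne_zero {x : ℂ} (h : Gam p q x ≠ 0) : E p q x ≠ 0 := by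
  rw [Gam_eq] at h
  exact fun h0 => h (by rw [h0, div_zero])

theorem pairG_shift_ne_zero (hp0 : p ≠ 0) (hq0 : q ≠ 0) {t : Fin 8 → ℂ} {ε : ℂ}
    (ht : ∀ j, t j ≠ 0) (hprod : ∏ j, t j = p ^ 2 * q ^ 2)
    (hε : ε ^ 2 = t 0 * t 1 * t 2 * t 3 / (p * q)) (h : pairG p q t ≠ 0) :
    pairG p q (shift ε t) ≠ 0 := by
  have := pairP_shift (r := Gam p q) (s := p * q) ht (mul_ne_zero hp0 hq0) (fun j k hjk => by
    rw [Gam_reflect hp0 hq0, mul_inv_cancel₀ (pairG_ne_zero_iff.1 h j k hjk)])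
    (hprod.trans (mul_pow p q 2).symm) hε
  intro h0
  exact h (by rw [pairG_eq_pairP, this, ← pairG_eq_pairP (shift ε t), h0, mul_zero])

/-- The tool for passing from generic to special parameters: the complement of a countable set is
dense. -/
theorem eq_zero_of_eventually {f g : ℂ → ℂ} {D : Set ℂ} (hD : D.Countable)
    (hf : ContinuousAt f 0) (hg : ContinuousAt g 0) (h : ∀ᶠ u in 𝓝 0, u ∉ D → f u = g u) :
    f 0 = g 0 := by
  have hfr : ∃ᶠ u in 𝓝 (0 : ℂ), u ∈ Dᶜ :=
    mem_closure_iff_frequently.1 ((hD.dense_compl ℝ) 0)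
  have h2 : ∃ᶠ u in 𝓝 (0 : ℂ), f u - g u ∈ ({0} : Set ℂ) :=
    (hfr.and_eventually h).mono fun u hu => sub_eq_zero.2 (hu.2 hu.1)
  exact sub_eq_zero.1 (isClosed_singleton.mem_of_frequently_of_tendsto h2 (hf.sub hg))

/-- The multiplier relating the values of `V` at `x` and at `w x`. -/
structure IsMultiplier (p q c : ℂ) (r : ℂ → ℂ) (w : Y ≃ₗ[ℝ] Y) (M : Y → Y → ℂ) : Prop where
  continuousAt : ∀ a b d : Y, pairG p q (param c a b) ≠ 0 →
    ContinuousAt (fun u : ℂ => M (a + u.re • d) (b + u.im • d)) 0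
  regular : ∀ a b, pairG p q (param c a b) ≠ 0 → pairG p q (param c (w a) (w b)) ≠ 0
  pairP_eq : ∀ a b, pairG p q (param c a b) ≠ 0 →
    pairP r (param c a b) = M a b * pairP r (param c (w a) (w b))
  hypI_eq : ∀ a b, pairG p q (param c a b) ≠ 0 → Admissible p q (param c a b) →
    Admissible p q (param c (w a) (w b)) →
    hypI p q (param c a b) = M a b * hypI p q (param c (w a) (w b))

theorem continuousAt_pairG_param (hp : ‖p‖ < 1) (hq : ‖q‖ < 1) {c : ℂ} (hc : c ≠ 0) (a b d : Y)
    (h : pairG p q (param c a b) ≠ 0) :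
    ContinuousAt (fun u : ℂ => pairG p q (param c (a + u.re • d) (b + u.im • d))) 0 := by
  simp only [param_add_smul]
  refine (pairG_differentiableAt hp hq (differentiable_tpath _ _ 0)
    (tpath_ne_zero (param_ne_zero hc a b) 0) ?_).continuousAt
  simp only [tpath_zero]
  exact fun j k hjk => E_ne_zero_of_Gam_ne_zero (pairG_ne_zero_iff.1 h j k hjk)

theorem isMultiplier_perm (hp : ‖p‖ < 1) (hq : ‖q‖ < 1) (c : ℂ) (r : ℂ → ℂ)
    (σ : Equiv.Perm (Fin 8)) : IsMultiplier p q c r (perm σ) fun _ _ => 1 where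
  continuousAt _ _ _ _ := continuousAt_const
  regular a b h := by rwa [param_perm, pairG_comp_perm]
  pairP_eq a b _ := by rw [param_perm, pairP_comp_perm, one_mul]
  hypI_eq a b _ _ _ := by rw [param_perm, hypI_comp_equiv hp hq, one_mul]

theorem isMultiplier_refl (hp : ‖p‖ < 1) (hq : ‖q‖ < 1) (hp0 : p ≠ 0) (hq0 : q ≠ 0) {c : ℂ}
    (hc : c ^ 4 = p * q) {r : ℂ → ℂ} (hr : IsSqrtGamma p q r) :
    IsMultiplier p q c r refl fun a b => blockG p q (param c a b) := by
  have hc0 : c ≠ 0 := by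
    rintro rfl
    exact mul_ne_zero hp0 hq0 (by rw [← hc]; simp)
  have hprod (a b : Y) : ∏ j, param c a b j = p ^ 2 * q ^ 2 := by
    rw [prod_param, ← mul_pow, ← hc]
    ring
  refine ⟨fun a b d h => ?_, fun a b h => ?_, fun a b h => ?_, fun a b _ h1 h2 => ?_⟩
  · simp only [param_add_smul]
    refine (blockG_differentiableAt hp hq (differentiable_tpath _ _ 0)
      (tpath_ne_zero (param_ne_zero hc0 a b) 0) ?_).continuousAt
    simp only [tpath_zero]
    exact fun j k hjk => E_ne_zero_of_Gam_ne_zero (pairG_ne_zero_iff.1 h j k hjk)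
  · obtain ⟨ε, hε, hεs⟩ := exists_param_refl hc0 a b
    rw [hεs]
    exact pairG_shift_ne_zero hp0 hq0 (param_ne_zero hc0 a b) (hprod a b) (hc ▸ hε) h
  · obtain ⟨ε, hε, hεs⟩ := exists_param_refl hc0 a b
    rw [hεs, blockG_eq_sq hr.1]
    exact pairP_shift (param_ne_zero hc0 a b) (mul_ne_zero hp0 hq0) (fun j k hjk => hr.2 _
      (mul_ne_zero (param_ne_zero hc0 a b j) (param_ne_zero hc0 a b k))
      (pairG_ne_zero_iff.1 h j k hjk)) ((hprod a b).trans (mul_pow p q 2).symm) (hc ▸ hε)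
  · obtain ⟨ε, hε, hεs⟩ := exists_param_refl hc0 a b
    rw [hεs] at h2 ⊢
    exact hypI_shift hp hq hp0 hq0 (hprod a b) (hc ▸ hε) h1 h2

theorem IsMultiplier.ne_zero {c : ℂ} {r : ℂ → ℂ} (hr : IsSqrtGamma p q r) {w : Y ≃ₗ[ℝ] Y}
    {M : Y → Y → ℂ} (h : IsMultiplier p q c r w M) {a b : Y} (hab : pairG p q (param c a b) ≠ 0) :
    M a b ≠ 0 := by
  have h1 := h.pairP_eq a b hab
  rw [← pairP_sq hr.1] at hab
  intro h0
  rw [h0, zero_mul] at h1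
  exact hab (by rw [h1]; simp)

/-- A vector of `Y` without vanishing coordinates. -/
def signVec : Y :=
  ⟨WithLp.toLp 2 fun j : Fin 8 => if j.val < 4 then 1 else -1, by
    change ∑ j : Fin 8, (if j.val < 4 then (1 : ℝ) else -1) = 0
    simp [Fin.sum_univ_eight]⟩

/-- The identities can be composed if the intermediate parameters, at w x, are admissible. In
general x is moved in the direction d with w d = `signVec`. As ∏ Γ(t_j t_k) is regular and non-zero
at w x, only conditions on squares t_j² can fail there. No coordinate of `signVec` vanishes, so the
intermediate parameters are admissible outside a countable set of u, and both sides are continuous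
at u = 0. -/
theorem IsMultiplier.mul (hp : ‖p‖ < 1) (hq : ‖q‖ < 1) (hp0 : p ≠ 0) (hq0 : q ≠ 0) {c : ℂ}
    (hc : c ≠ 0) {r : ℂ → ℂ} {g w : Y ≃ₗ[ℝ] Y} {L M : Y → Y → ℂ}
    (hg : IsMultiplier p q c r g L) (hw : IsMultiplier p q c r w M) :
    IsMultiplier p q c r (g * w) fun a b => M a b * L (w a) (w b) := by
  have hcont (a b d : Y) (hab : pairG p q (param c a b) ≠ 0) : ContinuousAt (fun u : ℂ =>
      M (a + u.re • d) (b + u.im • d) * L (w (a + u.re • d)) (w (b + u.im • d))) 0 := by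
    refine (hw.continuousAt a b d hab).mul ?_
    have := hg.continuousAt (w a) (w b) (w d) (hw.regular a b hab)
    simpa only [map_add, map_smul] using this
  refine ⟨hcont, fun a b hab => hg.regular _ _ (hw.regular a b hab), fun a b hab => ?_,
    fun a b hab h1 h2 => ?_⟩
  · rw [hw.pairP_eq a b hab, hg.pairP_eq _ _ (hw.regular a b hab), mul_assoc]
    rfl
  · set d : Y := w.symm signVec with hd
    have hwd : w d = signVec := w.apply_symm_apply _
    have hwt (u : ℂ) : param c (w (a + u.re • d)) (w (b + u.im • d)) =
        tpath (param c (w a) (w b)) (fun j => 2 * Real.pi * Complex.I * signVec.1 j) u := by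
      simp only [map_add, map_smul, hwd, param_add_smul]
    have hgwt (u : ℂ) : param c (g (w (a + u.re • d))) (g (w (b + u.im • d))) =
        tpath (param c (g (w a)) (g (w b))) (fun j => 2 * Real.pi * Complex.I * (g signVec).1 j)
          u := by
      simp only [map_add, map_smul, hwd, param_add_smul]
    set D : Set ℂ := {u | ¬ Admissible p q (param c (w (a + u.re • d)) (w (b + u.im • d)))} with hD
    have hDc : D.Countable := by
      simp only [hD, hwt]
      refine countable_not_admissible hp hq hp0 hq0 (param_ne_zero hc _ _) fun j k => ?_
      have hreg := pairG_ne_zero_iff.1 (hw.regular a b hab)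
      rcases lt_trichotomy j k with hjk | rfl | hjk
      · exact Or.inr (E_ne_zero_of_Gam_ne_zero (hreg j k hjk))
      · refine Or.inl ?_
        have : (signVec.1 j : ℂ) ≠ 0 := by
          by_cases hj : j.val < 4 <;> simp [signVec, hj]
        rw [← two_mul]
        exact mul_ne_zero two_ne_zero (mul_ne_zero Complex.two_pi_I_ne_zero this)
      · exact Or.inr (by rw [mul_comm]; exact E_ne_zero_of_Gam_ne_zero (hreg k j hjk))
    have hz (u : ℂ) : ((0 : ℂ).re • d : Y) = 0 ∧ ((0 : ℂ).im • d : Y) = 0 := by simp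
    have hadm {t e : Fin 8 → ℂ} (ht : Admissible p q t) :
        ∀ᶠ u in 𝓝 0, Admissible p q (tpath t e u) :=
      (isOpen_setOf_admissible hp hq hp0 hq0 t e).mem_nhds (by rwa [mem_ofPred_eq, tpath_zero])
    have key := eq_zero_of_eventually hDc
      (f := fun u => hypI p q (param c (a + u.re • d) (b + u.im • d)))
      (g := fun u => M (a + u.re • d) (b + u.im • d) *
        L (w (a + u.re • d)) (w (b + u.im • d)) *
        hypI p q (param c (g (w (a + u.re • d))) (g (w (b + u.im • d))))) ?_ ?_ ?_
    · simpa using key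
    · simp only [param_add_smul]
      exact (differentiableAt_hypI_tpath hp hq hp0 hq0 (by rwa [tpath_zero])).continuousAt
    · refine (hcont a b d hab).mul ?_
      simp only [hgwt]
      exact (differentiableAt_hypI_tpath hp hq hp0 hq0 (by rwa [tpath_zero])).continuousAt
    · have hN := (continuousAt_pairG_param hp hq hc a b d hab).eventually_ne
        (by simpa using hab)
      filter_upwards [hN, hadm (e := fun j => 2 * Real.pi * Complex.I * d.1 j) h1,
        hadm (e := fun j => 2 * Real.pi * Complex.I * (g signVec).1 j) h2] with u e1 e2 e3 e4
      have e4 : Admissible p q (param c (w (a + u.re • d)) (w (b + u.im • d))) := not_not.1 e4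
      rw [hw.hypI_eq _ _ e1 (by rwa [param_add_smul]) e4, hg.hypI_eq _ _ (hw.regular _ _ e1) e4
        (by rw [hgwt]; exact e3), mul_assoc]

theorem perm_inv (σ : Equiv.Perm (Fin 8)) : (perm σ)⁻¹ = perm σ⁻¹ := by
  ext x
  rfl

theorem refl_inv : refl⁻¹ = refl := by
  refine inv_eq_of_mul_eq_one_left (LinearEquiv.ext fun x => ?_)
  exact ((ℝ ∙ vVec)ᗮ).reflection_reflection x

theorem exists_isMultiplier (hp : ‖p‖ < 1) (hq : ‖q‖ < 1) (hp0 : p ≠ 0) (hq0 : q ≠ 0) {c : ℂ}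
    (hc : c ^ 4 = p * q) {r : ℂ → ℂ} (hr : IsSqrtGamma p q r) {w : Y ≃ₗ[ℝ] Y}
    (hw : w ∈ symmetryGroup) : ∃ M, IsMultiplier p q c r w M := by
  have hc0 : c ≠ 0 := by
    rintro rfl
    exact mul_ne_zero hp0 hq0 (by rw [← hc]; simp)
  have hgen : ∀ g ∈ ({refl} ∪ Set.range perm : Set (Y ≃ₗ[ℝ] Y)), ∃ M, IsMultiplier p q c r g M := by
    rintro g (rfl | ⟨σ, rfl⟩)
    · exact ⟨_, isMultiplier_refl hp hq hp0 hq0 hc hr⟩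
    · exact ⟨_, isMultiplier_perm hp hq c r σ⟩
  induction hw using Subgroup.closure_induction_left with
  | one => exact ⟨fun _ _ => 1, fun _ _ _ _ => continuousAt_const, fun _ _ h => h,
      fun a b _ => (one_mul _).symm, fun a b _ _ _ => (one_mul _).symm⟩
  | mul_left g hg w _ ih =>
    obtain ⟨M, hM⟩ := ih
    obtain ⟨L, hL⟩ := hgen g hg
    exact ⟨_, hL.mul hp hq hp0 hq0 hc0 hM⟩
  | inv_mul_cancel g hg w _ ih =>
    obtain ⟨M, hM⟩ := ih
    obtain ⟨L, hL⟩ : ∃ L, IsMultiplier p q c r g⁻¹ L := by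
      refine hgen _ ?_
      rcases hg with hg | ⟨σ, rfl⟩
      · exact Or.inl (by rw [mem_singleton_iff.1 hg, refl_inv]; rfl)
      · exact Or.inr ⟨σ⁻¹, (perm_inv σ).symm⟩
    exact ⟨_, hL.mul hp hq hp0 hq0 hc0 hM⟩

theorem normV_eq (hp : ‖p‖ < 1) (hq : ‖q‖ < 1) (hp0 : p ≠ 0) (hq0 : q ≠ 0) {c : ℂ}
    (hc : c ^ 4 = p * q) {r : ℂ → ℂ} (hr : IsSqrtGamma p q r) {w : Y ≃ₗ[ℝ] Y}
    (hw : w ∈ symmetryGroup) {a b : Y} {C C' : Contour} (hC : C.Separates p q (param c a b))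
    (hC' : C'.Separates p q (param c (w a) (w b)))
    (h : ∀ k l : Fin 8, k < l → Gam p q (param c a b k * param c a b l) ≠ 0) :
    normV p q r C' (param c (w a) (w b)) = normV p q r C (param c a b) := by
  obtain ⟨M, hM⟩ := exists_isMultiplier hp hq hp0 hq0 hc hr hw
  have hN := pairG_ne_zero_iff.2 h
  have h1 : Admissible p q (param c a b) := ⟨_, (Chain.single_separates_iff C _).2 hC⟩
  have h2 : Admissible p q (param c (w a) (w b)) := ⟨_, (Chain.single_separates_iff C' _).2 hC'⟩
  have h3 := hM.pairP_eq a b hN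
  have h4 := hM.hypI_eq a b hN h1 h2
  have h5 := hM.ne_zero hr hN
  rw [normV, normV, V_eq_hypI hp hq hC, V_eq_hypI hp hq hC', h4]
  change _ / pairP r _ = _ / pairP r _
  rw [h3, mul_left_comm, mul_div_mul_left _ _ h5]

/-! ### The third and the second transformation -/

theorem perm_apply (σ : Equiv.Perm (Fin 8)) (x : Y) (j : Fin 8) : (perm σ x).1 j = x.1 (σ j) := rfl

/-- Y has an orthogonal basis of seven roots: v, two vectors obtained from v by permuting
coordinates, and four differences of unit vectors with disjoint supports. The product of their
reflections is -1. -/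
theorem neg_mem_symmetryGroup : LinearEquiv.neg ℝ ∈ symmetryGroup := by
  have hr : refl ∈ symmetryGroup := Subgroup.subset_closure (Or.inl rfl)
  have hp (σ) : perm σ ∈ symmetryGroup := Subgroup.subset_closure (Or.inr ⟨σ, rfl⟩)
  set σ : Equiv.Perm (Fin 8) := Equiv.swap 2 4 * Equiv.swap 3 5 with hσ
  set τ : Equiv.Perm (Fin 8) := Equiv.swap 2 6 * Equiv.swap 3 7 with hτ
  set ρ : Equiv.Perm (Fin 8) := Equiv.swap 0 1 * Equiv.swap 2 3 * Equiv.swap 4 5 * Equiv.swap 6 7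
    with hρ
  have h : LinearEquiv.neg ℝ = refl * (perm σ * refl * perm σ) * (perm τ * refl * perm τ) * perm ρ := by
    ext x j
    have hx := sum_Y x
    simp only [LinearEquiv.mul_apply, refl_apply, perm_apply, LinearEquiv.neg_apply]
    have e1 : σ 0 = 0 ∧ σ 1 = 1 ∧ σ 2 = 4 ∧ σ 3 = 5 ∧ σ 4 = 2 ∧ σ 5 = 3 ∧ σ 6 = 6 ∧ σ 7 = 7 := by
      decide
    have e2 : τ 0 = 0 ∧ τ 1 = 1 ∧ τ 2 = 6 ∧ τ 3 = 7 ∧ τ 4 = 4 ∧ τ 5 = 5 ∧ τ 6 = 2 ∧ τ 7 = 3 := by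
      decide
    have e3 : ρ 0 = 1 ∧ ρ 1 = 0 ∧ ρ 2 = 3 ∧ ρ 3 = 2 ∧ ρ 4 = 5 ∧ ρ 5 = 4 ∧ ρ 6 = 7 ∧ ρ 7 = 6 := by
      decide
    obtain ⟨a0, a1, a2, a3, a4, a5, a6, a7⟩ := e1
    obtain ⟨b0, b1, b2, b3, b4, b5, b6, b7⟩ := e2
    obtain ⟨c0, c1, c2, c3, c4, c5, c6, c7⟩ := e3
    clear_value σ τ ρ
    fin_cases j <;>
      simp [a0, a1, a2, a3, a4, a5, a6, a7, b0, b1, b2, b3, b4, b5, b6, b7, c0, c1, c2, c3, c4, c5,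
        c6, c7] <;> linarith
  rw [h]
  exact mul_mem (mul_mem (mul_mem hr (mul_mem (mul_mem (hp σ) hr) (hp σ)))
    (mul_mem (mul_mem (hp τ) hr) (hp τ))) (hp ρ)

theorem param_neg {c : ℂ} (hc : c ≠ 0) (a b : Y) :
    param c (-a) (-b) = fun j => c ^ 2 / param c a b j := by
  funext j
  rw [eq_div_iff (param_ne_zero hc a b j)]
  have h : 2 * Real.pi * Complex.I * (((-a).1 j : ℂ) + Complex.I * ((-b).1 j : ℂ)) =
      -(2 * Real.pi * Complex.I * ((a.1 j : ℂ) + Complex.I * (b.1 j : ℂ))) := by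
    simp
    ring
  rw [param, param, h, Complex.exp_neg]
  have := Complex.exp_ne_zero (2 * Real.pi * Complex.I * ((a.1 j : ℂ) + Complex.I * (b.1 j : ℂ)))
  field_simp

/-- For c² = σ the map s ↦ σ/s is x ↦ -x. By the reflection equation the products of square roots at
s and σ/s are inverse to each other, so the multiplier of -1 is the square of the former, which is ∏
Γ(s_j s_k). -/
theorem hypI_div_of_pairG_ne_zero (hp : ‖p‖ < 1) (hq : ‖q‖ < 1) (hp0 : p ≠ 0) (hq0 : q ≠ 0)
    {r : ℂ → ℂ} (hr : IsSqrtGamma p q r) {s : Fin 8 → ℂ} {σ : ℂ} (hprod : ∏ j, s j = p ^ 2 * q ^ 2)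
    (hσ : σ ^ 2 = p * q) (h : pairG p q s ≠ 0) (h1 : Admissible p q s)
    (h2 : Admissible p q fun j => σ / s j) :
    hypI p q s = pairG p q s * hypI p q fun j => σ / s j := by
  obtain ⟨c, rfl⟩ := IsAlgClosed.exists_pow_nat_eq σ two_pos
  have hc : c ^ 4 = p * q := by rw [← hσ]; ring
  have hc0 : c ≠ 0 := by
    rintro rfl
    exact mul_ne_zero hp0 hq0 (by rw [← hc]; simp)
  obtain ⟨a, b, rfl⟩ := exists_param_eq hc0 (hprod.trans (by rw [← mul_pow, ← hc]; ring))
  obtain ⟨M, hM⟩ := exists_isMultiplier hp hq hp0 hq0 hc hr neg_mem_symmetryGroup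
  have e : param c (LinearEquiv.neg ℝ a) (LinearEquiv.neg ℝ b) = fun j => c ^ 2 / param c a b j :=
    param_neg hc0 a b
  have h3 := hM.pairP_eq a b h
  have h4 := hM.hypI_eq a b h h1 (by rwa [e])
  have h5 : pairP r (param c a b) * pairP r (fun j => c ^ 2 / param c a b j) = 1 := by
    simp only [pairP, ← Finset.prod_mul_distrib]
    refine Finset.prod_eq_one fun j _ => Finset.prod_eq_one fun k hk => ?_
    rw [div_mul_div_comm, ← pow_add, hc]
    exact hr.2 _ (mul_ne_zero (param_ne_zero hc0 a b j) (param_ne_zero hc0 a b k))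
      (pairG_ne_zero_iff.1 h j k (Finset.mem_Ioi.1 hk))
  rw [e] at h3 h4
  rw [h4, ← pairP_sq hr.1]
  congr 1
  calc M a b = M a b * (pairP r (param c a b) * pairP r (fun j => c ^ 2 / param c a b j)) := by
        rw [h5, mul_one]
    _ = pairP r (param c a b) * pairP r (param c a b) := by
        conv_rhs => rw [h3]
        conv_lhs => rw [h3]
        ring
    _ = _ := (sq _).symm

theorem countable_pairG_tpath_eq_zero (hp : ‖p‖ < 1) (hq : ‖q‖ < 1) (hp0 : p ≠ 0) (hq0 : q ≠ 0)
    {n : ℕ} {t d : Fin n → ℂ} (ht : ∀ j, t j ≠ 0) (hd : ∀ j k, j < k → d j + d k ≠ 0) :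
    {u | pairG p q (tpath t d u) = 0}.Countable := by
  have : {u | pairG p q (tpath t d u) = 0} ⊆ ⋃ i : {i : Fin n × Fin n // i.1 < i.2},
      ({u : ℂ | E p q (t i.1.1 * t i.1.2 * Complex.exp (u * (d i.1.1 + d i.1.2))) = 0} ∪
        {u : ℂ | E p q (p * q / (t i.1.1 * t i.1.2) *
          Complex.exp (u * -(d i.1.1 + d i.1.2))) = 0}) := by
    intro u hu
    have hu : ¬ pairG p q (tpath t d u) ≠ 0 := not_not.2 hu
    rw [pairG_ne_zero_iff] at hu
    push Not at hu
    obtain ⟨j, k, hjk, h⟩ := hu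
    rw [tpath_mul_tpath, Gam_eq, div_eq_zero_iff] at h
    refine mem_iUnion.2 ⟨⟨(j, k), hjk⟩, h.symm.imp id fun h => ?_⟩
    rw [mem_ofPred_eq, mul_neg, Complex.exp_neg]
    rwa [← div_div, div_eq_mul_inv _ (Complex.exp _)] at h
  refine (countable_iUnion fun i => ?_).mono this
  exact (countable_setOf_E_eq_zero hp hq (mul_ne_zero (ht _) (ht _)) (Or.inl (hd _ _ i.2))).union
    (countable_setOf_E_eq_zero hp hq (div_ne_zero (mul_ne_zero hp0 hq0)
      (mul_ne_zero (ht _) (ht _))) (Or.inl (neg_ne_zero.2 (hd _ _ i.2))))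

theorem prod_tpath (t d : Fin 8 → ℂ) (hd : ∑ j, d j = 0) (u : ℂ) :
    ∏ j, tpath t d u j = ∏ j, t j := by
  simp only [tpath, Finset.prod_mul_distrib, ← Complex.exp_sum, ← Finset.mul_sum, hd, mul_zero,
    Complex.exp_zero, mul_one]

theorem div_tpath (s : ℂ) (t d : J → ℂ) (u : ℂ) :
    (fun j => s / tpath t d u j) = tpath (fun j => s / t j) (fun j => -d j) u := by
  funext j
  rw [tpath, tpath, mul_neg, Complex.exp_neg, ← div_div, div_eq_mul_inv _ (Complex.exp _)]

theorem continuousAt_hypI_tpath [Fintype J] (hp : ‖p‖ < 1) (hq : ‖q‖ < 1) (hp0 : p ≠ 0)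
    (hq0 : q ≠ 0) {t : J → ℂ} (d : J → ℂ) (h : Admissible p q t) :
    ContinuousAt (fun u => hypI p q (tpath t d u)) 0 :=
  (differentiableAt_hypI_tpath hp hq hp0 hq0 (by rwa [tpath_zero])).continuousAt

theorem eventually_admissible_tpath [Fintype J] (hp : ‖p‖ < 1) (hq : ‖q‖ < 1) (hp0 : p ≠ 0)
    (hq0 : q ≠ 0) {t : J → ℂ} (d : J → ℂ) (h : Admissible p q t) :
    ∀ᶠ u in 𝓝 0, Admissible p q (tpath t d u) :=
  (isOpen_setOf_admissible hp hq hp0 hq0 t d).mem_nhds (by rwa [mem_ofPred_eq, tpath_zero])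

/-- The third transformation. -/
theorem hypI_div (hp : ‖p‖ < 1) (hq : ‖q‖ < 1) (hp0 : p ≠ 0) (hq0 : q ≠ 0)
    {r : ℂ → ℂ} (hr : IsSqrtGamma p q r) {s : Fin 8 → ℂ} {σ : ℂ} (hprod : ∏ j, s j = p ^ 2 * q ^ 2)
    (hσ : σ ^ 2 = p * q) (h1 : Admissible p q s) (h2 : Admissible p q fun j => σ / s j) :
    hypI p q s = pairG p q s * hypI p q fun j => σ / s j := by
  obtain ⟨hs0, hs⟩ := (admissible_iff hp hq hp0 hq0).1 h1
  -- The coordinates have sum zero, so the product of the parameters persists, but no two of them at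
  -- different places add up to zero. Hence ∏ Γ(s_j s_k) vanishes for countably many u only.
  set d : Fin 8 → ℂ := Fin.cons (-7) fun _ => 1 with hd
  have hd0 : ∑ j, d j = 0 := by
    rw [Fin.sum_univ_succ]
    simp [hd]
  have hdjk (j k : Fin 8) (hjk : j < k) : d j + d k ≠ 0 := by
    obtain ⟨k, rfl⟩ := Fin.exists_succ_eq_of_ne_zero (Fin.pos_iff_ne_zero.1 (hjk.trans_le' (Fin.zero_le j)))
    refine Fin.cases ?_ (fun j => ?_) j
    · norm_num [hd]
    · norm_num [hd]
  have key := eq_zero_of_eventually (countable_pairG_tpath_eq_zero hp hq hp0 hq0 hs0 hdjk)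
    (f := fun u => hypI p q (tpath s d u)) (g := fun u => pairG p q (tpath s d u) *
      hypI p q (tpath (fun j => σ / s j) (fun j => -d j) u))
    (continuousAt_hypI_tpath hp hq hp0 hq0 d h1) ?_ ?_
  · simpa only [tpath_zero] using key
  · refine ContinuousAt.mul (pairG_differentiableAt hp hq (differentiable_tpath s d 0) ?_ ?_).continuousAt
      (continuousAt_hypI_tpath hp hq hp0 hq0 _ h2)
    · simpa only [tpath_zero] using hs0
    · simpa only [tpath_zero] using fun j k _ => hs j k
  · filter_upwards [eventually_admissible_tpath hp hq hp0 hq0 d h1,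
      eventually_admissible_tpath hp hq hp0 hq0 (fun j => -d j) h2] with u e1 e2 e3
    rw [← div_tpath] at e2 ⊢
    exact hypI_div_of_pairG_ne_zero hp hq hp0 hq0 hr ((prod_tpath s d hd0 u).trans hprod) hσ e3 e1 e2

end EllipticHyp

end

/-! ### The second transformation, and square roots of the elliptic gamma function -/

noncomputable section

namespace EllipticHyp

open Filter Topology Set

variable {p q : ℂ} {J : Type}

/-- The product of the gamma factors that couple the two blocks of four parameters. -/
def crossG (p q : ℂ) (t : Fin 8 → ℂ) : ℂ :=
  ∏ j : Fin 4, ∏ k : Fin 4, Gam p q (t (Fin.castAdd 4 j) * t (Fin.natAdd 4 k))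

theorem crossG_differentiableAt (hp : ‖p‖ < 1) (hq : ‖q‖ < 1) {t : ℂ → Fin 8 → ℂ} {u : ℂ}
    (ht : DifferentiableAt ℂ t u) (h0 : ∀ j, t u j ≠ 0)
    (h : ∀ j k, j < k → E p q (t u j * t u k) ≠ 0) :
    DifferentiableAt ℂ (fun u => crossG p q (t u)) u :=
  differentiableAt_prod _ fun j _ => differentiableAt_prod _ fun k _ =>
    (Gam_differentiableAt hp hq (mul_ne_zero (h0 _) (h0 _)) (h _ _ (Fin.lt_def.2 (j.2.trans_le (Nat.le_add_right 4 k))))).comp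
      (f := fun u => t u (Fin.castAdd 4 j) * t u (Fin.natAdd 4 k)) u
      ((differentiableAt_pi.1 ht _).mul (differentiableAt_pi.1 ht _))

/-- The factors of the first transformation and of the third one after it: those within a block
cancel by the reflection equation, and the mixed ones remain. -/
theorem blockG_mul_pairG_shift (hp0 : p ≠ 0) (hq0 : q ≠ 0) {t : Fin 8 → ℂ} {ε : ℂ}
    (ht : ∀ j, t j ≠ 0) (hprod : ∏ j, t j = p ^ 2 * q ^ 2)
    (hε : ε ^ 2 = t 0 * t 1 * t 2 * t 3 / (p * q)) (h : pairG p q t ≠ 0) :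
    blockG p q t * pairG p q (shift ε t) = crossG p q t := by
  have h1 := pairP_shift (r := Gam p q) (s := p * q) ht (mul_ne_zero hp0 hq0) (fun j k hjk => by
    rw [Gam_reflect hp0 hq0, mul_inv_cancel₀ (pairG_ne_zero_iff.1 h j k hjk)])
    (hprod.trans (mul_pow p q 2).symm) hε
  have h2 := pairP_fin_eight (Gam p q) t
  rw [pairG_eq_pairP, h1] at h
  rw [h1] at h2
  rw [blockG_eq, pairG_eq_pairP, pairG_eq_pairP, pairG_eq_pairP, crossG]
  have n1 := left_ne_zero_of_mul h
  have n2 := right_ne_zero_of_mul n1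
  have n1 := left_ne_zero_of_mul n1
  rw [ne_eq, pow_eq_zero_iff two_ne_zero] at n1 n2
  refine mul_left_cancel₀ (mul_ne_zero n1 n2) ?_
  linear_combination h2

theorem div_shift {t : Fin 8 → ℂ} {ε σ τ υ : ℂ} (hτ : τ = σ * ε) (hυ : υ = σ / ε) :
    (fun j => σ / shift ε t j) = invert τ υ t := by
  funext j
  by_cases hj : j.val < 4
  · simp only [shift, invert, if_pos hj, hτ]
    rw [div_mul_eq_div_div, div_inv_eq_mul]
  · simp only [shift, invert, if_neg hj, hυ]
    rw [div_mul_eq_div_div]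

theorem invert_tpath (τ υ : ℂ) (t d : Fin 8 → ℂ) (u : ℂ) :
    invert τ υ (tpath t d u) = tpath (invert τ υ t) (fun j => -d j) u := by
  funext j
  by_cases hj : j.val < 4
  · simpa only [invert, tpath, if_pos hj] using congrFun (div_tpath τ t d u) j
  · simpa only [invert, tpath, if_neg hj] using congrFun (div_tpath υ t d u) j

/-- Exponents whose sum over each block of four vanishes, but no sum of two exponents does. -/
def genericExponents : Fin 8 → ℂ := ![1, 1, 1, -3, 5, 5, 5, -15]

theorem genericExponents_add_ne_zero (j k : Fin 8) :
    genericExponents j + genericExponents k ≠ 0 := by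
  fin_cases j <;> fin_cases k <;> norm_num [genericExponents]

/-- The second transformation. -/
theorem hypI_invert (hp : ‖p‖ < 1) (hq : ‖q‖ < 1) (hp0 : p ≠ 0) (hq0 : q ≠ 0)
    {r : ℂ → ℂ} (hr : IsSqrtGamma p q r) {t : Fin 8 → ℂ} {τ υ : ℂ}
    (hprod : ∏ j, t j = p ^ 2 * q ^ 2) (hτ : τ ^ 2 = t 0 * t 1 * t 2 * t 3) (hτυ : τ * υ = p * q)
    (h1 : Admissible p q t) (h2 : Admissible p q (invert τ υ t)) :
    hypI p q t = crossG p q t * hypI p q (invert τ υ t) := by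
  obtain ⟨ht0, ht⟩ := (admissible_iff hp hq hp0 hq0).1 h1
  have hpq := mul_ne_zero hp0 hq0
  obtain ⟨σ, hσ⟩ := IsAlgClosed.exists_pow_nat_eq (p * q) two_pos
  have hσ0 : σ ≠ 0 := by
    rintro rfl
    exact hpq (by rw [← hσ]; simp)
  have hτ0 : τ ≠ 0 := left_ne_zero_of_mul (hτυ ▸ hpq)
  -- With this ε, the shift by ε followed by s ↦ σ/s is the given map.
  set ε : ℂ := τ / σ with hεdef
  have hετ : τ = σ * ε := by rw [hεdef]; field_simp
  have hευ : υ = σ / ε := by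
    rw [hεdef, div_div_eq_mul_div, eq_div_iff hτ0, mul_comm, hτυ, ← hσ, sq]
  have hε0 : ε ≠ 0 := div_ne_zero hτ0 hσ0
  have hε : ε ^ 2 = t 0 * t 1 * t 2 * t 3 / (p * q) := by rw [hεdef, div_pow, hτ, hσ]
  set d := genericExponents
  have hd := genericExponents_add_ne_zero
  have hd0 : ∑ j, d j = 0 := by
    rw [Fin.sum_univ_eight]
    change (1 : ℂ) + 1 + 1 + -3 + 5 + 5 + 5 + -15 = 0
    norm_num
  have hs0 (j : Fin 8) : shift ε t j ≠ 0 := by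
    unfold shift
    split_ifs
    · exact mul_ne_zero (inv_ne_zero hε0) (ht0 j)
    · exact mul_ne_zero hε0 (ht0 j)
  have hshift (u : ℂ) : shift ε (tpath t d u) = tpath (shift ε t) d u := by
    have := shift_tpath (t := t) (d := d) (ε := ε) (m := 0) (u := u)
    simpa using this
  have hεu (u : ℂ) : ε ^ 2 = tpath t d u 0 * tpath t d u 1 * tpath t d u 2 * tpath t d u 3 /
      (p * q) := by
    have : Complex.exp (u * d 0) * Complex.exp (u * d 1) * Complex.exp (u * d 2) *
        Complex.exp (u * d 3) = 1 := by
      rw [← Complex.exp_add, ← Complex.exp_add, ← Complex.exp_add, ← mul_add, ← mul_add, ← mul_add]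
      change Complex.exp (u * (1 + 1 + 1 + -3)) = 1
      norm_num
    rw [hε]
    simp only [tpath]
    congr 1
    linear_combination (-t 0 * t 1 * t 2 * t 3) * this
  -- The shifted parameters need not be admissible, and ∏ Γ(t_j t_k) may vanish at t. Along the
  -- chosen direction both happen only for countably many u. The product of each block is constant
  -- in u, so ε does not change.
  have key := eq_zero_of_eventually
    ((countable_pairG_tpath_eq_zero hp hq hp0 hq0 ht0 fun j k _ => hd j k).union
      (countable_not_admissible hp hq hp0 hq0 hs0 fun j k => Or.inl (hd j k)))
    (f := fun u => hypI p q (tpath t d u)) (g := fun u => crossG p q (tpath t d u) *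
      hypI p q (tpath (invert τ υ t) (fun j => -d j) u))
    (continuousAt_hypI_tpath hp hq hp0 hq0 d h1) ?_ ?_
  · simpa only [tpath_zero] using key
  · refine ContinuousAt.mul
      (crossG_differentiableAt hp hq (differentiable_tpath t d 0) ?_ ?_).continuousAt
      (continuousAt_hypI_tpath hp hq hp0 hq0 _ h2)
    · simpa only [tpath_zero] using ht0
    · simpa only [tpath_zero] using fun j k _ => ht j k
  · filter_upwards [eventually_admissible_tpath hp hq hp0 hq0 d h1,
      eventually_admissible_tpath hp hq hp0 hq0 (fun j => -d j) h2] with u e1 e2 e3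
    obtain ⟨e3, e4⟩ := not_or.1 e3
    have e4 : Admissible p q (tpath (shift ε t) d u) := not_not.1 e4
    have hprodu := (prod_tpath t d hd0 u).trans hprod
    rw [← invert_tpath, ← div_shift hετ hευ] at e2 ⊢
    rw [← hshift] at e4
    have hsprod : ∏ j, shift ε (tpath t d u) j = p ^ 2 * q ^ 2 := by
      rw [← hprodu, prod_fin_eight, prod_fin_eight]
      simp only [shift_castAdd, shift_natAdd, Finset.prod_mul_distrib, Finset.prod_const,
        Finset.card_univ, Fintype.card_fin]
      field_simp
    rw [hypI_shift hp hq hp0 hq0 hprodu (hεu u) e1 e4,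
      hypI_div hp hq hp0 hq0 hr hsprod hσ e4 e2, ← mul_assoc,
      blockG_mul_pairG_shift hp0 hq0 (tpath_ne_zero ht0 u) hprodu (hεu u) e3]

/-! ### Square roots of the elliptic gamma function -/

/-- In a well-ordering of ℂ the root is chosen freely at the smaller one of u and pq/u, and its
inverse is taken at the other. If u = pq/u is neither a zero nor a pole, then Γ(u) = 1 and either
root will do. -/
theorem exists_isSqrtGamma (hp0 : p ≠ 0) (hq0 : q ≠ 0) : ∃ r, IsSqrtGamma p q r := by
  choose g hg using fun u => IsAlgClosed.exists_pow_nat_eq (Gam p q u) two_pos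
  have hpq := mul_ne_zero hp0 hq0
  have hasymm (a b : ℂ) (h : WellOrderingRel a b) : ¬ WellOrderingRel b a := asymm h
  classical
  refine ⟨fun u => if WellOrderingRel (p * q / u) u then (g (p * q / u))⁻¹ else g u,
    fun u => ?_, fun u hu h => ?_⟩
  · dsimp only
    split_ifs
    · rw [inv_pow, hg, Gam_reflect hp0 hq0, inv_inv]
    · exact hg u
  · have huu : p * q / (p * q / u) = u := by field_simp
    have hg0 (v : ℂ) (hv : Gam p q v ≠ 0) : g v ≠ 0 := fun h0 => hv (by rw [← hg, h0]; simp)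
    have h' : Gam p q (p * q / u) ≠ 0 := by
      rw [Gam_reflect hp0 hq0]
      exact inv_ne_zero h
    simp only [huu]
    rcases trichotomous_of WellOrderingRel (p * q / u) u with hlt | heq | hgt
    · rw [if_pos hlt, if_neg (hasymm _ _ hlt), inv_mul_cancel₀ (hg0 _ h')]
    · rw [heq, if_neg (irrefl u), ← sq, hg, Gam_eq, heq, div_self (E_ne_zero_of_Gam_ne_zero h)]
    · rw [if_neg (hasymm _ _ hgt), if_pos hgt, mul_inv_cancel₀ (hg0 _ h)]

end EllipticHyp

end

/-! ### The Weyl group of type E₇ -/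

noncomputable section

namespace EllipticHyp

open Filter Topology Set

/-! ### Simply laced root systems from a basis of simple roots -/

section SimplyLaced

variable {E : Type} [NormedAddCommGroup E] [InnerProductSpace ℝ E] {n : ℕ}
  (b : Module.Basis (Fin n) ℝ E)

/-- The lattice spanned by the simple roots. -/
def rootLattice : Submodule ℤ E := Submodule.span ℤ (range b)

/-- `b` consists of simple roots of squared length `2` with the Cartan matrix `A`. -/
structure IsSimplyLaced (A : Matrix (Fin n) (Fin n) ℤ) : Prop where
  inner_eq : ∀ i j, inner ℝ (b i) (b j) = (A i j : ℝ)
  diag : ∀ i, A i i = 2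
  nonpos : ∀ i j, i ≠ j → A i j ≤ 0

/-- The roots: the vectors of squared length `2` in the root lattice. -/
def rootSet : Set E := {x | x ∈ rootLattice b ∧ inner ℝ x x = (2 : ℝ)}

theorem basis_mem_rootLattice (i : Fin n) : b i ∈ rootLattice b :=
  Submodule.subset_span (mem_range_self i)

variable {b} {A : Matrix (Fin n) (Fin n) ℤ}

theorem IsSimplyLaced.exists_inner_eq (h : IsSimplyLaced b A) {x y : E} (hx : x ∈ rootLattice b)
    (hy : y ∈ rootLattice b) : ∃ m : ℤ, inner ℝ x y = (m : ℝ) := by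
  induction hx using Submodule.span_induction with
  | zero => exact ⟨0, by simp⟩
  | add u v _ _ hu hv =>
    obtain ⟨k, hk⟩ := hu
    obtain ⟨l, hl⟩ := hv
    exact ⟨k + l, by rw [inner_add_left, hk, hl]; push_cast; ring⟩
  | smul z u _ hu =>
    obtain ⟨k, hk⟩ := hu
    exact ⟨z * k, by rw [← Int.cast_smul_eq_zsmul ℝ, real_inner_smul_left, hk]; push_cast; ring⟩
  | mem u hu =>
    obtain ⟨i, rfl⟩ := hu
    induction hy using Submodule.span_induction with
    | zero => exact ⟨0, by simp⟩
    | add u v _ _ hu hv =>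
      obtain ⟨k, hk⟩ := hu
      obtain ⟨l, hl⟩ := hv
      exact ⟨k + l, by rw [inner_add_right, hk, hl]; push_cast; ring⟩
    | smul z u _ hu =>
      obtain ⟨k, hk⟩ := hu
      exact ⟨z * k, by rw [← Int.cast_smul_eq_zsmul ℝ, real_inner_smul_right, hk]; push_cast; ring⟩
    | mem u hu =>
      obtain ⟨j, rfl⟩ := hu
      exact ⟨A i j, h.inner_eq i j⟩

theorem IsSimplyLaced.exists_inner_self_eq (h : IsSimplyLaced b A) {x : E}
    (hx : x ∈ rootLattice b) : ∃ m : ℤ, inner ℝ x x = 2 * (m : ℝ) := by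
  induction hx using Submodule.span_induction with
  | zero => exact ⟨0, by simp⟩
  | add u v hu' hv' hu hv =>
    obtain ⟨k, hk⟩ := hu
    obtain ⟨l, hl⟩ := hv
    obtain ⟨m, hm⟩ := h.exists_inner_eq hu' hv'
    exact ⟨k + l + m, by rw [real_inner_add_add_self, hk, hl, hm]; push_cast; ring⟩
  | smul z u _ hu =>
    obtain ⟨k, hk⟩ := hu
    refine ⟨z * z * k, ?_⟩
    rw [← Int.cast_smul_eq_zsmul ℝ, real_inner_smul_left, real_inner_smul_right, hk]
    push_cast
    ring
  | mem u hu =>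
    obtain ⟨i, rfl⟩ := hu
    exact ⟨1, by rw [h.inner_eq, h.diag]; norm_num⟩

theorem IsSimplyLaced.two_le_inner_self (h : IsSimplyLaced b A) {x : E} (hx : x ∈ rootLattice b)
    (h0 : x ≠ 0) : 2 ≤ inner ℝ x x := by
  obtain ⟨m, hm⟩ := h.exists_inner_self_eq hx
  have h1 : 0 < inner ℝ x x := real_inner_self_pos.2 h0
  rw [hm] at h1 ⊢
  have : (0 : ℝ) < m := by linarith
  have : 1 ≤ m := by exact_mod_cast this
  have : (1 : ℝ) ≤ m := by exact_mod_cast this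
  linarith

theorem IsSimplyLaced.basis_mem_rootSet (h : IsSimplyLaced b A) (i : Fin n) : b i ∈ rootSet b :=
  ⟨basis_mem_rootLattice b i, by rw [h.inner_eq, h.diag]; norm_num⟩

theorem finite_rootSet [FiniteDimensional ℝ E] : (rootSet b).Finite := by
  have := FiniteDimensional.proper ℝ E
  refine (ZSpan.setFinite_inter b (s := Metric.closedBall 0 (Real.sqrt 2))
    Metric.isBounded_closedBall).subset fun x hx => ⟨?_, hx.1⟩
  rw [mem_closedBall_zero_iff, norm_eq_sqrt_real_inner, hx.2]

theorem IsSimplyLaced.reflect_mem (h : IsSimplyLaced b A) {x y : E} (hx : x ∈ rootSet b)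
    (hy : y ∈ rootSet b) : y - (inner ℝ x y : ℝ) • x ∈ rootSet b := by
  refine ⟨?_, ?_⟩
  · obtain ⟨m, hm⟩ := h.exists_inner_eq hx.1 hy.1
    rw [hm, Int.cast_smul_eq_zsmul]
    exact sub_mem hy.1 (Submodule.smul_mem _ _ hx.1)
  · rw [real_inner_sub_sub_self, real_inner_smul_right, real_inner_smul_left,
      real_inner_smul_right, hx.2, hy.2, real_inner_comm]
    ring

/-- Write x = P - N by the signs of the coefficients. The supports are disjoint, so ⟨P, N⟩ ≤ 0. If
both were non-zero, the squared length of x would be at least 2 + 2, the lattice being even. -/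
theorem IsSimplyLaced.mem_closure_or_neg_mem_closure (h : IsSimplyLaced b A) {x : E}
    (hx : x ∈ rootSet b) :
    x ∈ AddSubmonoid.closure (range b) ∨ -x ∈ AddSubmonoid.closure (range b) := by
  obtain ⟨c, hc⟩ := (Submodule.mem_span_range_iff_exists_fun ℤ).1 hx.1
  have hmem (f : Fin n → ℕ) : ∑ i, f i • b i ∈ AddSubmonoid.closure (range b) :=
    sum_mem fun i _ => nsmul_mem (AddSubmonoid.subset_closure (mem_range_self i)) _
  set P : E := ∑ i, (c i).toNat • b i with hP
  set N : E := ∑ i, (-c i).toNat • b i with hN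
  have hx' : x = P - N := by
    rw [← hc, hP, hN, ← Finset.sum_sub_distrib]
    refine Finset.sum_congr rfl fun i _ => ?_
    rw [← natCast_zsmul, ← natCast_zsmul, ← sub_smul, Int.toNat_sub_toNat_neg]
  have hlat {y : E} (hy : y ∈ AddSubmonoid.closure (range b)) : y ∈ rootLattice b :=
    (AddSubmonoid.closure_le (S := (rootLattice b).toAddSubmonoid)).2 Submodule.subset_span hy
  have hPN : inner ℝ P N ≤ 0 := by
    rw [hP, hN, sum_inner]
    refine Finset.sum_nonpos fun i _ => ?_
    rw [inner_sum]
    refine Finset.sum_nonpos fun j _ => ?_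
    rw [← Nat.cast_smul_eq_nsmul ℝ, ← Nat.cast_smul_eq_nsmul ℝ, real_inner_smul_left,
      real_inner_smul_right, h.inner_eq]
    rcases eq_or_ne i j with rfl | hij
    · rcases le_total 0 (c i) with hi | hi
      · rw [Int.toNat_of_nonpos (neg_nonpos.2 hi)]
        simp
      · rw [Int.toNat_of_nonpos hi]
        simp
    · refine mul_nonpos_of_nonneg_of_nonpos (by positivity)
        (mul_nonpos_of_nonneg_of_nonpos (by positivity) ?_)
      exact_mod_cast h.nonpos i j hij
  have h2 := hx.2
  rw [hx', real_inner_sub_sub_self] at h2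
  by_cases hP0 : P = 0
  · right
    rw [hx', hP0, zero_sub, neg_neg]
    exact hmem _
  · by_cases hN0 : N = 0
    · left
      rw [hx', hN0, sub_zero]
      exact hmem _
    · have := h.two_le_inner_self (hlat (hmem _)) hP0
      have := h.two_le_inner_self (hlat (hmem _)) hN0
      linarith

/-- The coroot of a root, as a linear form. -/
def corootEmbedding (b : Module.Basis (Fin n) ℝ E) : rootSet b ↪ Module.Dual ℝ E :=
  ⟨fun x => innerₗ E x.1, fun _ _ hxy => Subtype.ext <| ext_inner_right ℝ fun z =>
    LinearMap.congr_fun hxy z⟩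

theorem IsSimplyLaced.span_rootSet (h : IsSimplyLaced b A) :
    Submodule.span ℝ (range (Function.Embedding.subtype (· ∈ rootSet b))) = ⊤ := by
  refine top_le_iff.1 (b.span_eq.symm.le.trans (Submodule.span_mono ?_))
  rintro _ ⟨i, rfl⟩
  exact ⟨⟨b i, h.basis_mem_rootSet i⟩, rfl⟩

theorem IsSimplyLaced.mapsTo (h : IsSimplyLaced b A) (i : rootSet b) :
    MapsTo (Module.preReflection (Function.Embedding.subtype (· ∈ rootSet b) i)
      ((Module.Dual.eval ℝ E).flip (corootEmbedding b i)))
      (range (Function.Embedding.subtype (· ∈ rootSet b)))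
      (range (Function.Embedding.subtype (· ∈ rootSet b))) := by
  rintro _ ⟨y, rfl⟩
  exact ⟨⟨_, h.reflect_mem i.2 y.2⟩, rfl⟩

variable [FiniteDimensional ℝ E]

instance : Finite (rootSet b) := finite_rootSet.to_subtype

/-- The root system with the simple roots `b`. -/
def IsSimplyLaced.rootPairing (h : IsSimplyLaced b A) :
    RootPairing (rootSet b) ℝ E (Module.Dual ℝ E) :=
  RootPairing.mk'' (Module.Dual.eval ℝ E) (Function.Embedding.subtype (· ∈ rootSet b))
    (corootEmbedding b) (fun i => i.2.2) h.mapsTo h.span_rootSet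

theorem IsSimplyLaced.root_eq (h : IsSimplyLaced b A) (i : rootSet b) :
    h.rootPairing.root i = i := rfl

theorem IsSimplyLaced.coroot_eq (h : IsSimplyLaced b A) (i : rootSet b) :
    h.rootPairing.coroot i = innerₗ E i.1 := rfl

theorem IsSimplyLaced.isCrystallographic (h : IsSimplyLaced b A) :
    h.rootPairing.IsCrystallographic where
  exists_value i j := by
    obtain ⟨m, hm⟩ := h.exists_inner_eq j.2.1 i.2.1
    exact ⟨m, hm.symm⟩

theorem IsSimplyLaced.isRootSystem (h : IsSimplyLaced b A) : h.rootPairing.IsRootSystem :=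
  RootPairing.isRootSystem_mk'' fun i j => by
    obtain ⟨m, hm⟩ := h.exists_inner_eq j.2.1 i.2.1
    exact ⟨m, hm.symm⟩

theorem IsSimplyLaced.isReduced (h : IsSimplyLaced b A) : h.rootPairing.IsReduced where
  eq_or_eq_neg i j hij := by
    rw [h.root_eq, h.root_eq] at hij ⊢
    have hi : (i : E) ≠ 0 := fun h0 => by
      have := i.2.2
      rw [h0, inner_zero_left] at this
      norm_num at this
    rw [LinearIndependent.pair_iff' hi] at hij
    push Not at hij
    obtain ⟨c, hc⟩ := hij
    have := j.2.2
    rw [← hc, real_inner_smul_left, real_inner_smul_right, i.2.2] at this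
    rcases mul_self_eq_one_iff.1 (show c * c = 1 by linarith) with rfl | rfl
    · exact Or.inl (by rw [← hc, one_smul])
    · exact Or.inr (by rw [← hc, neg_smul, one_smul, neg_neg])

/-- The simple roots as roots. -/
def IsSimplyLaced.simpleRoot (h : IsSimplyLaced b A) : Fin n ↪ rootSet b :=
  ⟨fun i => ⟨b i, h.basis_mem_rootSet i⟩, fun _ _ hij => b.injective (congrArg Subtype.val hij)⟩

/-- The simple roots form a base. -/
def IsSimplyLaced.base (h : IsSimplyLaced b A) : h.rootPairing.Base where
  support := Finset.univ.map h.simpleRoot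
  linearIndepOn_root := by
    rw [Finset.coe_map, Finset.coe_univ, image_univ, linearIndepOn_range_iff h.simpleRoot.injective]
    exact b.linearIndependent
  linearIndepOn_coroot := by
    rw [Finset.coe_map, Finset.coe_univ, image_univ, linearIndepOn_range_iff h.simpleRoot.injective]
    refine b.linearIndependent.map' (innerₗ E) (LinearMap.ker_eq_bot.2 fun x y hxy => ?_)
    exact ext_inner_right ℝ fun z => LinearMap.congr_fun hxy z
  root_mem_or_neg_mem i := by
    have : h.rootPairing.root '' (Finset.univ.map h.simpleRoot : Finset (rootSet b)) = range b := by
      rw [Finset.coe_map, Finset.coe_univ, image_univ, ← range_comp]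
      rfl
    rw [this]
    exact h.mem_closure_or_neg_mem_closure i.2
  coroot_mem_or_neg_mem i := by
    have : h.rootPairing.coroot '' (Finset.univ.map h.simpleRoot : Finset (rootSet b)) =
        (innerₗ E).toAddMonoidHom '' range b := by
      rw [Finset.coe_map, Finset.coe_univ, image_univ, ← range_comp, ← range_comp]
      rfl
    rw [this, ← AddMonoidHom.map_mclosure, h.coroot_eq]
    rcases h.mem_closure_or_neg_mem_closure i.2 with hi | hi
    · exact Or.inl (AddSubmonoid.mem_map_of_mem _ hi)
    · exact Or.inr ⟨_, hi, map_neg _ _⟩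

theorem IsSimplyLaced.simpleRoot_mem (h : IsSimplyLaced b A) (i : Fin n) :
    h.simpleRoot i ∈ h.base.support :=
  Finset.mem_map_of_mem _ (Finset.mem_univ i)

/-- The numbering of the simple roots. -/
def IsSimplyLaced.baseEquiv (h : IsSimplyLaced b A) : h.base.support ≃ Fin n :=
  (Equiv.ofBijective (fun i => ⟨h.simpleRoot i, h.simpleRoot_mem i⟩)
    ⟨fun _ _ hij => h.simpleRoot.injective (congrArg Subtype.val hij), by
      rintro ⟨x, hx⟩
      obtain ⟨i, -, rfl⟩ := Finset.mem_map.1 hx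
      exact ⟨i, rfl⟩⟩).symm

theorem IsSimplyLaced.reindex_cartanMatrix (h : IsSimplyLaced b A) :
    haveI := h.isCrystallographic
    h.base.cartanMatrix.reindex h.baseEquiv h.baseEquiv = A := by
  have := h.isCrystallographic
  ext i j
  have h1 : (h.base.cartanMatrix (h.baseEquiv.symm i) (h.baseEquiv.symm j) : ℝ) = A i j := by
    rw [← h.inner_eq, real_inner_comm]
    exact h.base.algebraMap_cartanMatrixIn_apply ℤ _ _
  exact_mod_cast h1

theorem IsSimplyLaced.map_weylGroup (h : IsSimplyLaced b A) :
    h.rootPairing.weylGroup.map (RootPairing.Equiv.weightHom h.rootPairing) =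
      Subgroup.closure (range h.rootPairing.reflection) := by
  rw [← RootPairing.range_weylGroup_weightHom, MonoidHom.domRestrict_range]

/-- A group that contains the simple reflections and is generated by reflections in roots is the
Weyl group. -/
theorem IsSimplyLaced.isWeylGroupOfType (h : IsSimplyLaced b A) {G : Subgroup (E ≃ₗ[ℝ] E)}
    (h1 : ∀ i, ∃ g ∈ G, ∀ x, g x = x - (inner ℝ (b i) x : ℝ) • b i)
    (h2 : G ≤ Subgroup.closure {g | ∃ α ∈ rootSet b, ∀ x, g x = x - (inner ℝ α x : ℝ) • α}) :
    IsWeylGroupOfType A G := by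
  have := h.isCrystallographic
  have := h.isReduced
  refine ⟨rootSet b, inferInstance, h.rootPairing, h.isRootSystem, h.isCrystallographic,
    h.isReduced, h.base, h.baseEquiv, h.reindex_cartanMatrix, ?_⟩
  rw [h.map_weylGroup]
  refine le_antisymm ((Subgroup.closure_le _).2 ?_) (h2.trans (Subgroup.closure_mono ?_))
  · rintro _ ⟨i, rfl⟩
    have hs : ∀ i ∈ h.base.support, h.rootPairing.reflection i ∈ G := by
      intro i hi
      obtain ⟨i, -, rfl⟩ := Finset.mem_map.1 hi
      obtain ⟨g, hg, hgi⟩ := h1 i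
      have : h.rootPairing.reflection (h.simpleRoot i) = g := LinearEquiv.ext fun x => (hgi x).symm
      rwa [this]
    -- All roots are reached from simple ones by simple reflections and changes of sign, and the
    -- reflection in the image of a root is a conjugate of its reflection.
    refine h.base.induction_reflect (p := fun i => h.rootPairing.reflection i ∈ G) i
      (fun i hi => ?_) hs fun i j hi hj => ?_
    · rw [RootPairing.reflection_reflectionPerm]
      exact mul_mem (mul_mem hi hi) hi
    · rw [RootPairing.reflection_reflectionPerm]
      exact mul_mem (mul_mem (hs j hj) hi) (hs j hj)
  · rintro g ⟨α, hα, hg⟩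
    exact ⟨⟨α, hα⟩, LinearEquiv.ext fun x => (hg x).symm⟩

end SimplyLaced

/-! ### The root system of type `E₇` -/

/-- The vector `e_i - e_j` of `Y`. -/
def subVec (i j : Fin 8) : Y :=
  ⟨WithLp.toLp 2 fun k => (if k = i then 1 else 0) - if k = j then 1 else 0, by
    change ∑ k, (((if k = i then 1 else 0) - if k = j then 1 else 0 : ℝ)) = 0
    simp⟩

theorem subVec_apply (i j k : Fin 8) :
    (subVec i j).1 k = (if k = i then 1 else 0) - if k = j then 1 else 0 := rfl

theorem inner_subVec (i j : Fin 8) (x : Y) : inner ℝ (subVec i j) x = x.1 i - x.1 j := by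
  rw [inner_Y]
  simp [subVec_apply, sub_mul, Finset.sum_sub_distrib]

theorem perm_swap_apply {i j : Fin 8} (hij : i ≠ j) (x : Y) :
    perm (Equiv.swap i j) x = x - (inner ℝ (subVec i j) x : ℝ) • subVec i j := by
  ext k
  rw [inner_subVec]
  change x.1 (Equiv.swap i j k) = x.1 k - (x.1 i - x.1 j) * (subVec i j).1 k
  rw [subVec_apply, Equiv.swap_apply_def]
  rcases eq_or_ne k i with rfl | hki
  · simp [hij]
  · rcases eq_or_ne k j with rfl | hkj
    · simp [hki]
    · simp [hki, hkj]

/-- The simple roots of type `E₇`, in the order of Bourbaki. -/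
def simpleVec : Fin 7 → Y :=
  ![subVec 1 2, vVec, subVec 2 3, subVec 3 4, subVec 4 5, subVec 5 6, subVec 6 7]

theorem vVec_apply (k : Fin 8) : vVec.1 k = if k.val < 4 then -(1 / 2) else 1 / 2 := rfl

theorem sum_smul_simpleVec_apply (c : Fin 7 → ℝ) (k : Fin 8) : (∑ i, c i • simpleVec i).1 k =
    ![-c 1 / 2, -c 1 / 2 + c 0, -c 1 / 2 - c 0 + c 2, -c 1 / 2 - c 2 + c 3, c 1 / 2 - c 3 + c 4,
      c 1 / 2 - c 4 + c 5, c 1 / 2 - c 5 + c 6, c 1 / 2 - c 6] k := by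
  rw [Fin.sum_univ_seven]
  change c 0 * (subVec 1 2).1 k + c 1 * vVec.1 k + c 2 * (subVec 2 3).1 k + c 3 * (subVec 3 4).1 k +
    c 4 * (subVec 4 5).1 k + c 5 * (subVec 5 6).1 k + c 6 * (subVec 6 7).1 k = _
  simp only [subVec_apply, vVec_apply]
  fin_cases k <;> simp <;> ring

/-- The coordinates with respect to the simple roots. -/
def simpleCoord (x : Y) : Fin 7 → ℝ :=
  ![x.1 1 - x.1 0, -2 * x.1 0, x.1 1 + x.1 2 - 2 * x.1 0, x.1 1 + x.1 2 + x.1 3 - 3 * x.1 0,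
    x.1 1 + x.1 2 + x.1 3 + x.1 4 - 2 * x.1 0, x.1 1 + x.1 2 + x.1 3 + x.1 4 + x.1 5 - x.1 0,
    -x.1 0 - x.1 7]

theorem sum_simpleCoord_smul (x : Y) : ∑ i, simpleCoord x i • simpleVec i = x := by
  have hx := sum_Y x
  ext k
  rw [sum_smul_simpleVec_apply]
  fin_cases k <;> simp [simpleCoord] <;> linarith

theorem linearIndependent_simpleVec : LinearIndependent ℝ simpleVec := by
  rw [Fintype.linearIndependent_iff]
  intro c hc
  have h (k : Fin 8) := (sum_smul_simpleVec_apply c k).symm.trans (congrArg (fun x : Y => x.1 k) hc)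
  have h0 : -c 1 / 2 = 0 := h 0
  have h1 : -c 1 / 2 + c 0 = 0 := h 1
  have h2 : -c 1 / 2 - c 0 + c 2 = 0 := h 2
  have h3 : -c 1 / 2 - c 2 + c 3 = 0 := h 3
  have h4 : c 1 / 2 - c 3 + c 4 = 0 := h 4
  have h5 : c 1 / 2 - c 4 + c 5 = 0 := h 5
  have h6 : c 1 / 2 - c 5 + c 6 = 0 := h 6
  intro i
  fin_cases i <;> simp only [Fin.mk_zero, Fin.mk_one, Fin.reduceFinMk] <;> linarith

/-- The basis of simple roots. -/
def simpleBasis : Module.Basis (Fin 7) ℝ Y :=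
  Module.Basis.mk linearIndependent_simpleVec fun x _ => by
    rw [← sum_simpleCoord_smul x]
    exact sum_mem fun i _ => Submodule.smul_mem _ _ (Submodule.subset_span (mem_range_self i))

theorem inner_vVec (x : Y) : inner ℝ vVec x =
    (-x.1 0 - x.1 1 - x.1 2 - x.1 3 + x.1 4 + x.1 5 + x.1 6 + x.1 7) / 2 := by
  rw [inner_Y, Fin.sum_univ_eight]
  simp [vVec_apply]
  ring

theorem inner_simpleVec (i : Fin 7) (x : Y) : inner ℝ (simpleVec i) x =
    ![x.1 1 - x.1 2, (-x.1 0 - x.1 1 - x.1 2 - x.1 3 + x.1 4 + x.1 5 + x.1 6 + x.1 7) / 2,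
      x.1 2 - x.1 3, x.1 3 - x.1 4, x.1 4 - x.1 5, x.1 5 - x.1 6, x.1 6 - x.1 7] i := by
  fin_cases i
  · exact inner_subVec 1 2 x
  · exact inner_vVec x
  · exact inner_subVec 2 3 x
  · exact inner_subVec 3 4 x
  · exact inner_subVec 4 5 x
  · exact inner_subVec 5 6 x
  · exact inner_subVec 6 7 x

theorem isSimplyLaced_simpleBasis : IsSimplyLaced simpleBasis CartanMatrix.E₇ where
  inner_eq i j := by
    rw [simpleBasis, Module.Basis.mk_apply, Module.Basis.mk_apply, inner_simpleVec]
    fin_cases i <;> fin_cases j <;>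
      simp [simpleVec, subVec_apply, vVec_apply, CartanMatrix.E₇] <;> norm_num
  diag := by decide
  nonpos := by
    intro i j hij
    fin_cases i <;> fin_cases j <;> simp [CartanMatrix.E₇] at hij ⊢

/-- The only adjacent transposition whose root is not simple: the root is the negative of the
highest root, with the coefficients 2, 2, 3, 4, 3, 2, 1. -/
theorem subVec_zero_one_mem : subVec 0 1 ∈ rootSet simpleBasis := by
  refine ⟨?_, by rw [inner_subVec]; simp [subVec_apply]; norm_num⟩
  have h : subVec 0 1 = ∑ i, ((![-2, -2, -3, -4, -3, -2, -1] : Fin 7 → ℤ) i) • simpleBasis i := by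
    simp only [← Int.cast_smul_eq_zsmul ℝ]
    rw [simpleBasis]
    simp only [Module.Basis.mk_apply]
    ext k
    rw [sum_smul_simpleVec_apply, subVec_apply]
    fin_cases k <;> simp <;> norm_num
  rw [h]
  exact sum_mem fun i _ => Submodule.smul_mem _ _ (basis_mem_rootLattice _ i)

theorem perm_mul (σ τ : Equiv.Perm (Fin 8)) : perm (σ * τ) = perm τ * perm σ := by
  ext x k
  rfl

theorem subVec_castSucc_succ_mem (i : Fin 7) :
    subVec i.castSucc i.succ ∈ rootSet simpleBasis := by
  have h (j : Fin 7) := isSimplyLaced_simpleBasis.basis_mem_rootSet j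
  simp only [simpleBasis, Module.Basis.mk_apply] at h
  fin_cases i
  · exact subVec_zero_one_mem
  · exact h 0
  · exact h 2
  · exact h 3
  · exact h 4
  · exact h 5
  · exact h 6

/-- The simple reflections are six adjacent transpositions and the reflection in v. Conversely,
adjacent transpositions generate all permutations and are reflections in roots. -/
theorem isWeylGroupOfType_symmetryGroup : IsWeylGroupOfType CartanMatrix.E₇ symmetryGroup := by
  have hperm (σ) : perm σ ∈ symmetryGroup := Subgroup.subset_closure (Or.inr ⟨σ, rfl⟩)
  refine isSimplyLaced_simpleBasis.isWeylGroupOfType (fun i => ?_)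
    ((Subgroup.closure_le _).2 (union_subset ?_ ?_))
  · have hswap {j k : Fin 8} (hjk : j ≠ k) : ∃ g ∈ symmetryGroup,
        ∀ x, g x = x - (inner ℝ (subVec j k) x : ℝ) • subVec j k :=
      ⟨_, hperm (Equiv.swap j k), perm_swap_apply hjk⟩
    rw [simpleBasis, Module.Basis.mk_apply]
    fin_cases i
    · exact hswap (by decide)
    · exact ⟨refl, Subgroup.subset_closure (Or.inl rfl), refl_eq⟩
    all_goals exact hswap (by decide)
  · rintro _ rfl
    refine Subgroup.subset_closure ⟨vVec, ?_, refl_eq⟩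
    simpa [simpleBasis] using! isSimplyLaced_simpleBasis.basis_mem_rootSet 1
  · rintro _ ⟨σ, rfl⟩
    have hσ : σ ∈ Submonoid.closure (range fun i : Fin 7 => Equiv.swap i.castSucc i.succ) := by
      rw [Equiv.Perm.mclosure_swap_castSucc_succ]
      trivial
    induction hσ using Submonoid.closure_induction with
    | mem τ hτ =>
      obtain ⟨i, rfl⟩ := hτ
      exact Subgroup.subset_closure ⟨_, subVec_castSucc_succ_mem i,
        perm_swap_apply (Fin.castSucc_lt_succ (i := i)).ne⟩
    | one => exact one_mem _
    | mul τ ρ _ _ h1 h2 =>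
      rw [perm_mul]
      exact mul_mem h2 h1

end EllipticHyp

end

theorem mainTheorem4 (p q : ℂ) (hp0 : p ≠ 0) (hp1 : ‖p‖ < 1) (hq0 : q ≠ 0) (hq1 : ‖q‖ < 1) :
    -- the first transformation
    (∀ (t : Fin 8 → ℂ) (ε : ℂ), ∏ j, t j = p ^ 2 * q ^ 2 →
      ε ^ 2 = t 0 * t 1 * t 2 * t 3 / (p * q) →
      ∀ C C' : EllipticHyp.Contour,
        C.Separates p q t → C'.Separates p q (EllipticHyp.shift ε t) →
        EllipticHyp.V p q C t =
          (∏ j : Fin 4, ∏ k ∈ Finset.Ioi j,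
            EllipticHyp.Gam p q (t (Fin.castAdd 4 j) * t (Fin.castAdd 4 k)) *
              EllipticHyp.Gam p q (t (Fin.natAdd 4 j) * t (Fin.natAdd 4 k))) *
            EllipticHyp.V p q C' (EllipticHyp.shift ε t)) ∧
    -- the second transformation
    (∀ (t : Fin 8 → ℂ) (τ υ : ℂ), ∏ j, t j = p ^ 2 * q ^ 2 →
      τ ^ 2 = t 0 * t 1 * t 2 * t 3 → υ ^ 2 = t 4 * t 5 * t 6 * t 7 → τ * υ = p * q →
      ∀ C C' : EllipticHyp.Contour,
        C.Separates p q t → C'.Separates p q (EllipticHyp.invert τ υ t) →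
        EllipticHyp.V p q C t =
          (∏ j : Fin 4, ∏ k : Fin 4,
            EllipticHyp.Gam p q (t (Fin.castAdd 4 j) * t (Fin.natAdd 4 k))) *
            EllipticHyp.V p q C' (EllipticHyp.invert τ υ t)) ∧
    -- the third transformation
    (∀ (s : Fin 8 → ℂ) (σ : ℂ), ∏ j, s j = p ^ 2 * q ^ 2 → σ ^ 2 = p * q →
      ∀ C C' : EllipticHyp.Contour,
        C.Separates p q s → C'.Separates p q (fun j => σ / s j) →
        EllipticHyp.V p q C s =
          (∏ j, ∏ k ∈ Finset.Ioi j, EllipticHyp.Gam p q (s j * s k)) *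
            EllipticHyp.V p q C' (fun j => σ / s j)) ∧
    -- the parameter changes generate the Weyl group of type `E₇`
    EllipticHyp.IsWeylGroupOfType CartanMatrix.E₇ EllipticHyp.symmetryGroup ∧
    -- the coordinates `x` on the parameters, and the action of the generators on parameters
    (∀ c : ℂ, c ^ 4 = p * q →
      (∀ t : Fin 8 → ℂ, ∏ j, t j = p ^ 2 * q ^ 2 ↔
        ∃ a b : EllipticHyp.Y, t = EllipticHyp.param c a b) ∧
      (∀ (a b : EllipticHyp.Y) (σ : Equiv.Perm (Fin 8)),
        EllipticHyp.param c (EllipticHyp.perm σ a) (EllipticHyp.perm σ b) =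
          fun j => EllipticHyp.param c a b (σ j)) ∧
      (∀ a b : EllipticHyp.Y, ∃ ε : ℂ,
        ε ^ 2 = EllipticHyp.param c a b 0 * EllipticHyp.param c a b 1 *
          EllipticHyp.param c a b 2 * EllipticHyp.param c a b 3 / (p * q) ∧
        EllipticHyp.param c (EllipticHyp.refl a) (EllipticHyp.refl b) =
          EllipticHyp.shift ε (EllipticHyp.param c a b))) ∧
    -- the normalised function is invariant under this group
    (∃ r : ℂ → ℂ, EllipticHyp.IsSqrtGamma p q r) ∧
    (∀ (r : ℂ → ℂ) (c : ℂ), EllipticHyp.IsSqrtGamma p q r → c ^ 4 = p * q →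
      ∀ w ∈ EllipticHyp.symmetryGroup, ∀ (a b : EllipticHyp.Y) (C C' : EllipticHyp.Contour),
        C.Separates p q (EllipticHyp.param c a b) →
        C'.Separates p q (EllipticHyp.param c (w a) (w b)) →
        (∀ k l : Fin 8, k < l →
          EllipticHyp.Gam p q (EllipticHyp.param c a b k * EllipticHyp.param c a b l) ≠ 0) →
        EllipticHyp.normV p q r C' (EllipticHyp.param c (w a) (w b)) =
          EllipticHyp.normV p q r C (EllipticHyp.param c a b)) := by
  have adm {t : Fin 8 → ℂ} {C : EllipticHyp.Contour} (hC : C.Separates p q t) :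
      EllipticHyp.Admissible p q t :=
    ⟨_, (EllipticHyp.Chain.single_separates_iff C t).2 hC⟩
  -- The second and third transformations do not involve square roots, but they are derived from the
  -- covariance under -1, which is formulated with some choice of them.
  obtain ⟨r₀, hr₀⟩ := EllipticHyp.exists_isSqrtGamma hp0 hq0
  refine ⟨fun t ε hprod hε C C' hC hC' => ?_, fun t τ υ hprod hτ _ hτυ C C' hC hC' => ?_,
    fun s σ hprod hσ C C' hC hC' => ?_, EllipticHyp.isWeylGroupOfType_symmetryGroup,
    fun c hc => ⟨fun t => ⟨fun ht => ?_, ?_⟩, fun a b σ => rfl, fun a b => ?_⟩, ⟨r₀, hr₀⟩,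
    fun r c hr hc w hw a b C C' hC hC' h =>
      EllipticHyp.normV_eq hp1 hq1 hp0 hq0 hc hr hw hC hC' h⟩
  · rw [EllipticHyp.V_eq_hypI hp1 hq1 hC, EllipticHyp.V_eq_hypI hp1 hq1 hC',
      EllipticHyp.hypI_shift hp1 hq1 hp0 hq0 hprod hε (adm hC) (adm hC')]
    exact mul_left_comm _ _ _
  · rw [EllipticHyp.V_eq_hypI hp1 hq1 hC, EllipticHyp.V_eq_hypI hp1 hq1 hC',
      EllipticHyp.hypI_invert hp1 hq1 hp0 hq0 hr₀ hprod hτ hτυ (adm hC) (adm hC')]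
    exact mul_left_comm _ _ _
  · rw [EllipticHyp.V_eq_hypI hp1 hq1 hC, EllipticHyp.V_eq_hypI hp1 hq1 hC',
      EllipticHyp.hypI_div hp1 hq1 hp0 hq0 hr₀ hprod hσ (adm hC) (adm hC')]
    exact mul_left_comm _ _ _
  · refine EllipticHyp.exists_param_eq ?_ ?_
    · rintro rfl
      exact mul_ne_zero hp0 hq0 (by rw [← hc]; simp)
    · rw [ht, ← mul_pow, ← hc]
      ring
  · rintro ⟨a, b, rfl⟩
    rw [EllipticHyp.prod_param, ← mul_pow, ← hc]
    ring
  · rw [← hc]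
    refine EllipticHyp.exists_param_refl ?_ a b
    rintro rfl
    exact mul_ne_zero hp0 hq0 (by rw [← hc]; simp)
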